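/- **Setting.** Let $[k]=(q^k-q^{-k})/(q-q^{-1})\in\mathbb C(q)$. For $n\ge 0$ let $\mathrm{TL}^D_{n+1}$ be the $\mathbb C(q)$-algebra with generators $E_0,\dots,E_n$ and relations $E_i^2=-[2]E_i$; $E_iE_jE_i=E_i$ if $i,j$ are adjacent in the Dynkin diagram $D_{n+1}$ (nodes $0$ and $1$ are both joined to $2$, and $2-3-\cdots-n$ is a chain); $E_iE_j=E_jE_i$ otherwise. The Jones--Wenzl projections $Q_n\in \mathrm{TL}^D_{n+1}$ are the elements with $Q_n\neq0$, $Q_nQ_k=Q_kQ_n=Q_n$ for $0\le k\le n$, and $E_iQ_n=Q_nE_i=0$ for $0\le i\le n$. **Diagrams.** An $(n+1)$-strand diagram consists of $n+1$ marked points on the top and on the bottom, numbered $1,\dots,n+1$ from the left, joined in pairs by non-crossing arcs (cups joining two top points, caps joining two bottom points, vertical strands), each arc carrying at most one dot, such that: the number of dots is one or even; if it is even, dots lie only on outer-most cups and caps (not enclosed by another one and with no vertical strand to their left) or on the left-most vertical strand; if it is one, the dot lies on the arc through the left-most bottom point; the diagram consisting of $n+1$ vertical strands has no dot. A reduced word (one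 that is not a scalar multiple of a shorter word) $E_{s_1}\cdots E_{s_l}$ has a diagram: stack the diagrams of the generators from top to bottom, where $E_i$ ($i\ge1$) has an undotted cup and an undotted cap joining the points $i,i+1$ and vertical strands elsewhere, and $E_0$ is $E_1$ with a dot on the cup and on the cap; delete loops, cancel pairs of dots on the same arc, and if the total number of dots is odd, replace the dots by a single dot on the arc through the left-most bottom point. The coefficient $\mathrm{coef}_n(D)$ of a diagram $D$ in $Q_n$ is the coefficient, in the expansion of $Q_n$ in the elements given by reduced words, of the element $E_w$, where $w$ is a reduced word with diagram $D$. **Removal.** An inner-most cap of $D$ has position $i\le n$ if it joins the bottom points $i,i+1$; a vertical strand joining the right-most top and bottom points counts as an inner-most cap of position $n+1$. Let $I(D)\subseteq[1,n+1]$ be the set of positions of inner-most caps, dotted or not. For $i\in I(D)$ let $D_i$ be the $n$-strand connectivity obtained by deleting that cap (for $i\le n$ the right-most top point then becomes the right-most bottom point). Let $\mathcal D^e_i$ be the set of $n$-strand diagrams with connectivity $D_i$ and an even number of dots, and $D_i^{\mathrm{odd}}$ the diagram with connectivity $D_i$ and a unique dot; if $D_i$ consists of $n$ vertical strands, there is no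 $D_i^{\mathrm{odd}}$ and we put $\mathrm{coef}_{n-1}(D_i^{\mathrm{odd}})=0$. **Proposition.** The coefficients are well defined: for every diagram $D$ there is exactly one value $\mathrm{coef}_n(D)$. If $D$ is an $(n+1)$-strand diagram with a unique dot (so $n\ge 1$), then $$\mathrm{coef}_n(D)=\sum_{i\in I(D)}\mathrm{coef}(h_{n,i})\Big(\sum_{D'\in\mathcal D^e_i}\mathrm{coef}_{n-1}(D')-[2]\,\mathrm{coef}_{n-1}(D_i^{\mathrm{odd}})\Big)+\sum_{i\in I(D)}2^{\delta(i=1)}\,\mathrm{coef}(g_{n,i})\,\mathrm{coef}_{n-1}(D_i^{\mathrm{odd}}),$$ where $$\mathrm{coef}(g_{n,1})=\frac{[n]}{[2n]},\qquad \mathrm{coef}(g_{n,i})=\frac{[n][2i-2]}{[2n][i-1]}\ (2\le i\le n+1),\qquad \mathrm{coef}(h_{n,j})=\frac{[n][n+1-j]}{[2n][n+1]}\ (1\le j\le n+1),$$ so that $\mathrm{coef}(h_{n,n+1})=0$. -/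

import Mathlib

namespace TLTypeD

noncomputable section

/-! ### The ground field and quantum integers -/

/-- The field `ℂ(q)` of rational functions. -/
abbrev K : Type := RatFunc ℂ

/-- The indeterminate `q`. -/
def q : K := RatFunc.X

/-- The quantum integer `[k] = (q ^ k - q ^ (-k)) / (q - q⁻¹)`. -/
def qInt (k : ℤ) : K := (q ^ k - q ^ (-k)) / (q - q⁻¹)

/-- `coef(g_{n,i})`, used for `1 ≤ i ≤ n + 1`. -/
def coefG (n i : ℕ) : K :=
  if i = 1 then qInt n / qInt (2 * n)
  else (qInt n * qInt (2 * i - 2)) / (qInt (2 * n) * qInt (i - 1))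

/-- `coef(h_{n,j})`; it vanishes for `j = n + 1`. -/
def coefH (n j : ℕ) : K :=
  (qInt n * qInt (n + 1 - j)) / (qInt (2 * n) * qInt (n + 1))

/-! ### The Temperley--Lieb algebra of type `D` -/

/-- Adjacency in the Dynkin diagram of type `D` with nodes `0, 1, 2, …`: the nodes `0` and `1` are
both joined to `2`, and `2 - 3 - 4 - ⋯` is a chain. -/
def Adj (i j : ℕ) : Prop :=
  (1 ≤ i ∧ j = i + 1) ∨ (1 ≤ j ∧ i = j + 1) ∨ (i = 0 ∧ j = 2) ∨ (i = 2 ∧ j = 0)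

/-- The defining relations for the generators `E_0, …, E_{m-1}`. -/
inductive Rel (m : ℕ) : FreeAlgebra K (Fin m) → FreeAlgebra K (Fin m) → Prop
  | sq (i : Fin m) :
      Rel m (FreeAlgebra.ι K i * FreeAlgebra.ι K i) ((-qInt 2) • FreeAlgebra.ι K i)
  | braid (i j : Fin m) (h : Adj i j) :
      Rel m (FreeAlgebra.ι K i * FreeAlgebra.ι K j * FreeAlgebra.ι K i) (FreeAlgebra.ι K i)
  | comm (i j : Fin m) (h : ¬ Adj i j) :
      Rel m (FreeAlgebra.ι K i * FreeAlgebra.ι K j) (FreeAlgebra.ι K j * FreeAlgebra.ι K i)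

/-- The Temperley--Lieb algebra of type `D_m`, with generators `E_0, …, E_{m-1}`; its diagrams have
`m` strands. -/
abbrev TLD (m : ℕ) : Type := RingQuot (Rel m)

/-- The generator `E_i`. -/
def E {m : ℕ} (i : Fin m) : TLD m := RingQuot.mkAlgHom K (Rel m) (FreeAlgebra.ι K i)

/-- The word `E_w = E_{s_1} ⋯ E_{s_l}`. -/
def word {m : ℕ} (w : List (Fin m)) : TLD m := (w.map E).prod

/-- `w` is a reduced expression: up to a scalar, `E_w` is not a word with fewer generators. -/
def IsReduced {m : ℕ} (w : List (Fin m)) : Prop :=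
  ∀ (v : List (Fin m)) (c : K), v.length < w.length → word w ≠ c • word v

/-- The natural homomorphism `TL^D_k → TL^D_m` for `k ≤ m`, sending `E_i` to `E_i`. -/
def incl {k m : ℕ} (h : k ≤ m) : TLD k →ₐ[K] TLD m :=
  RingQuot.liftAlgHom K ⟨FreeAlgebra.lift K (fun i => E (Fin.castLE h i)), by
    intro x y hxy
    cases hxy with
    | sq i =>
      simpa [E] using RingQuot.mkAlgHom_rel K (Rel.sq (Fin.castLE h i))
    | braid i j hij =>
      simpa [E] using RingQuot.mkAlgHom_rel K
        (Rel.braid (Fin.castLE h i) (Fin.castLE h j) (by simpa using hij))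
    | comm i j hij =>
      simpa [E] using RingQuot.mkAlgHom_rel K
        (Rel.comm (Fin.castLE h i) (Fin.castLE h j) (by simpa using hij))⟩

/-- `Q` is the family of Jones--Wenzl projections of type `D`, indexed by the number of strands:
`Q (n + 1) ∈ TL^D_{n+1}` is the projection usually written `Q_n`. (For zero strands the algebra is
the ground field and the conditions say `Q 0 = 1`.) -/
structure IsJonesWenzl (Q : ∀ m : ℕ, TLD m) : Prop where
  ne_zero : ∀ m, Q m ≠ 0
  mul_incl : ∀ (k m : ℕ) (h : k ≤ m), Q m * incl h (Q k) = Q m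
  incl_mul : ∀ (k m : ℕ) (h : k ≤ m), incl h (Q k) * Q m = Q m
  gen_mul : ∀ (m : ℕ) (i : Fin m), E i * Q m = 0
  mul_gen : ∀ (m : ℕ) (i : Fin m), Q m * E i = 0

/-! ### Dotted Temperley--Lieb diagrams

The `2 * m` marked points of an `m`-strand diagram are numbered along the boundary: the top points
from left to right are `0, …, m - 1`, and then the bottom points from right to left are
`m, …, 2 * m - 1`. So the `j`-th bottom point from the left (`1 ≤ j ≤ m`) is `2 * m - j`. -/

/-- Connectivity and dots: `partner p` is the other endpoint of the arc (cup, cap or vertical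
strand) at `p`, and `dot p` says whether that arc carries a dot. -/
@[ext]
structure Raw (m : ℕ) where
  partner : Fin (2 * m) → Fin (2 * m)
  dot : Fin (2 * m) → Bool

/-- The number of dots; every arc has two endpoints. -/
def Raw.numDots {m : ℕ} (D : Raw m) : ℕ := (Finset.univ.filter fun p => D.dot p = true).card / 2

/-- The identity diagram: `m` vertical strands without dots. -/
def Raw.one (m : ℕ) : Raw m := ⟨Fin.rev, fun _ => false⟩

/-- The arc at `p` is outer-most: no other arc lies between it and the left edge of the diagram.
(For a cup or a cap: there is no larger one outside it, and no vertical strand to its left; for a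
vertical strand: it is the left-most one.) -/
def Raw.IsOuter {m : ℕ} (D : Raw m) (p : Fin (2 * m)) : Prop :=
  ∀ r, ¬ (r < min p (D.partner p) ∧ max p (D.partner p) < D.partner r)

/-- The arc at `p` has the left-most bottom point as one of its endpoints. -/
def IsFirstBottom {m : ℕ} (partner : Fin (2 * m) → Fin (2 * m)) (p : Fin (2 * m)) : Prop :=
  (p : ℕ) = 2 * m - 1 ∨ (partner p : ℕ) = 2 * m - 1

/-- An `m`-strand Temperley--Lieb diagram of type `D`. -/
structure Diagram (m : ℕ) extends Raw m where
  partner_partner : ∀ p, partner (partner p) = p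
  partner_ne : ∀ p, partner p ≠ p
  /-- Arcs do not cross. -/
  noncrossing : ∀ p r, ¬ (p < r ∧ r < partner p ∧ partner p < partner r)
  dot_partner : ∀ p, dot (partner p) = dot p
  /-- The number of dots is one or even. -/
  dots_one_or_even : toRaw.numDots = 1 ∨ Even toRaw.numDots
  /-- If it is even, all dots are on outer-most cups, outer-most caps or the left-most vertical
  strand. -/
  dots_even : Even toRaw.numDots → ∀ p, dot p = true → toRaw.IsOuter p
  /-- If it is one, the dot is on the arc at the left-most bottom point. -/
  dots_one : toRaw.numDots = 1 → ∀ p, dot p = true → IsFirstBottom partner p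
  /-- If all strands are vertical, there is no dot. -/
  dots_identity : partner = (Raw.one m).partner → ∀ p, dot p = false

theorem Diagram.toRaw_injective (m : ℕ) : Function.Injective (Diagram.toRaw (m := m)) := by
  rintro ⟨D, _⟩ ⟨D', _⟩ h
  cases h
  rfl

instance (m : ℕ) : Finite (Raw m) :=
  Finite.of_injective (fun D : Raw m => (D.partner, D.dot)) fun D D' h => by
    simp only [Prod.mk.injEq] at h
    exact Raw.ext h.1 h.2

instance (m : ℕ) : Finite (Diagram m) := Finite.of_injective _ (Diagram.toRaw_injective m)

instance (m : ℕ) : Fintype (Diagram m) := Fintype.ofFinite _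

/-! ### The diagram of a reduced word -/

/-- Put `D` on top of the diagram of `E_s`. With `j = s` for `s ≥ 1` and `j = 1` for `s = 0`, the
diagram of `E_s` has a cup and a cap joining the points `j` and `j + 1`, and otherwise vertical
strands; the cup and the cap carry a dot exactly if `s = 0`. Here `a` and `b` are the bottom points
`j` and `j + 1`. They get joined by the cap of `E_s`, while the arcs of `D` ending there are joined
by the cup of `E_s`: either into one arc, on which two dots cancel, or into a loop, which is
deleted. -/
def Raw.stack {m : ℕ} (D : Raw m) (s : Fin m) : Raw m :=
  let a : Fin (2 * m) := ⟨2 * m - max (s : ℕ) 1, by have := s.isLt; omega⟩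
  let b : Fin (2 * m) := ⟨2 * m - max (s : ℕ) 1 - 1, by have := s.isLt; omega⟩
  let e : Bool := decide ((s : ℕ) = 0)
  { partner := fun p =>
      if p = a then b
      else if p = b then a
      else if p = D.partner a then D.partner b
      else if p = D.partner b then D.partner a
      else D.partner p
    dot := fun p =>
      if p = a ∨ p = b then e
      else if p = D.partner a ∨ p = D.partner b then (D.dot a ^^ (e ^^ D.dot b))
      else D.dot p }

open Classical in
/-- The diagram with the given connectivity and a single dot, on the arc at the left-most bottom
point. -/
def oddDiagram {m : ℕ} (partner : Fin (2 * m) → Fin (2 * m)) : Raw m :=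
  ⟨partner, fun p => decide (IsFirstBottom partner p)⟩

open Classical in
/-- If the number of dots is odd, replace them by a single dot at the prescribed place. -/
def Raw.normalize {m : ℕ} (D : Raw m) : Raw m :=
  if Odd D.numDots then oddDiagram D.partner else D

/-- The diagram of the word `E_w`; only used for reduced words. -/
def diagramOf {m : ℕ} (w : List (Fin m)) : Raw m :=
  (w.foldl Raw.stack (Raw.one m)).normalize

/-! ### Coefficients -/

/-- `f` is an expansion of `x` as a linear combination of reduced words. -/
def IsExpansion {m : ℕ} (x : TLD m) (f : TLD m →₀ K) : Prop :=
  (∀ y ∈ f.support, ∃ w : List (Fin m), IsReduced w ∧ word w = y) ∧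
    (f.sum fun y c => c • y) = x

/-- `a` is the coefficient of the diagram `D` in `x`, that is, the coefficient of the element `E_w`,
`w` a reduced word with diagram `D`, in an expansion of `x` into reduced words. -/
def IsCoeff {m : ℕ} (x : TLD m) (D : Raw m) (a : K) : Prop :=
  ∃ f : TLD m →₀ K, IsExpansion x f ∧
    ∃ w : List (Fin m), IsReduced w ∧ diagramOf w = D ∧ f (word w) = a

/-- The coefficient of the diagram `D` in `x`. -/
def coef {m : ℕ} (x : TLD m) (D : Raw m) : K := Classical.epsilon fun a => IsCoeff x D a

/-! ### Removing inner-most caps -/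

open Classical in
/-- `I(D)`: the positions of the inner-most caps, with or without a dot. A position `i < m` is a cap
joining the bottom points `i` and `i + 1`; the position `m` is a vertical strand joining the
right-most points `m - 1` (top) and `m` (bottom). -/
def Raw.positions {m : ℕ} (D : Raw m) : Finset ℕ :=
  (Finset.Icc 1 m).filter fun i =>
    ∃ p : Fin (2 * m), (p : ℕ) = 2 * m - i ∧ (D.partner p : ℕ) = 2 * m - i - 1

/-- The connectivity of `D_i`: the inner-most cap at position `i` is deleted, and the remaining
`2 * n` marked points are renumbered along the boundary. (For `i ≤ n` this turns the right-most top
point into the right-most bottom point.) -/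
def Raw.remove {n : ℕ} (D : Raw (n + 1)) (i : ℕ) (p : Fin (2 * n)) : Fin (2 * n) :=
  let b := 2 * n + 1 - i
  let p' : Fin (2 * (n + 1)) :=
    if (p : ℕ) < b then ⟨p, by omega⟩ else ⟨p + 2, by omega⟩
  let r : ℕ := D.partner p'
  let r' : ℕ := if r < b then r else r - 2
  if h : r' < 2 * n then ⟨r', h⟩ else p

open Classical in
/-- The set of diagrams with a given connectivity and an even number of dots. -/
def evenLifts {m : ℕ} (partner : Fin (2 * m) → Fin (2 * m)) : Finset (Diagram m) :=
  Finset.univ.filter fun D' => D'.partner = partner ∧ Even D'.numDots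

open Classical in
/-- The coefficient in `x` of the diagram with the given connectivity and a unique dot; it is `0` if
the connectivity is that of the identity, where there is no such diagram. -/
def coefOdd {m : ℕ} (x : TLD m) (partner : Fin (2 * m) → Fin (2 * m)) : K :=
  if partner = (Raw.one m).partner then 0 else coef x (oddDiagram partner)

end

end TLTypeD

open TLTypeD

open TLTypeD

namespace TLTypeD

noncomputable section

/-! The recursion comes from the factorisation `Q (n + 1) = P * cosetSum`, where `P` is the image of
`Q n` in the algebra on `n + 1` strands (and `P = 1` if `n = 1`). As a left module over the algebra
on `n` strands, the larger algebra is spanned by three families of coset words: `desc` (`e n ⋯ e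
i`), `descZero` (`e n ⋯ e 2 * e 0`) and `valley` (`e n ⋯ e 2 * e 1 * e 0 * e 2 ⋯ e i`). Right
multiplication by `e s` sends a coset word to a neighbouring one, or multiplies it by the loop
value, or produces a word that starts with a generator of the smaller algebra and is therefore
killed by `P`. So `P * cosetSum * e s = 0` amounts to three-term recursions for the coefficients
(`TLRel.CoefRel`, `TLRel.cosetSum_mul_gen`), which `coefG` and `coefH` satisfy by the Chebyshev
recursion of quantum integers (`coefRel`). An element killed by all generators on the right and with
coefficient `1` at the identity must be the Jones--Wenzl projection (`IsJonesWenzl.eq_of_mul_gen`).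

Coefficients are read off in a diagram module. A `State` is a matching with dots together with a
`tag` recording one dotted loop; in its presence dots no longer matter, and a second dotted loop
costs `-[2]`. Tagged states stand for diagrams with an odd number of dots. Letting `x` act on the
identity gives `expand m x`. This map is injective: by induction on the number of strands, every
planar state comes from a word in normal form, and these words span (`LowerBasis.hasBasis`,
`expand_injective`). Hence a reduced word never closes a loop at the price of a scalar, its
expansion is the single state of its diagram, and the coefficient of a diagram is the value of
`expand` at its state (`isCoeff_iff`). This also proves that coefficients are well defined.

In diagrams, multiplying by `desc`, `descZero` and `valley` inserts a cap at position `i`, a dotted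
cap at position `1`, and a cap together with a dotted loop (`insL`, `insDotL`, `insTagL`). At a
tagged state the first two give the coefficient of the odd diagram on `n` strands, twice for `i =
1`. The third collects every dotting of the remaining connectivity: even ones with weight `1`, the
odd one with weight `-[2]` (`insTagL_apply_insert`). Summing over the caps that can be removed gives
the formula. -/

/-! ### Coset words in an algebra with type `D` Temperley--Lieb generators -/

/-- The elements `e 0, …, e n` satisfy the Temperley--Lieb relations of type `D_{n+1}`, with loop
parameter `δ`. -/
structure TLRel {R : Type*} [Ring R] [Algebra K R] (δ : K) (n : ℕ) (e : ℕ → R) : Prop where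
  sq : ∀ i, i ≤ n → e i * e i = δ • e i
  comm : ∀ i j, i ≤ n → j ≤ n → ¬ Adj i j → e i * e j = e j * e i
  braid : ∀ i j, i ≤ n → j ≤ n → Adj i j → e i * e j * e i = e i

section Coset

variable {R : Type*} [Ring R]

/-- Auxiliary descending product `e n * e (n - 1) * ⋯` with `k` factors. -/
def descAux (e : ℕ → R) (n : ℕ) : ℕ → R
  | 0 => 1
  | k + 1 => descAux e n k * e (n - k)

/-- The descending product `e n * e (n - 1) * ⋯ * e i`. -/
def desc (e : ℕ → R) (n i : ℕ) : R := descAux e n (n + 1 - i)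

/-- The products `e n ⋯ e 2 * e 1 * e 0 * e 2 ⋯ e i`, for `1 ≤ i`. -/
def valley (e : ℕ → R) (n : ℕ) : ℕ → R
  | 0 => 0
  | 1 => desc e n 1 * e 0
  | i + 2 => valley e n (i + 1) * e (i + 2)

/-- The product `e n ⋯ e 2 * e 0`. -/
def descZero (e : ℕ → R) (n : ℕ) : R := desc e n 2 * e 0

variable (e : ℕ → R) (n : ℕ)

@[simp] lemma desc_top : desc e n (n + 1) = 1 := by simp [desc, descAux]

lemma desc_eq {i : ℕ} (hi : i ≤ n) : desc e n i = desc e n (i + 1) * e i := by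
  have h : n + 1 - i = (n + 1 - (i + 1)) + 1 := by omega
  have h2 : n - (n + 1 - (i + 1)) = i := by omega
  unfold desc
  rw [h, descAux, h2]

lemma valley_one : valley e n 1 = desc e n 1 * e 0 := rfl

lemma valley_succ {i : ℕ} (hi : 1 ≤ i) : valley e n (i + 1) = valley e n i * e (i + 1) := by
  obtain ⟨j, rfl⟩ := Nat.exists_eq_add_of_le' hi
  rfl

end Coset

namespace TLRel

variable {R : Type*} [Ring R] [Algebra K R] {δ : K} {n : ℕ} {e : ℕ → R}

/-- The subalgebra generated by `e 0, …, e (n - 1)` if `2 ≤ n`, and the scalars if `n ≤ 1`. -/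
def sub (n : ℕ) (e : ℕ → R) : Subalgebra K R :=
  -- For `n = 1` the element `e 0` is itself the coset word `descZero e 1`, so it must not be
  -- counted among the left coefficients as well.
  Algebra.adjoin K (e '' {t | t < n ∧ 2 ≤ n})

lemma mem_sub {t : ℕ} (ht : t < n) (hn : 2 ≤ n) : e t ∈ sub n e :=
  Algebra.subset_adjoin ⟨t, ⟨ht, hn⟩, rfl⟩

/-- The bound `3 ≤ k` only matters for `i = 0`, since node `0` is adjacent to node `2`. -/
lemma desc_comm (H : TLRel δ n e) {i k : ℕ} (hk : k ≤ n + 1) (h : i + 2 ≤ k) (h3 : 3 ≤ k) :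
    e i * desc e n k = desc e n k * e i := by
  induction hk using Nat.decreasingInduction with
  | self => simp
  | of_succ k hk ih =>
    have hk' : k ≤ n := by omega
    rw [desc_eq e n hk', ← mul_assoc, ih (by omega) (by omega), mul_assoc, mul_assoc,
      H.comm i k (by omega) hk' (by unfold Adj; omega)]

lemma desc_mul_self (H : TLRel δ n e) {i : ℕ} (hi : i ≤ n) :
    desc e n i * e i = δ • desc e n i := by
  rw [desc_eq e n hi, mul_assoc, H.sq i hi, mul_smul_comm]

lemma desc_mul_succ (H : TLRel δ n e) {i : ℕ} (hi : i + 1 ≤ n) (h1 : 1 ≤ i) :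
    desc e n i * e (i + 1) = desc e n (i + 1) := by
  rw [desc_eq e n (by omega : i ≤ n), desc_eq e n hi, mul_assoc, mul_assoc, ← mul_assoc (e (i + 1)),
    H.braid (i + 1) i hi (by omega) (by unfold Adj; omega)]

/-- `z` lies in the left module generated by `desc e n s`, with a coefficient that starts with one
of the generators `e 0, …, e (n - 1)`. -/
def Lower (n : ℕ) (e : ℕ → R) (s : ℕ) (z : R) : Prop :=
  -- The leading factor `e t` is the point: any `P` with `P * e t = 0` kills `z`.
  ∃ t y, t < n ∧ 2 ≤ n ∧ y ∈ sub n e ∧ z = e t * y * desc e n s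

lemma Lower.mul_comm_gen (H : TLRel δ n e) {s i : ℕ} {z : R} (h : Lower n e s z) (hs : s ≤ n + 1)
    (hi : i + 2 ≤ s) (h3 : 3 ≤ s) : Lower n e s (z * e i) := by
  obtain ⟨t, y, ht, hn, hy, rfl⟩ := h
  refine ⟨t, y * e i, ht, hn, Subalgebra.mul_mem _ hy (mem_sub (by omega) hn), ?_⟩
  rw [mul_assoc, ← H.desc_comm hs hi h3]
  simp only [mul_assoc]

lemma Lower.mul_succ (H : TLRel δ n e) {s : ℕ} {z : R} (h : Lower n e s z) (hs : s + 1 ≤ n)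
    (h1 : 1 ≤ s) : Lower n e (s + 1) (z * e (s + 1)) := by
  obtain ⟨t, y, ht, hn, hy, rfl⟩ := h
  exact ⟨t, y, ht, hn, hy, by rw [mul_assoc, H.desc_mul_succ hs h1]⟩

lemma lower_comm (H : TLRel δ n e) {i s : ℕ} (hi : i + 2 ≤ s) (h3 : 3 ≤ s) (hs : s ≤ n + 1) :
    Lower n e s (desc e n s * e i) :=
  ⟨i, 1, by omega, by omega, Subalgebra.one_mem _, by rw [mul_one, H.desc_comm hs hi h3]⟩

/-- The factor `e s` moves left to meet `e s * e (s - 1)`, and the braid relation removes `e (s -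
1)`. This leaves a gap in the word, across which the tail `e (s - 2) ⋯ e i` commutes to the far
left. -/
lemma desc_mul_far (H : TLRel δ n e) {i s : ℕ} (h1 : 1 ≤ i) (hi : i + 2 ≤ s) (hs : s ≤ n) :
    Lower n e s (desc e n i * e s) := by
  have hi' : i ≤ s - 2 := by omega
  induction hi' using Nat.decreasingInduction with
  | self =>
    obtain ⟨s, rfl⟩ := Nat.exists_eq_add_of_le' (by omega : 2 ≤ s)
    simp only [Nat.add_sub_cancel] at *
    rw [desc_eq e n (by omega), mul_assoc, H.comm s (s + 2) (by omega) hs (by unfold Adj; omega),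
      ← mul_assoc, H.desc_mul_succ hs (by omega)]
    exact H.lower_comm (by omega) (by omega) (by omega)
  | of_succ i hi' ih =>
    rw [desc_eq e n (by omega), mul_assoc, H.comm i s (by omega) hs (by unfold Adj; omega),
      ← mul_assoc]
    exact (ih (by omega) (by omega)).mul_comm_gen H (by omega) (by omega) (by omega)

lemma desc_mul_zero (H : TLRel δ n e) {i : ℕ} (hi : 3 ≤ i) (hs : i ≤ n + 1) :
    Lower n e i (desc e n i * e 0) := H.lower_comm (by omega) hi hs

lemma descZero_mul_zero (H : TLRel δ n e) : descZero e n * e 0 = δ • descZero e n := by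
  rw [descZero, mul_assoc, H.sq 0 (by omega), mul_smul_comm]

lemma valley_one_eq (H : TLRel δ n e) (hn : 1 ≤ n) : valley e n 1 = descZero e n * e 1 := by
  rw [valley_one, descZero, desc_eq e n hn, mul_assoc, mul_assoc,
    H.comm 0 1 (by omega) hn (by unfold Adj; omega)]

lemma descZero_mul_two (H : TLRel δ n e) (hn : 2 ≤ n) : descZero e n * e 2 = desc e n 2 := by
  rw [descZero, desc_eq e n hn, mul_assoc, mul_assoc, ← mul_assoc (e 2),
    H.braid 2 0 hn (by omega) (by unfold Adj; omega)]

lemma descZero_mul_far (H : TLRel δ n e) {s : ℕ} (h3 : 3 ≤ s) (hs : s ≤ n) :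
    Lower n e s (descZero e n * e s) := by
  rw [descZero, mul_assoc, H.comm 0 s (by omega) hs (by unfold Adj; omega), ← mul_assoc]
  rcases Nat.lt_or_ge 3 s with h | h
  · exact (H.desc_mul_far (by omega) h hs).mul_comm_gen H (by omega) (by omega) (by omega)
  · obtain rfl : s = 3 := by omega
    rw [H.desc_mul_succ hs (by omega)]
    exact H.desc_mul_zero (by omega) (by omega)

lemma valley_mul_self (H : TLRel δ n e) {i : ℕ} (h1 : 1 ≤ i) (hi : i ≤ n) :
    valley e n i * e i = δ • valley e n i := by
  rcases Nat.lt_or_ge 1 i with h | h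
  · obtain ⟨i, rfl⟩ := Nat.exists_eq_add_of_le' h1
    rw [valley_succ e n (by omega), mul_assoc, H.sq _ hi, mul_smul_comm]
  · obtain rfl : i = 1 := by omega
    rw [H.valley_one_eq hi, mul_assoc, H.sq _ hi, mul_smul_comm]

lemma valley_one_mul_zero (H : TLRel δ n e) : valley e n 1 * e 0 = δ • valley e n 1 := by
  rw [valley_one, mul_assoc, H.sq 0 (by omega), mul_smul_comm]

lemma valley_succ_mul (H : TLRel δ n e) {i : ℕ} (h1 : 1 ≤ i) (hi : i + 1 ≤ n) :
    valley e n (i + 1) * e i = valley e n i := by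
  rcases Nat.lt_or_ge 1 i with h | h
  · obtain ⟨i, rfl⟩ := Nat.exists_eq_add_of_le' h1
    rw [valley_succ e n (by omega), valley_succ e n (by omega), mul_assoc, mul_assoc,
      ← mul_assoc (e (i + 1)), H.braid (i + 1) (i + 1 + 1) (by omega) hi (by unfold Adj; omega)]
  · obtain rfl : i = 1 := by omega
    rw [valley_succ e n le_rfl, H.valley_one_eq (by omega), mul_assoc, mul_assoc, ← mul_assoc (e 1),
      H.braid 1 2 (by omega) hi (by unfold Adj; omega)]

lemma valley_two_mul_zero (H : TLRel δ n e) (hi : 2 ≤ n) :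
    valley e n 2 * e 0 = valley e n 1 := by
  rw [valley_succ e n le_rfl, valley_one, mul_assoc, mul_assoc, ← mul_assoc (e 0),
    H.braid 0 2 (by omega) hi (by unfold Adj; omega)]

lemma valley_mul_far (H : TLRel δ n e) {i s : ℕ} (h1 : 1 ≤ i) (hi : i + 2 ≤ s) (hs : s ≤ n) :
    Lower n e s (valley e n i * e s) := by
  induction i, h1 using Nat.le_induction with
  | base =>
    rw [valley_one, mul_assoc, H.comm 0 s (by omega) hs (by unfold Adj; omega), ← mul_assoc]
    exact (H.desc_mul_far (by omega) hi hs).mul_comm_gen H (by omega) (by omega) (by omega)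
  | succ i h1 ih =>
    rw [valley_succ e n h1, mul_assoc, H.comm (i + 1) s (by omega) hs (by unfold Adj; omega),
      ← mul_assoc]
    exact (ih (by omega)).mul_comm_gen H (by omega) (by omega) (by omega)

/-- Moving `e s` to the left until a braid relation applies shortens the ascending part to `valley e
n s` (to `valley e n 1` for `s = 0`). The next letter is then too far away, so `valley_mul_far`
applies, and the letters after it only shift the end of a descending word. -/
lemma valley_mul_lower (H : TLRel δ n e) {i s : ℕ} (h3 : 3 ≤ i) (hi : s + 2 ≤ i) (hs : i ≤ n) :
    Lower n e i (valley e n i * e s) := by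
  have key : ∀ k, 1 ≤ k → s + 1 ≤ k → 2 ≤ k → k + 1 ≤ n →
      valley e n (k + 1) * e s = (valley e n k * e s) * e (k + 1) := by
    intro k h1 hk h2 hkn
    rw [valley_succ e n h1, mul_assoc, mul_assoc,
      H.comm s (k + 1) (by omega) hkn (by unfold Adj; omega)]
  -- The `3` is needed for `s = 0`: `valley e n 2 * e 0` is still a valley.
  have hm : max 3 (s + 2) ≤ i := by omega
  clear h3 hi
  induction i, hm using Nat.le_induction with
  | base =>
    rcases Nat.eq_zero_or_pos s with rfl | h
    · have h2 := key 2 (by omega) (by omega) le_rfl (by simpa using hs)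
      rw [H.valley_two_mul_zero (by omega)] at h2
      rw [show max 3 (0 + 2) = 2 + 1 from rfl, h2]
      exact H.valley_mul_far le_rfl (by omega) (by simpa using hs)
    · have hmax : max 3 (s + 2) = s + 1 + 1 := by omega
      rw [hmax] at hs ⊢
      rw [key (s + 1) (by omega) (by omega) (by omega) hs, H.valley_succ_mul h (by omega)]
      exact H.valley_mul_far h (by omega) hs
  | succ i hm ih =>
    rw [key i (by omega) (by omega) (by omega) hs]
    exact (ih (by omega)).mul_succ H hs (by omega)

/-! ### Left multiplication -/

/-- After moving right, `e t` meets `e (t + 1) * e t` and absorbs `e (t + 1)`. The word splits at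
this gap, and its lower part commutes to the left into the subalgebra. -/
lemma gen_mul_desc (H : TLRel δ n e) {i t : ℕ} (h1 : 1 ≤ i) (hi : i ≤ t) (ht : t < n) :
    ∃ y ∈ sub n e, e t * desc e n i = y * desc e n (t + 2) := by
  induction hi using Nat.decreasingInduction with
  | self =>
    refine ⟨e t, mem_sub ht (by omega), ?_⟩
    rw [desc_eq e n (by omega), desc_eq e n (by omega), ← mul_assoc, ← mul_assoc,
      H.desc_comm (by omega) le_rfl (by omega), mul_assoc, mul_assoc, ← mul_assoc (e t),
      H.braid t (t + 1) (by omega) (by omega) (by unfold Adj; omega)]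
  | of_succ i hi ih =>
    obtain ⟨y, hy, h⟩ := ih (by omega)
    refine ⟨y * e i, Subalgebra.mul_mem _ hy (mem_sub (by omega) (by omega)), ?_⟩
    rw [desc_eq e n (by omega), ← mul_assoc, h, mul_assoc, mul_assoc,
      H.desc_comm (by omega) (by omega) (by omega)]

lemma gen_mul_descZero (H : TLRel δ n e) {t : ℕ} (h2 : 2 ≤ t) (ht : t < n) :
    ∃ y ∈ sub n e, e t * descZero e n = y * desc e n (t + 2) := by
  obtain ⟨y, hy, h⟩ := H.gen_mul_desc (by omega) h2 ht
  refine ⟨y * e 0, Subalgebra.mul_mem _ hy (mem_sub (by omega) (by omega)), ?_⟩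
  rw [descZero, ← mul_assoc, h, mul_assoc, mul_assoc, H.desc_comm (by omega) (by omega) (by omega)]

lemma zero_mul_descZero (H : TLRel δ n e) (hn : 2 ≤ n) :
    e 0 * descZero e n = e 0 * desc e n 3 := by
  rw [descZero, desc_eq e n hn, ← mul_assoc, ← mul_assoc,
    H.desc_comm (by omega) (by omega) le_rfl, mul_assoc, mul_assoc, ← mul_assoc (e 0),
    H.braid 0 2 (by omega) hn (by unfold Adj; omega)]

/-- `z = y * desc e n k` for some `k ≥ 1` and some `y` in the subalgebra. -/
def InDesc (n : ℕ) (e : ℕ → R) (z : R) : Prop :=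
  ∃ y ∈ sub n e, ∃ k, 1 ≤ k ∧ k ≤ n + 1 ∧ z = y * desc e n k

lemma Lower.inDesc {s : ℕ} {z : R} (h : Lower n e s z) (h1 : 1 ≤ s) (hs : s ≤ n + 1) :
    InDesc n e z := by
  obtain ⟨t, y, ht, hn, hy, rfl⟩ := h
  exact ⟨e t * y, Subalgebra.mul_mem _ (mem_sub ht hn) hy, s, h1, hs, rfl⟩

lemma InDesc.mul_left {z y : R} (h : InDesc n e z) (hy : y ∈ sub n e) : InDesc n e (y * z) := by
  obtain ⟨y', hy', k, h1, hk, rfl⟩ := h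
  exact ⟨y * y', Subalgebra.mul_mem _ hy hy', k, h1, hk, by rw [mul_assoc]⟩

lemma inDesc_smul_desc (c : K) {k : ℕ} (h1 : 1 ≤ k) (hk : k ≤ n + 1) :
    InDesc n e (c • desc e n k) :=
  ⟨algebraMap K R c, Subalgebra.algebraMap_mem _ _, k, h1, hk, by rw [Algebra.smul_def]⟩

lemma inDesc_desc {k : ℕ} (h1 : 1 ≤ k) (hk : k ≤ n + 1) : InDesc n e (desc e n k) := by
  simpa using inDesc_smul_desc (n := n) (e := e) 1 h1 hk

/-- The descending words are the coset words of type `A`; they are closed under `e 1, …, e n`,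
whereas `e 0` leads out to `descZero` and `valley`. -/
lemma InDesc.mul_gen (H : TLRel δ n e) {z : R} {i : ℕ} (h : InDesc n e z) (h1 : 1 ≤ i)
    (hi : i ≤ n) : InDesc n e (z * e i) := by
  obtain ⟨y, hy, k, hk1, hk, rfl⟩ := h
  rw [mul_assoc]
  refine InDesc.mul_left ?_ hy
  rcases lt_trichotomy k i with hki | rfl | hki
  · rcases Nat.lt_or_ge (k + 1) i with h | h
    · exact (H.desc_mul_far hk1 h hi).inDesc h1 (by omega)
    · obtain rfl : i = k + 1 := by omega
      rw [H.desc_mul_succ hi hk1]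
      exact inDesc_desc h1 (by omega)
  · rw [H.desc_mul_self hi]
    exact inDesc_smul_desc _ h1 hk
  · rcases Nat.lt_or_ge (i + 1) k with h | h
    · exact (H.lower_comm h (by omega) hk).inDesc (by omega) hk
    · obtain rfl : k = i + 1 := by omega
      rw [← desc_eq e n hi]
      exact inDesc_desc h1 (by omega)

/-- A generator on the left breaks the word before it turns around. Modulo descending words, left
coefficients of a valley thus act through scalars only, which is why the spanning words need no
other coefficients there. -/
lemma gen_mul_valley (H : TLRel δ n e) {i t : ℕ} (h1 : 1 ≤ i) (hi : i ≤ n) (ht : t < n)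
    (hn : 2 ≤ n) : InDesc n e (e t * valley e n i) := by
  induction i, h1 using Nat.le_induction with
  | base =>
    rcases Nat.eq_zero_or_pos t with rfl | h
    · refine ⟨e 0 * e 1, Subalgebra.mul_mem _ (mem_sub ht hn) (mem_sub (by omega) hn), 3,
        by omega, by omega, ?_⟩
      rw [H.valley_one_eq (by omega), ← mul_assoc, H.zero_mul_descZero hn, mul_assoc, mul_assoc,
        H.desc_comm (by omega) (by omega) le_rfl]
    · obtain ⟨y, hy, h'⟩ := H.gen_mul_desc le_rfl h ht
      refine ⟨y * e 0, Subalgebra.mul_mem _ hy (mem_sub (by omega) hn), t + 2,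
        by omega, by omega, ?_⟩
      rw [valley_one, ← mul_assoc, h', mul_assoc, mul_assoc,
        H.desc_comm (by omega) (by omega) (by omega)]
  | succ i h1 ih =>
    rw [valley_succ e n h1, ← mul_assoc]
    exact (ih (by omega)).mul_gen H (by omega) hi

end TLRel


namespace TLRel

variable {R : Type*} [Ring R] [Algebra K R] {δ : K} {n : ℕ} {e : ℕ → R}

/-! ### Right multiplication on the coset words -/

/-- The products of an element of the subalgebra with a coset word. -/
inductive IsCoset (n : ℕ) (e : ℕ → R) : R → Prop
  | desc (y : R) (hy : y ∈ sub n e) (k : ℕ) (h1 : 1 ≤ k) (hk : k ≤ n + 1) :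
      IsCoset n e (y * desc e n k)
  | descZero (y : R) (hy : y ∈ sub n e) : IsCoset n e (y * descZero e n)
  | valley (y : R) (hy : y ∈ sub n e) (k : ℕ) (h1 : 1 ≤ k) (hk : k ≤ n) :
      IsCoset n e (y * valley e n k)

lemma InDesc.isCoset {z : R} (h : InDesc n e z) : IsCoset n e z := by
  obtain ⟨y, hy, k, h1, hk, rfl⟩ := h
  exact .desc y hy k h1 hk

lemma IsCoset.mul_left {z y : R} (h : IsCoset n e z) (hy : y ∈ sub n e) :
    IsCoset n e (y * z) := by
  cases h with
  | desc y' hy' k h1 hk => rw [← mul_assoc]; exact .desc _ (mul_mem hy hy') k h1 hk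
  | descZero y' hy' => rw [← mul_assoc]; exact .descZero _ (mul_mem hy hy')
  | valley y' hy' k h1 hk => rw [← mul_assoc]; exact .valley _ (mul_mem hy hy') k h1 hk

lemma isCoset_desc {k : ℕ} (h1 : 1 ≤ k) (hk : k ≤ n + 1) : IsCoset n e (TLTypeD.desc e n k) := by
  simpa using IsCoset.desc 1 (one_mem (sub n e)) k h1 hk

lemma isCoset_descZero : IsCoset n e (TLTypeD.descZero e n) := by
  simpa using IsCoset.descZero 1 (one_mem (sub n e))

lemma isCoset_valley {k : ℕ} (h1 : 1 ≤ k) (hk : k ≤ n) : IsCoset n e (TLTypeD.valley e n k) := by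
  simpa using IsCoset.valley 1 (one_mem (sub n e)) k h1 hk

lemma IsCoset.smul {z : R} (h : IsCoset n e z) (c : K) : IsCoset n e (c • z) := by
  rw [Algebra.smul_def]
  exact h.mul_left (Subalgebra.algebraMap_mem _ _)

/-- Closure under right multiplication shows that every word is a coset word with a left coefficient
in the subalgebra. -/
lemma IsCoset.mul_gen (H : TLRel δ n e) {z : R} (h : IsCoset n e z) {s : ℕ} (hn : 1 ≤ n)
    (hs : s ≤ n) : IsCoset n e (z * e s) := by
  cases h with
  | desc y hy k h1 hk =>
    rcases Nat.eq_zero_or_pos s with rfl | h0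
    · rw [mul_assoc]
      refine IsCoset.mul_left ?_ hy
      rcases Nat.lt_or_ge k 3 with h | h
      · obtain rfl | rfl : k = 1 ∨ k = 2 := by omega
        · exact isCoset_valley le_rfl hn
        · exact isCoset_descZero
      · exact ((H.desc_mul_zero h hk).inDesc h1 hk).isCoset
    · exact (InDesc.mul_gen H ⟨y, hy, k, h1, hk, rfl⟩ h0 hs).isCoset
  | descZero y hy =>
    rw [mul_assoc]
    refine IsCoset.mul_left ?_ hy
    rcases Nat.lt_or_ge s 3 with h | h
    · obtain rfl | rfl | rfl : s = 0 ∨ s = 1 ∨ s = 2 := by omega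
      · rw [H.descZero_mul_zero]
        exact isCoset_descZero.smul _
      · rw [← H.valley_one_eq hn]
        exact isCoset_valley le_rfl hn
      · rw [H.descZero_mul_two hs]
        exact isCoset_desc (by omega) (by omega)
    · exact ((H.descZero_mul_far h hs).inDesc (by omega) (by omega)).isCoset
  | valley y hy k h1 hk =>
    rw [mul_assoc]
    refine IsCoset.mul_left ?_ hy
    rcases Nat.lt_or_ge (k + 1) s with h | h
    · exact ((H.valley_mul_far h1 h hs).inDesc (by omega) (by omega)).isCoset
    by_cases h' : 3 ≤ k ∧ s + 2 ≤ k
    · exact ((H.valley_mul_lower h'.1 h'.2 hk).inDesc (by omega) (by omega)).isCoset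
    obtain rfl | rfl | h : s = k + 1 ∨ s = k ∨ s < k := by omega
    · rw [← valley_succ e n h1]
      exact isCoset_valley (by omega) hs
    · rw [H.valley_mul_self h1 hk]
      exact (isCoset_valley h1 hk).smul _
    rcases Nat.eq_zero_or_pos s with rfl | h0
    · obtain rfl | rfl : k = 1 ∨ k = 2 := by omega
      · rw [H.valley_one_mul_zero]
        exact (isCoset_valley h1 hk).smul _
      · rw [H.valley_two_mul_zero hk]
        exact isCoset_valley le_rfl hn
    · obtain rfl : k = s + 1 := by omega
      rw [H.valley_succ_mul h0 hk]
      exact isCoset_valley h0 hs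

/-! ### An element annihilated by all generators -/

lemma Lower.annihilated {P z : R} (hP : 2 ≤ n → ∀ t < n, P * e t = 0) {s : ℕ}
    (h : Lower n e s z) : P * z = 0 := by
  obtain ⟨t, y, ht, hn, hy, rfl⟩ := h
  rw [mul_assoc, ← mul_assoc, hP hn t ht, zero_mul]

lemma sum_tridiagonal {M : Type*} [AddCommGroup M] [Module K M] (c : ℕ → K) (v : M) {s N : ℕ}
    (h1 : 1 ≤ s) (hs : s ≤ N) :
    ∑ i ∈ Finset.Icc 1 N, c i • (if i = s + 1 then v else if i = s then δ • v
        else if i + 1 = s then v else 0) =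
      ((if s + 1 ≤ N then c (s + 1) else 0) + c s * δ + (if 2 ≤ s then c (s - 1) else 0)) • v := by
  have h : ∀ i, c i • (if i = s + 1 then v else if i = s then δ • v
        else if i + 1 = s then v else 0) = (if i = s + 1 then c (s + 1) • v else 0) +
        (if i = s then (c s * δ) • v else 0) + (if i = s - 1 then
          (if 2 ≤ s then c (s - 1) • v else c 0 • v) else 0) := by
    intro i
    by_cases h1' : i = s + 1
    · subst h1'
      simp
      omega
    · by_cases h2 : i = s
      · subst h2
        have : ¬ i = i - 1 := by omega
        simp [this, mul_smul]
      · by_cases h3 : i + 1 = s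
        · subst h3
          by_cases h4 : 1 ≤ i
          · simp [h4]
            omega
          · obtain rfl : i = 0 := by omega
            simp
        · have : ¬ i = s - 1 := by omega
          simp [h1', h2, h3, this]
  rw [Finset.sum_congr rfl fun i _ => h i, Finset.sum_add_distrib, Finset.sum_add_distrib,
    Finset.sum_ite_eq', Finset.sum_ite_eq', Finset.sum_ite_eq', add_smul, add_smul]
  congr 1
  · congr 1
    · by_cases h : s + 1 ≤ N <;> simp [h]
    · simp [h1, hs]
  · by_cases h : 2 ≤ s
    · have : 1 ≤ s - 1 ∧ s ≤ N + 1 := by omega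
      simp [h, this]
    · have : ¬ (1 ≤ s - 1) := by omega
      simp [h, this]

/-- The combination of coset words with coefficients `cg` (for descending words) and `ch`. -/
def cosetSum (n : ℕ) (e : ℕ → R) (cg ch : ℕ → K) : R :=
  ∑ i ∈ Finset.Icc 1 (n + 1), cg i • TLTypeD.desc e n i + cg 1 • TLTypeD.descZero e n +
    ∑ i ∈ Finset.Icc 1 n, ch i • TLTypeD.valley e n i

/-- Modulo the words killed by `P`, the generator `e s` has rank one on descending words: only the
indices `s - 1`, `s`, `s + 1` survive, and all of them go to `desc e n s`. -/
lemma desc_mul_table (H : TLRel δ n e) {P : R} (hP : 2 ≤ n → ∀ t < n, P * e t = 0) {s i : ℕ}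
    (h1 : 1 ≤ s) (hs : s ≤ n) (hi : 1 ≤ i) (hin : i ≤ n + 1) :
    P * (TLTypeD.desc e n i * e s) = if i = s + 1 then P * TLTypeD.desc e n s else
      if i = s then δ • (P * TLTypeD.desc e n s) else
      if i + 1 = s then P * TLTypeD.desc e n s else 0 := by
  split_ifs with h2 h3 h4
  · subst h2
    rw [← desc_eq e n hs]
  · subst h3
    rw [H.desc_mul_self hs, mul_smul_comm]
  · subst h4
    rw [H.desc_mul_succ hs hi]
  · rcases Nat.lt_or_ge i s with h | h
    · exact (H.desc_mul_far hi (by omega) hs).annihilated hP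
    · exact (H.lower_comm (by omega) (by omega) hin).annihilated hP

lemma valley_mul_table (H : TLRel δ n e) {P : R} (hP : 2 ≤ n → ∀ t < n, P * e t = 0) {s i : ℕ}
    (h1 : 1 ≤ s) (hs : s ≤ n) (hi : 1 ≤ i) (hin : i ≤ n) :
    P * (TLTypeD.valley e n i * e s) = if i = s + 1 then P * TLTypeD.valley e n s else
      if i = s then δ • (P * TLTypeD.valley e n s) else
      if i + 1 = s then P * TLTypeD.valley e n s else 0 := by
  split_ifs with h2 h3 h4
  · subst h2
    rw [H.valley_succ_mul h1 hin]
  · subst h3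
    rw [H.valley_mul_self h1 hs, mul_smul_comm]
  · subst h4
    rw [← valley_succ e n hi]
  · rcases Nat.lt_or_ge i s with h | h
    · exact (H.valley_mul_far hi (by omega) hs).annihilated hP
    · exact (H.valley_mul_lower (by omega) (by omega) hin).annihilated hP

/-- The linear relations on the coefficients that make `cosetSum` an annihilated element. -/
structure CoefRel (δ : K) (n : ℕ) (cg ch : ℕ → K) : Prop where
  g_far : ∀ s, 3 ≤ s → s ≤ n → cg (s + 1) + cg s * δ + cg (s - 1) = 0
  -- `cg 1` enters twice because both prongs of the fork, `desc 1` and `descZero`, are sent to `desc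
  -- 2` by `e 2`.
  g_two : 2 ≤ n → cg 3 + cg 2 * δ + cg 1 + cg 1 = 0
  g_one : cg 2 + cg 1 * δ = 0
  h_far : ∀ s, 2 ≤ s → s ≤ n → ch (s + 1) + ch s * δ + ch (s - 1) = 0
  -- Here `cg 1` comes from `desc 1 * e 0`, or equally from `descZero * e 1`; both are `valley 1`.
  h_one : cg 1 + (ch 2 + ch 1 * δ) = 0
  h_top : ch (n + 1) = 0

lemma CoefRel.h_sum {cg ch : ℕ → K} (C : CoefRel δ n cg ch) {s : ℕ} (hs : s ≤ n) :
    (if s + 1 ≤ n then ch (s + 1) else 0) = ch (s + 1) := by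
  split_ifs with h
  · rfl
  · obtain rfl : s = n := by omega
    exact C.h_top.symm

/-- For `s ≥ 1` everything is a multiple of `P * desc s` or `P * valley s`; for `s = 0` the targets
are `P * descZero` and `P * valley 1`. The relations in `CoefRel` say that the coefficients of these
elements vanish. -/
lemma cosetSum_mul_gen (H : TLRel δ n e) {P : R} (hP : 2 ≤ n → ∀ t < n, P * e t = 0)
    {cg ch : ℕ → K} (C : CoefRel δ n cg ch) (hn : 1 ≤ n) {s : ℕ} (hs : s ≤ n) :
    P * cosetSum n e cg ch * e s = 0 := by
  have expand : P * cosetSum n e cg ch * e s =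
      ∑ i ∈ Finset.Icc 1 (n + 1), cg i • (P * (TLTypeD.desc e n i * e s)) +
        cg 1 • (P * (TLTypeD.descZero e n * e s)) +
      ∑ i ∈ Finset.Icc 1 n, ch i • (P * (TLTypeD.valley e n i * e s)) := by
    simp only [cosetSum, mul_add, add_mul, Finset.mul_sum, Finset.sum_mul, mul_smul_comm,
      smul_mul_assoc, mul_assoc]
  rw [expand]
  rcases Nat.eq_zero_or_pos s with rfl | h0
  · have hg : ∑ i ∈ Finset.Icc 1 (n + 1), cg i • (P * (TLTypeD.desc e n i * e 0)) =
        cg 1 • (P * TLTypeD.valley e n 1) + cg 2 • (P * TLTypeD.descZero e n) := by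
      rw [← Finset.sum_subset (s₁ := {1, 2})]
      · rw [Finset.sum_pair (by decide)]
        rfl
      · intro i hi
        simp only [Finset.mem_insert, Finset.mem_singleton, Finset.mem_Icc] at *
        omega
      · intro i hi hi'
        simp only [Finset.mem_insert, Finset.mem_singleton, Finset.mem_Icc] at *
        rw [(H.desc_mul_zero (by omega) hi.2).annihilated hP, smul_zero]
    have hh : ∑ i ∈ Finset.Icc 1 n, ch i • (P * (TLTypeD.valley e n i * e 0)) =
        (ch 2 + ch 1 * δ) • (P * TLTypeD.valley e n 1) := by
      rcases Nat.lt_or_ge 1 n with h2 | h2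
      · rw [← Finset.sum_subset (s₁ := {1, 2})]
        · rw [Finset.sum_pair (by decide), H.valley_one_mul_zero, H.valley_two_mul_zero h2,
            mul_smul_comm, smul_smul, add_smul, add_comm]
        · intro i hi
          simp only [Finset.mem_insert, Finset.mem_singleton, Finset.mem_Icc] at *
          omega
        · intro i hi hi'
          simp only [Finset.mem_insert, Finset.mem_singleton, Finset.mem_Icc] at *
          rw [(H.valley_mul_lower (by omega) (by omega) hi.2).annihilated hP, smul_zero]
      -- There is no `valley 2` here, but its coefficient is `ch (n + 1) = 0`, so the formula
      -- persists.
      · obtain rfl : n = 1 := by omega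
        rw [Finset.Icc_self, Finset.sum_singleton, H.valley_one_mul_zero, C.h_top, zero_add,
          mul_smul_comm, smul_smul]
    rw [hg, hh, H.descZero_mul_zero, mul_smul_comm, smul_smul,
      show ∀ a b c d : R, a + b + c + d = (a + d) + (b + c) by intros; abel, ← add_smul,
      ← add_smul, C.g_one, C.h_one, zero_smul, zero_smul, add_zero]
  · rw [Finset.sum_congr rfl fun i hi => congrArg (cg i • ·) (H.desc_mul_table hP h0 hs
        (Finset.mem_Icc.1 hi).1 (Finset.mem_Icc.1 hi).2),
      Finset.sum_congr rfl fun i hi => congrArg (ch i • ·) (H.valley_mul_table hP h0 hs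
        (Finset.mem_Icc.1 hi).1 (Finset.mem_Icc.1 hi).2),
      sum_tridiagonal cg _ h0 (by omega), sum_tridiagonal ch _ h0 hs, C.h_sum hs,
      if_pos (by omega)]
    obtain rfl | h2 : s = 1 ∨ 2 ≤ s := by omega
    · rw [← H.valley_one_eq hn, if_neg (by omega), if_neg (by omega), add_zero, add_zero, C.g_one,
        zero_smul, zero_add, ← add_smul, C.h_one, zero_smul]
    · rw [if_pos h2, if_pos h2, C.h_far s h2 hs, zero_smul, add_zero]
      obtain rfl | h3 : s = 2 ∨ 3 ≤ s := by omega
      · rw [H.descZero_mul_two hs, ← add_smul, C.g_two hs, zero_smul]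
      · rw [(H.descZero_mul_far h3 hs).annihilated hP, smul_zero, add_zero, C.g_far s h3 hs,
          zero_smul]

end TLRel

/-! ### Quantum integers -/

lemma q_ne_zero : q ≠ 0 := RatFunc.X_ne_zero

lemma q_pow_ne_one {k : ℕ} (hk : k ≠ 0) : q ^ k ≠ 1 := by
  intro h
  have h' : (algebraMap (Polynomial ℂ) (RatFunc ℂ)) (Polynomial.X ^ k) =
      algebraMap (Polynomial ℂ) (RatFunc ℂ) 1 := by
    simpa [q, RatFunc.algebraMap_X] using h
  have h2 := congrArg Polynomial.natDegree (RatFunc.algebraMap_injective ℂ h')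
  simp at h2
  exact hk h2

lemma q_sub_inv_ne_zero : q - q⁻¹ ≠ 0 := by
  intro h
  refine q_pow_ne_one (k := 2) (by decide) ?_
  have h2 : q = q⁻¹ := sub_eq_zero.1 h
  rw [pow_two]
  nth_rewrite 2 [h2]
  exact mul_inv_cancel₀ q_ne_zero

lemma qInt_natCast_ne_zero {k : ℕ} (hk : k ≠ 0) : qInt k ≠ 0 := by
  unfold qInt
  refine div_ne_zero ?_ q_sub_inv_ne_zero
  intro h
  refine q_pow_ne_one (k := 2 * k) (by omega) ?_
  have h2 : q ^ (k : ℤ) = q ^ (-(k : ℤ)) := sub_eq_zero.1 h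
  rw [two_mul, pow_add]
  rw [zpow_natCast, zpow_neg, zpow_natCast] at h2
  nth_rewrite 2 [h2]
  exact mul_inv_cancel₀ (pow_ne_zero _ q_ne_zero)

lemma qInt_zero : qInt 0 = 0 := by simp [qInt]

lemma qInt_two : qInt 2 = q + q⁻¹ := by
  have h1 := q_sub_inv_ne_zero
  rw [qInt, div_eq_iff h1, zpow_neg]
  have : q ^ (2 : ℤ) = q * q := by rw [← pow_two]; rfl
  rw [this, mul_inv]
  ring

lemma q_zpow_neg_add_one (k : ℤ) : q ^ (-(k + 1)) = q ^ (-k) * q⁻¹ := by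
  rw [neg_add, ← sub_eq_add_neg, zpow_sub_one₀ q_ne_zero]

lemma q_zpow_neg_sub_one (k : ℤ) : q ^ (-(k - 1)) = q ^ (-k) * q := by
  rw [show -(k - 1) = -k + 1 by ring, zpow_add_one₀ q_ne_zero]

lemma qInt_rec (k : ℤ) : qInt (k + 1) + qInt (k - 1) = qInt k * qInt 2 := by
  rw [qInt_two, qInt, qInt, qInt, ← add_div, div_mul_eq_mul_div, zpow_add_one₀ q_ne_zero,
    zpow_sub_one₀ q_ne_zero, q_zpow_neg_add_one, q_zpow_neg_sub_one]
  congr 1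
  ring

/-- The sum `q ^ k + q ^ (-k)`, which equals `[2 k] / [k]`. -/
def qSum (k : ℤ) : K := q ^ k + q ^ (-k)

lemma qSum_zero : qSum 0 = 2 := by simp [qSum]; norm_num

lemma qSum_one : qSum 1 = qInt 2 := by simp [qSum, qInt_two]

lemma qSum_rec (k : ℤ) : qSum (k + 1) + qSum (k - 1) = qSum k * qInt 2 := by
  rw [qInt_two, qSum, qSum, qSum, zpow_add_one₀ q_ne_zero,
    zpow_sub_one₀ q_ne_zero, q_zpow_neg_add_one, q_zpow_neg_sub_one]
  ring

lemma qInt_two_mul (k : ℤ) : qInt (2 * k) = qInt k * qSum k := by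
  have h0 := q_ne_zero
  rw [qInt, qInt, qSum, div_mul_eq_mul_div]
  congr 1
  rw [two_mul, neg_add, zpow_add₀ h0, zpow_add₀ h0]
  ring

lemma coefG_one (n : ℕ) : coefG n 1 = qInt n / qInt (2 * n) := by simp [coefG]

/-- In this form the coefficients obey the recursion of `qSum`. At `i = 1` the same expression would
be twice `coefG n 1`, as `qSum 0 = 2`: the two prongs `desc 1` and `descZero` share this value. -/
lemma coefG_eq {n i : ℕ} (h : 2 ≤ i) :
    coefG n i = qInt n / qInt (2 * n) * qSum ((i : ℤ) - 1) := by
  have hi : qInt ((i : ℤ) - 1) ≠ 0 := by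
    have := qInt_natCast_ne_zero (k := i - 1) (by omega)
    rwa [Nat.cast_sub (by omega), Nat.cast_one] at this
  rw [coefG, if_neg (by omega), show (2 * (i : ℤ) - 2) = 2 * ((i : ℤ) - 1) by ring,
    qInt_two_mul ((i : ℤ) - 1), mul_comm (qInt ((i : ℤ) - 1)), ← mul_assoc, mul_div_mul_right _ _ hi,
    div_mul_eq_mul_div]

lemma coefG_top {n : ℕ} (hn : 1 ≤ n) : coefG n (n + 1) = 1 := by
  have h1 : qInt (n : ℤ) ≠ 0 := qInt_natCast_ne_zero (by omega)
  have h2 : qInt (2 * (n : ℤ)) ≠ 0 := by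
    have := qInt_natCast_ne_zero (k := 2 * n) (by omega)
    simpa using this
  rw [coefG_eq (by omega), div_mul_eq_mul_div, Nat.cast_add, Nat.cast_one, add_sub_cancel_right,
    ← qInt_two_mul, div_self h2]

lemma coefH_top (n : ℕ) : coefH n (n + 1) = 0 := by simp [coefH, qInt_zero]

lemma coefH_eq (n i : ℕ) : coefH n i =
    qInt n / qInt (2 * n) * (qInt ((n : ℤ) + 1 - i) / qInt ((n : ℤ) + 1)) := by
  rw [coefH, mul_div_mul_comm]

/-- Both families solve the recursion `a (k + 1) + a (k - 1) = [2] * a k`. For `coefH` the boundary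
value `[0] = 0` sits at `n + 1`, and `h_one` fixes the scale by `[n + 1] + [n - 1] = [n] [2]`. -/
lemma coefRel (n : ℕ) : TLRel.CoefRel (-qInt 2) n (coefG n) (coefH n) := by
  have hN : qInt ((n : ℤ) + 1) ≠ 0 := by
    have := qInt_natCast_ne_zero (k := n + 1) (by omega)
    simpa using this
  refine ⟨?_, ?_, ?_, ?_, ?_, coefH_top n⟩
  · intro s h3 hs
    rw [coefG_eq (by omega), coefG_eq (by omega), coefG_eq (by omega),
      Nat.cast_sub (by omega), Nat.cast_add, Nat.cast_one]
    have := qSum_rec ((s : ℤ) - 1)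
    rw [show (s : ℤ) + 1 - 1 = s - 1 + 1 by ring]
    linear_combination (qInt n / qInt (2 * n)) * this
  · intro h2
    rw [coefG_eq (by omega), coefG_eq (by omega), coefG_one]
    have := qSum_rec 1
    norm_num [qSum_zero] at this ⊢
    linear_combination (qInt n / qInt (2 * n)) * this
  · rw [coefG_eq (by omega), coefG_one]
    norm_num [qSum_one]
  · intro s h2 hs
    rw [coefH_eq, coefH_eq, coefH_eq, Nat.cast_sub (by omega), Nat.cast_add, Nat.cast_one]
    have := qInt_rec ((n : ℤ) + 1 - s)
    rw [show (n : ℤ) + 1 - (s + 1) = n + 1 - s - 1 by ring,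
      show (n : ℤ) + 1 - (s - 1) = n + 1 - s + 1 by ring]
    field_simp
    linear_combination (qInt n / qInt (2 * n)) * this
  · rw [coefH_eq, coefH_eq, coefG_one]
    have := qInt_rec (n : ℤ)
    rw [Nat.cast_one, add_sub_cancel_right,
      show (n : ℤ) + 1 - (2 : ℕ) = n - 1 by push_cast; ring]
    have h2 : qInt n / qInt (2 * n) * ((qInt ((n : ℤ) + 1)) + qInt ((n : ℤ) - 1) - qInt n * qInt 2)
      = 0 := by rw [this]; ring
    field_simp
    linear_combination h2

/-! ### Connectivity states -/

/-- A perfect matching of the points `α` with dots on its arcs. A state with `tag = true` stands for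
a diagram multiplied by a dotted loop, in which dots on arcs are irrelevant. -/
@[ext]
structure State (α : Type*) where
  tag : Bool
  par : α → α
  dot : α → Bool
  par_par : ∀ p, par (par p) = p
  par_ne : ∀ p, par p ≠ p
  dot_par : ∀ p, dot (par p) = dot p
  tag_dot : tag = true → ∀ p, dot p = false

namespace State

variable {α : Type*} [DecidableEq α]

/-- Join the arcs at `a` and `b`, and put a new arc between `a` and `b`, with a dot if `e`. -/
def join (a b : α) (hab : a ≠ b) (e : Bool) (S : State α) : State α where
  -- A loop closes exactly if `a` and `b` are already joined, and it then carries an odd number of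
  -- dots exactly if `S.dot a ≠ e`.
  tag := S.tag || decide (S.par a = b ∧ S.dot a ≠ e)
  par p := if p = a then b else if p = b then a else if p = S.par a then S.par b
    else if p = S.par b then S.par a else S.par p
  dot p := !(S.tag || decide (S.par a = b ∧ S.dot a ≠ e)) &&
    if p = a ∨ p = b then e else if p = S.par a ∨ p = S.par b then (S.dot a ^^ (e ^^ S.dot b))
    else S.dot p
  par_par p := by
    have h1 := S.par_par
    have h2 := S.par_ne
    grind
  par_ne p := by
    have h1 := S.par_par
    have h2 := S.par_ne
    grind
  dot_par p := by
    have h1 := S.par_par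
    have h2 := S.par_ne
    have h3 := S.dot_par
    congr 1
    grind
  tag_dot h p := by rw [h]; rfl

/-- The scalar created by `join`. -/
def joinCoef {F : Type*} [One F] (δ : F) (a b : α) (e : Bool) (S : State α) : F :=
  -- The first dotted loop costs nothing, being stored in the tag; on a tagged state every further
  -- loop gives `δ`, dotted or not.
  if S.par a = b ∧ (S.tag = true ∨ S.dot a = e) then δ else 1

lemma join_of_loop (a b : α) (hab : a ≠ b) (e : Bool) (S : State α)
    (h : S.par a = b ∧ (S.tag = true ∨ S.dot a = e)) : S.join a b hab e = S := by
  have h1 := S.par_par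
  have h2 := S.par_ne
  have h3 := S.dot_par
  have h4 := S.tag_dot
  obtain ⟨h, h'⟩ := h
  ext p <;> simp only [join] <;> grind

lemma join_par_left (a b : α) (hab : a ≠ b) (e : Bool) (S : State α) :
    (S.join a b hab e).par a = b := by simp [join]

lemma join_loop (a b : α) (hab : a ≠ b) (e : Bool) (S : State α) :
    (S.join a b hab e).tag = true ∨ (S.join a b hab e).dot a = e := by
  simp only [join]
  grind

lemma join_symm (a b : α) (hab : a ≠ b) (e : Bool) (S : State α) :
    S.join a b hab e = S.join b a hab.symm e := by
  have h1 := S.par_par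
  have h2 := S.par_ne
  have h3 := S.dot_par
  ext p <;> simp only [join] <;> grind

lemma joinCoef_symm {F : Type*} [One F] (δ : F) (a b : α) (e : Bool) (S : State α) :
    S.joinCoef δ a b e = S.joinCoef δ b a e := by
  have h1 := S.par_par
  have h3 := S.dot_par
  simp only [joinCoef]
  congr 1
  grind

lemma join_dot_of_tag (a b : α) (hab : a ≠ b) (e : Bool) (S : State α)
    (h : (S.join a b hab e).tag = false) (p : α) : (S.join a b hab e).dot p =
      if p = a ∨ p = b then e else if p = S.par a ∨ p = S.par b then (S.dot a ^^ (e ^^ S.dot b))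
      else S.dot p := by
  simp only [join] at h ⊢
  rw [h]
  rfl

lemma tag_of_join_tag (a b : α) (hab : a ≠ b) (e : Bool) (S : State α)
    (h : (S.join a b hab e).tag = false) : S.tag = false := by
  simp only [join, Bool.or_eq_false_iff] at h
  exact h.1

lemma join_join_comm_tag (a b c d : α) (hab : a ≠ b) (hcd : c ≠ d) (hac : a ≠ c) (had : a ≠ d)
    (hbc : b ≠ c) (hbd : b ≠ d) (e f : Bool) (S : State α) :
    ((S.join a b hab e).join c d hcd f).tag = ((S.join c d hcd f).join a b hab e).tag := by
  have h1 := S.par_par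
  have h2 := S.par_ne
  have h3 := S.dot_par
  have h4 := S.tag_dot
  rcases Bool.eq_false_or_eq_true (S.dot a) with ha | ha <;>
    rcases Bool.eq_false_or_eq_true (S.dot b) with hb | hb <;>
    cases e <;> cases f <;> simp only [join, ha, hb] <;> grind (splits := 20)

set_option maxHeartbeats 1000000 in
lemma join_join_comm (a b c d : α) (hab : a ≠ b) (hcd : c ≠ d) (hac : a ≠ c) (had : a ≠ d)
    (hbc : b ≠ c) (hbd : b ≠ d) (e f : Bool) (S : State α) :
    (S.join a b hab e).join c d hcd f = (S.join c d hcd f).join a b hab e := by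
  have h1 := S.par_par
  have h2 := S.par_ne
  have h3 := S.dot_par
  have h4 := S.tag_dot
  have htag := S.join_join_comm_tag a b c d hab hcd hac had hbc hbd e f
  ext p
  · exact htag
  · simp only [join]
    grind (splits := 30)
  -- A tagged state has no dots, so the dots need to be followed only if no dotted loop arises on
  -- either side.
  · rcases Bool.eq_false_or_eq_true ((S.join a b hab e).join c d hcd f).tag with T | T
    · rw [tag_dot _ T, tag_dot _ (htag.symm.trans T)]
    · have T' := htag.symm.trans T
      rw [join_dot_of_tag _ _ _ _ _ T, join_dot_of_tag _ _ _ _ _ T']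
      have t1 := tag_of_join_tag _ _ _ _ _ T
      have t2 := tag_of_join_tag _ _ _ _ _ T'
      simp only [join_dot_of_tag _ _ _ _ _ t1, join_dot_of_tag _ _ _ _ _ t2]
      clear h4 t1 t2 T T' htag
      simp only [join]
      rcases Bool.eq_false_or_eq_true (S.dot a) with ha | ha <;>
      rcases Bool.eq_false_or_eq_true (S.dot b) with hb | hb <;>
      rcases Bool.eq_false_or_eq_true (S.dot c) with hc | hc <;>
      rcases Bool.eq_false_or_eq_true (S.dot d) with hd | hd <;>
      cases e <;> cases f <;> simp only [ha, hb, hc, hd, Bool.xor_true, Bool.xor_false,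
        Bool.true_xor, Bool.false_xor, Bool.not_true, Bool.not_false] <;> grind (splits := 30)

lemma joinCoef_comm {F : Type*} [CommRing F] (δ : F) (a b c d : α) (hab : a ≠ b) (hcd : c ≠ d)
    (hac : a ≠ c) (had : a ≠ d)
    (hbc : b ≠ c) (hbd : b ≠ d) (e f : Bool) (S : State α) :
    S.joinCoef δ a b e * (S.join a b hab e).joinCoef δ c d f =
      S.joinCoef δ c d f * (S.join c d hcd f).joinCoef δ a b e := by
  have h1 := S.par_par
  have h2 := S.par_ne
  have h3 := S.dot_par
  have h4 := S.tag_dot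
  rcases Bool.eq_false_or_eq_true (S.dot a) with ha | ha <;>
    rcases Bool.eq_false_or_eq_true (S.dot b) with hb | hb <;>
    cases e <;> cases f <;> simp only [joinCoef, join, ha, hb] <;> grind (splits := 20)

/-- This is `E_0 * E_1 = E_1 * E_0`: the caps sit at the same points, and in either order the second
join closes a loop with one dot. -/
lemma join_join_same (a b : α) (hab : a ≠ b) (S : State α) :
    (S.join a b hab true).join a b hab false = (S.join a b hab false).join a b hab true := by
  have h1 := S.par_par
  have h2 := S.par_ne
  have h3 := S.dot_par
  have h4 := S.tag_dot
  ext p <;> simp only [join] <;> grind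

lemma joinCoef_same {F : Type*} [CommRing F] (δ : F) (a b : α) (hab : a ≠ b) (S : State α) :
    S.joinCoef δ a b true * (S.join a b hab true).joinCoef δ a b false =
      S.joinCoef δ a b false * (S.join a b hab false).joinCoef δ a b true := by
  have h1 := S.par_par
  have h2 := S.par_ne
  have h3 := S.dot_par
  have h4 := S.tag_dot
  simp only [joinCoef, join]
  grind

/-- A zigzag is straightened. Along the resulting strand both `e` and `f` occur twice, so their dots
cancel. -/
lemma join_braid (a b c : α) (hab : a ≠ b) (hbc : b ≠ c) (hac : a ≠ c) (e f : Bool)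
    (S : State α) :
    ((S.join a b hab e).join b c hbc f).join a b hab e = S.join a b hab e := by
  have h1 := S.par_par
  have h2 := S.par_ne
  have h3 := S.dot_par
  have h4 := S.tag_dot
  ext p <;> simp only [join] <;> grind

lemma joinCoef_braid {F : Type*} [CommRing F] (δ : F) (a b c : α) (hab : a ≠ b) (hbc : b ≠ c) (hac : a ≠ c) (e f : Bool)
    (S : State α) :
    (S.join a b hab e).joinCoef δ b c f *
      ((S.join a b hab e).join b c hbc f).joinCoef δ a b e = 1 := by
  have h1 := S.par_par
  have h2 := S.par_ne
  have h3 := S.dot_par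
  have h4 := S.tag_dot
  simp only [joinCoef, join]
  grind

end State


/-! ### The right module of states -/

/-- The bottom point at which the cap of the generator `s` starts. -/
def ptA {m : ℕ} (s : Fin m) : Fin (2 * m) :=
  ⟨2 * m - max (s : ℕ) 1, by have := s.isLt; omega⟩

/-- The bottom point at which the cap of the generator `s` ends. -/
def ptB {m : ℕ} (s : Fin m) : Fin (2 * m) :=
  ⟨2 * m - max (s : ℕ) 1 - 1, by have := s.isLt; omega⟩

lemma ptA_ne_ptB {m : ℕ} (s : Fin m) : ptA s ≠ ptB s := by
  have := s.isLt
  simp only [ptA, ptB, ne_eq, Fin.mk.injEq]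
  omega

namespace State

variable {m : ℕ}

/-- The action of the generator `s` on states, up to a scalar. -/
def step (S : State (Fin (2 * m))) (s : Fin m) : State (Fin (2 * m)) :=
  S.join (ptA s) (ptB s) (ptA_ne_ptB s) (decide ((s : ℕ) = 0))

/-- The scalar in the action of the generator `s`. -/
def stepCoef (S : State (Fin (2 * m))) (s : Fin m) : K :=
  S.joinCoef (-qInt 2) (ptA s) (ptB s) (decide ((s : ℕ) = 0))

/-- The state of the identity diagram. -/
def one (m : ℕ) : State (Fin (2 * m)) where
  tag := false
  par := Fin.rev
  dot _ := false
  par_par := Fin.rev_rev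
  par_ne p h := by
    have := congrArg Fin.val h
    rw [Fin.val_rev] at this
    omega
  dot_par _ := rfl
  tag_dot h := by simp at h

lemma step_step_self (S : State (Fin (2 * m))) (s : Fin m) : (S.step s).step s = S.step s :=
  join_of_loop _ _ _ _ _ ⟨join_par_left _ _ _ _ _, join_loop _ _ _ _ _⟩

lemma stepCoef_step_self (S : State (Fin (2 * m))) (s : Fin m) :
    (S.step s).stepCoef s = -qInt 2 :=
  if_pos ⟨join_par_left _ _ _ _ _, join_loop _ _ _ _ _⟩

lemma step_braid (S : State (Fin (2 * m))) {i j : Fin m} (h : Adj i j) :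
    ((S.step i).step j).step i = S.step i ∧
      (S.step i).stepCoef j * ((S.step i).step j).stepCoef i = 1 := by
  have hi := i.isLt
  have hj := j.isLt
  -- Adjacent generators have caps with exactly one common point; the two cases are mirror images.
  have key : ptB i = ptA j ∧ ptA i ≠ ptB j ∨ ptA i = ptB j ∧ ptB i ≠ ptA j := by
    simp only [Adj] at h
    simp only [ptA, ptB, Fin.mk.injEq, ne_eq]
    omega
  have aux : ∀ (a b c d : Fin (2 * m)) (hab : a ≠ b) (hcd : c ≠ d) (e f : Bool), b = c → a ≠ d →
      ((S.join a b hab e).join c d hcd f).join a b hab e = S.join a b hab e ∧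
        (S.join a b hab e).joinCoef (-qInt 2) c d f *
          ((S.join a b hab e).join c d hcd f).joinCoef (-qInt 2) a b e = 1 := by
    rintro a b c d hab hcd e f rfl had
    exact ⟨join_braid a b d hab hcd had e f S, joinCoef_braid _ a b d hab hcd had e f S⟩
  rcases key with ⟨h1, h2⟩ | ⟨h1, h2⟩
  · exact aux _ _ _ _ _ _ _ _ h1 h2
  · have := aux (ptB i) (ptA i) (ptB j) (ptA j) (ptA_ne_ptB i).symm (ptA_ne_ptB j).symm
      (decide ((i : ℕ) = 0)) (decide ((j : ℕ) = 0)) h1 h2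
    simpa only [step, stepCoef, join_symm (ptB i) (ptA i), join_symm (ptB j) (ptA j),
      joinCoef_symm _ (ptB i) (ptA i), joinCoef_symm _ (ptB j) (ptA j)] using this

lemma step_comm (S : State (Fin (2 * m))) {i j : Fin m} (h : ¬ Adj i j) :
    (S.step i).step j = (S.step j).step i ∧
      S.stepCoef i * (S.step i).stepCoef j = S.stepCoef j * (S.step j).stepCoef i := by
  have hi := i.isLt
  have hj := j.isLt
  have aux : ∀ (a b c d : Fin (2 * m)) (hab : a ≠ b) (hcd : c ≠ d), a = c → b = d →
      (S.join a b hab true).join c d hcd false = (S.join c d hcd false).join a b hab true ∧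
        S.joinCoef (-qInt 2) a b true * (S.join a b hab true).joinCoef (-qInt 2) c d false =
        S.joinCoef (-qInt 2) c d false * (S.join c d hcd false).joinCoef (-qInt 2) a b true := by
    rintro a b c d hab hcd rfl rfl
    exact ⟨join_join_same a b hab S, joinCoef_same _ a b hab S⟩
  by_cases hij : i = j
  · subst hij
    exact ⟨rfl, rfl⟩
  have hij' : (i : ℕ) ≠ j := fun h => hij (Fin.ext h)
  by_cases h01 : (i : ℕ) = 0 ∧ (j : ℕ) = 1
  · have := aux (ptA i) (ptB i) (ptA j) (ptB j) (ptA_ne_ptB i) (ptA_ne_ptB j)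
      (by simp [ptA, h01]) (by simp [ptB, h01])
    simpa only [step, stepCoef, h01, decide_true, one_ne_zero, decide_false] using this
  by_cases h10 : (i : ℕ) = 1 ∧ (j : ℕ) = 0
  · have := aux (ptA j) (ptB j) (ptA i) (ptB i) (ptA_ne_ptB j) (ptA_ne_ptB i)
      (by simp [ptA, h10]) (by simp [ptB, h10])
    simp only [step, stepCoef, h10, decide_true, one_ne_zero, decide_false]
    exact ⟨this.1.symm, this.2.symm⟩
  have hd : ptA i ≠ ptA j ∧ ptA i ≠ ptB j ∧ ptB i ≠ ptA j ∧ ptB i ≠ ptB j := by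
    simp only [Adj] at h
    simp only [ptA, ptB, Fin.mk.injEq, ne_eq]
    omega
  obtain ⟨h1, h2, h3, h4⟩ := hd
  exact ⟨join_join_comm _ _ _ _ _ _ h1 h2 h3 h4 _ _ S,
    joinCoef_comm _ _ _ _ _ _ _ h1 h2 h3 h4 _ _ S⟩

end State

/-- The free module on the states. -/
abbrev StateModule (m : ℕ) : Type := State (Fin (2 * m)) →₀ K

section Rep

variable {m : ℕ}

/-- The action of the generator `s` on the module of states. -/
def act (s : Fin m) : StateModule m →ₗ[K] StateModule m :=
  Finsupp.linearCombination K fun S => Finsupp.single (S.step s) (S.stepCoef s)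

lemma act_single (s : Fin m) (S : State (Fin (2 * m))) (c : K) :
    act s (Finsupp.single S c) = Finsupp.single (S.step s) (c * S.stepCoef s) := by
  simp [act, Finsupp.linearCombination_single]

/-- The right action of the Temperley--Lieb algebra on the module of states. -/
def rep (m : ℕ) : TLD m →ₐ[K] (Module.End K (StateModule m))ᵐᵒᵖ :=
  RingQuot.liftAlgHom K ⟨FreeAlgebra.lift K fun s => MulOpposite.op (act s), by
    intro x y hxy
    cases hxy with
    | sq i =>
      rw [map_mul, map_smul, FreeAlgebra.lift_ι_apply, ← MulOpposite.op_mul, ← MulOpposite.op_smul]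
      congr 1
      refine Finsupp.lhom_ext fun S c => ?_
      rw [Module.End.mul_apply, LinearMap.smul_apply, act_single, act_single, S.step_step_self,
        S.stepCoef_step_self, Finsupp.smul_single, smul_eq_mul, mul_comm _ (-qInt 2)]
    | braid i j hij =>
      rw [map_mul, map_mul, FreeAlgebra.lift_ι_apply, FreeAlgebra.lift_ι_apply,
        ← MulOpposite.op_mul, ← MulOpposite.op_mul]
      congr 1
      refine Finsupp.lhom_ext fun S c => ?_
      rw [Module.End.mul_apply, Module.End.mul_apply, act_single, act_single, act_single,
        (S.step_braid hij).1, mul_assoc, (S.step_braid hij).2, mul_one]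
    | comm i j hij =>
      rw [map_mul, map_mul, FreeAlgebra.lift_ι_apply, FreeAlgebra.lift_ι_apply,
        ← MulOpposite.op_mul, ← MulOpposite.op_mul]
      congr 1
      refine Finsupp.lhom_ext fun S c => ?_
      rw [Module.End.mul_apply, Module.End.mul_apply, act_single, act_single, act_single,
        act_single, (S.step_comm hij).1, mul_assoc, (S.step_comm hij).2, mul_assoc]⟩

lemma rep_E (s : Fin m) : rep m (E s) = MulOpposite.op (act s) := by
  rw [rep, E, RingQuot.liftAlgHom_mkAlgHom_apply, FreeAlgebra.lift_ι_apply]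

/-- The image of the identity diagram under an element of the algebra. -/
def expand (m : ℕ) : TLD m →ₗ[K] StateModule m :=
  LinearMap.applyₗ (Finsupp.single (State.one m) (1 : K)) ∘ₗ
    (MulOpposite.opLinearEquiv K).symm.toLinearMap ∘ₗ (rep m).toLinearMap

lemma expand_apply (x : TLD m) :
    expand m x = (rep m x).unop (Finsupp.single (State.one m) (1 : K)) := rfl

lemma expand_one : expand m 1 = Finsupp.single (State.one m) 1 := by
  rw [expand_apply, map_one]
  rfl

lemma expand_mul_E (x : TLD m) (s : Fin m) : expand m (x * E s) = act s (expand m x) := by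
  rw [expand_apply, map_mul, rep_E]
  rfl

lemma word_nil : word ([] : List (Fin m)) = 1 := rfl

lemma word_append (v w : List (Fin m)) : word (v ++ w) = word v * word w := by
  simp [word]

lemma word_concat (w : List (Fin m)) (s : Fin m) : word (w ++ [s]) = word w * E s := by
  simp [word]

lemma span_word : Submodule.span K (Set.range (word (m := m))) = ⊤ := by
  rw [eq_top_iff]
  rintro x -
  obtain ⟨y, rfl⟩ := RingQuot.mkAlgHom_surjective K (Rel m) x
  induction y using FreeAlgebra.induction with
  | grade0 r =>
    rw [AlgHom.commutes, Algebra.algebraMap_eq_smul_one]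
    exact Submodule.smul_mem _ _ (Submodule.subset_span ⟨[], rfl⟩)
  | grade1 s => exact Submodule.subset_span ⟨[s], by simp [word, E]⟩
  | mul a b ha hb =>
    rw [map_mul]
    have h : Submodule.span K (Set.range (word (m := m))) * Submodule.span K
        (Set.range (word (m := m))) ≤ Submodule.span K (Set.range (word (m := m))) := by
      rw [Submodule.span_mul_span]
      refine Submodule.span_mono ?_
      rintro _ ⟨_, ⟨v, rfl⟩, _, ⟨w, rfl⟩, rfl⟩
      exact ⟨v ++ w, word_append v w⟩
    exact h (Submodule.mul_mem_mul ha hb)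
  | add a b ha hb =>
    rw [map_add]
    exact Submodule.add_mem _ ha hb

/-- The generators indexed by natural numbers; they vanish outside the range. -/
def gen (m i : ℕ) : TLD m := if h : i < m then E ⟨i, h⟩ else 0

lemma gen_val (s : Fin m) : gen m s = E s := by simp [gen]

lemma gen_of_lt {i : ℕ} (h : i < m) : gen m i = E ⟨i, h⟩ := by simp [gen, h]

lemma tlRel_gen (n : ℕ) : TLRel (-qInt 2) n (gen (n + 1)) where
  sq i hi := by
    rw [gen_of_lt (by omega)]
    have h := RingQuot.mkAlgHom_rel K (Rel.sq (⟨i, by omega⟩ : Fin (n + 1)))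
    rwa [map_mul, map_smul] at h
  comm i j hi hj h := by
    rw [gen_of_lt (by omega), gen_of_lt (by omega)]
    simpa [E] using RingQuot.mkAlgHom_rel K
      (Rel.comm (⟨i, by omega⟩ : Fin (n + 1)) ⟨j, by omega⟩ (by simpa using h))
  braid i j hi hj h := by
    rw [gen_of_lt (by omega), gen_of_lt (by omega)]
    simpa [E] using RingQuot.mkAlgHom_rel K
      (Rel.braid (⟨i, by omega⟩ : Fin (n + 1)) ⟨j, by omega⟩ (by simpa using h))

lemma incl_E {k m : ℕ} (h : k ≤ m) (i : Fin k) : incl h (E i) = E (Fin.castLE h i) := by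
  rw [incl, E, RingQuot.liftAlgHom_mkAlgHom_apply, FreeAlgebra.lift_ι_apply]

end Rep


/-! ### Inserting an arc -/

/-- An embedding of `α` into `β` that misses exactly the two points `u` and `v`. -/
structure Slot (α β : Type*) where
  up : α → β
  down : β → α
  u : β
  v : β
  u_ne : u ≠ v
  up_ne_u : ∀ p, up p ≠ u
  up_ne_v : ∀ p, up p ≠ v
  down_up : ∀ p, down (up p) = p
  up_down : ∀ q, q ≠ u → q ≠ v → up (down q) = q

lemma Slot.eq_or {α β : Type*} (I : Slot α β) (q : β) :
    q = I.u ∨ q = I.v ∨ ∃ p, q = I.up p := by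
  by_cases h1 : q = I.u
  · exact Or.inl h1
  by_cases h2 : q = I.v
  · exact Or.inr (Or.inl h2)
  exact Or.inr (Or.inr ⟨_, (I.up_down q h1 h2).symm⟩)

namespace State

variable {α β : Type*}

/-- Multiply by a dotted loop. -/
def tagged (S : State α) : State α where
  tag := true
  par := S.par
  dot _ := false
  par_par := S.par_par
  par_ne := S.par_ne
  dot_par _ := rfl
  tag_dot _ _ := rfl

/-- Two slots that differ by moving the arc over by one point. -/
structure Shift (I J : Slot α β) (z : α) : Prop where
  v_eq : J.v = I.u
  up_z : I.up z = J.u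
  up_z' : J.up z = I.v
  up_eq : ∀ p, p ≠ z → I.up p = J.up p

lemma up_down_par (I : Slot α β) (S : State β) (h : S.par I.u = I.v) (p : α) :
    I.up (I.down (S.par (I.up p))) = S.par (I.up p) := by
  have h1 := S.par_par
  refine I.up_down _ (fun h' => I.up_ne_v p ?_) (fun h' => I.up_ne_u p ?_)
  · rw [← h1 (I.up p), h', h]
  · rw [← h1 (I.up p), h', ← h, h1]

/-- Delete the arc between the two points of the slot. -/
def remove (I : Slot α β) (S : State β) (h : S.par I.u = I.v) : State α where
  tag := S.tag
  par p := I.down (S.par (I.up p))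
  dot p := S.dot (I.up p)
  par_par p := by rw [S.up_down_par I h, S.par_par, I.down_up]
  par_ne p h' := by
    refine S.par_ne (I.up p) ?_
    rw [← S.up_down_par I h, h']
  dot_par p := by rw [S.up_down_par I h, S.dot_par]
  tag_dot h p := S.tag_dot h _

lemma up_eq_iff (I : Slot α β) (p p' : α) : I.up p = I.up p' ↔ p = p' :=
  ⟨fun h => by rw [← I.down_up p, h, I.down_up], fun h => by rw [h]⟩

variable [DecidableEq β]

/-- Add an arc without dot between the two new points. -/
def insert (I : Slot α β) (S : State α) : State β where
  tag := S.tag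
  par q := if q = I.u then I.v else if q = I.v then I.u else I.up (S.par (I.down q))
  dot q := if q = I.u ∨ q = I.v then false else S.dot (I.down q)
  par_par q := by
    have h1 := S.par_par
    have h2 := I.u_ne
    have h3 := I.up_ne_u
    have h4 := I.up_ne_v
    have h5 := I.down_up
    have h6 := I.up_down
    grind
  par_ne q := by
    have h1 := S.par_ne
    have h2 := I.u_ne
    have h3 := I.up_ne_u
    have h4 := I.up_ne_v
    have h5 := I.down_up
    have h6 := I.up_down
    grind
  dot_par q := by
    have h1 := S.dot_par
    have h2 := I.u_ne
    have h3 := I.up_ne_u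
    have h4 := I.up_ne_v
    have h5 := I.down_up
    have h6 := I.up_down
    grind
  tag_dot h q := by
    rw [S.tag_dot h, ite_self]

lemma insert_tagged (I : Slot α β) (S : State α) : S.tagged.insert I = (S.insert I).tagged := by
  ext p
  · rfl
  · rfl
  · simp [insert, tagged]

lemma remove_insert (I : Slot α β) (S : State α) (h : (S.insert I).par I.u = I.v) :
    (S.insert I).remove I h = S := by
  have h3 := I.up_ne_u
  have h4 := I.up_ne_v
  have h5 := I.down_up
  ext p <;> simp only [insert, remove] <;> grind

lemma insert_remove (I : Slot α β) (S : State β) (h : S.par I.u = I.v) (h' : S.dot I.u = false) :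
    (S.remove I h).insert I = S := by
  have h0 := S.dot_par
  have h1 := S.par_par
  have h3 := I.up_ne_u
  have h4 := I.up_ne_v
  have h5 := I.down_up
  have h6 := I.up_down
  have h8 := S.up_down_par I h
  ext p <;> simp only [insert, remove] <;> grind

lemma insert_par_u (I : Slot α β) (S : State α) : (S.insert I).par I.u = I.v := by
  simp [insert]

lemma insert_dot_u (I : Slot α β) (S : State α) : (S.insert I).dot I.u = false := by
  simp [insert]

lemma insert_par_up (I : Slot α β) (S : State α) (p : α) :
    (S.insert I).par (I.up p) = I.up (S.par p) := by
  simp [insert, I.up_ne_u, I.up_ne_v, I.down_up]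

lemma insert_dot_up (I : Slot α β) (S : State α) (p : α) :
    (S.insert I).dot (I.up p) = S.dot p := by
  simp [insert, I.up_ne_u, I.up_ne_v, I.down_up]

lemma insert_joinCoef_shift {F : Type*} [One F] (δ : F) {I J : Slot α β} {z : α}
    (h : Shift I J z) (S : State α) (e : Bool) : (S.insert J).joinCoef δ I.v I.u e = 1 := by
  refine if_neg fun h' => ?_
  rw [← h.up_z', insert_par_up] at h'
  exact J.up_ne_v _ (h'.1.trans h.v_eq.symm)

lemma insert_joinCoef_shift' {F : Type*} [One F] (δ : F) {I J : Slot α β} {z : α}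
    (h : Shift I J z) (S : State α) (e : Bool) : (S.insert I).joinCoef δ J.v J.u e = 1 := by
  refine if_neg fun h' => ?_
  rw [← h.up_z, h.v_eq, insert_par_u] at h'
  exact I.up_ne_v _ h'.1.symm

lemma insert_join_loop (I : Slot α β) (S : State α) :
    (S.insert I).join I.v I.u I.u_ne.symm true = S.tagged.insert I := by
  have h0 := S.dot_par
  have h1 := S.par_par
  have h2 := S.par_ne
  have i2 := I.u_ne
  have i3 := I.up_ne_u
  have i4 := I.up_ne_v
  have i5 := I.down_up
  have i6 := I.up_down
  ext q <;> simp only [join, insert, tagged] <;> grind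

lemma insert_joinCoef_loop {F : Type*} [One F] (δ : F) (I : Slot α β) (S : State α) :
    (S.insert I).joinCoef δ I.v I.u true = if S.tag = true then δ else 1 := by
  simp only [joinCoef, insert]
  simp

lemma insert_par_v (I : Slot α β) (S : State α) : (S.insert I).par I.v = I.u := by
  simp [insert, I.u_ne.symm]

lemma insert_dot_v (I : Slot α β) (S : State α) : (S.insert I).dot I.v = false := by
  simp [insert]

variable [DecidableEq α]

/-- Add an arc with a dot between the two new points, and change the dot on the arc at `z`. -/
def insertDot (I : Slot α β) (z : α) (S : State α) : State β where
  tag := S.tag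
  par q := if q = I.u then I.v else if q = I.v then I.u else I.up (S.par (I.down q))
  dot q := !S.tag && if q = I.u ∨ q = I.v then true else
    (S.dot (I.down q) ^^ decide (I.down q = z ∨ I.down q = S.par z))
  par_par := (S.insert I).par_par
  par_ne := (S.insert I).par_ne
  dot_par q := by
    have h1 := S.dot_par
    have h2 := I.u_ne
    have h3 := I.up_ne_u
    have h4 := I.up_ne_v
    have h5 := I.down_up
    have h6 := I.up_down
    have h7 := S.par_par
    grind
  tag_dot h q := by
    rw [h]
    rfl

/-- On tagged states a dotted cap is the same as an undotted one. This is the source of the factor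
`2` at `i = 1` in the recursion. -/
lemma insertDot_of_tag (I : Slot α β) (z : α) (S : State α) (h : S.tag = true) :
    S.insertDot I z = S.insert I := by
  ext p
  · rfl
  · rfl
  · simp [insertDot, insert, h, S.tag_dot h]

lemma insertDot_par_u (I : Slot α β) (z : α) (S : State α) :
    (S.insertDot I z).par I.u = I.v := by
  simp [insertDot]

lemma insertDot_par_up (I : Slot α β) (z : α) (S : State α) (p : α) :
    (S.insertDot I z).par (I.up p) = I.up (S.par p) := by
  simp [insertDot, I.up_ne_u, I.up_ne_v, I.down_up]

lemma insertDot_dot_up (I : Slot α β) (z : α) (S : State α) (p : α) (h : S.tag = false) :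
    (S.insertDot I z).dot (I.up p) = (S.dot p ^^ decide (p = z ∨ p = S.par z)) := by
  simp [insertDot, I.up_ne_u, I.up_ne_v, I.down_up, h]

/-- Change the dot on the arc at `z`. -/
def flip (z : α) (S : State α) : State α where
  tag := S.tag
  par := S.par
  dot p := !S.tag && (S.dot p ^^ decide (p = z ∨ p = S.par z))
  par_par := S.par_par
  par_ne := S.par_ne
  dot_par p := by
    have h1 := S.dot_par
    have h7 := S.par_par
    grind
  tag_dot h q := by
    rw [h]
    rfl

lemma remove_insertDot (I : Slot α β) (z : α) (S : State α)
    (h : (S.insertDot I z).par I.u = I.v) :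
    (S.insertDot I z).remove I h = S.flip z := by
  have h3 := I.up_ne_u
  have h4 := I.up_ne_v
  have h5 := I.down_up
  ext p <;> simp only [insertDot, remove, flip] <;> grind

lemma insertDot_remove (I : Slot α β) (z : α) (S : State β) (h : S.par I.u = I.v)
    (h' : S.dot I.u = true) : ((S.remove I h).flip z).insertDot I z = S := by
  have h0 := S.dot_par
  have h1 := S.par_par
  have h3 := I.up_ne_u
  have h4 := I.up_ne_v
  have h5 := I.down_up
  have h6 := I.up_down
  have h8 := S.up_down_par I h
  have h7 : S.tag = false := by
    by_contra h
    rw [S.tag_dot (by simpa using h)] at h'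
    simp at h'
  ext p
  · rfl
  · simp only [insertDot, remove, flip]
    grind
  · simp only [insertDot, remove, flip, h7]
    grind

lemma flip_flip (z : α) (S : State α) : (S.flip z).flip z = S := by
  ext p
  · rfl
  · rfl
  · simp only [flip]
    cases h : S.tag
    · by_cases hp : p = z ∨ p = S.par z <;> simp [hp]
    · simp [S.tag_dot h p]

lemma insertDot_par_v (I : Slot α β) (z : α) (S : State α) :
    (S.insertDot I z).par I.v = I.u := by
  simp [insertDot, I.u_ne.symm]

lemma insertDot_dot_u (I : Slot α β) (z : α) (S : State α) :
    (S.insertDot I z).dot I.u = !S.tag := by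
  simp [insertDot]

lemma insertDot_dot_v (I : Slot α β) (z : α) (S : State α) :
    (S.insertDot I z).dot I.v = !S.tag := by
  simp [insertDot]

lemma insert_join (I : Slot α β) (S : State α) (a b : α) (hab : a ≠ b)
    (hab' : I.up a ≠ I.up b) (e : Bool) :
    (S.insert I).join (I.up a) (I.up b) hab' e = (S.join a b hab e).insert I := by
  have h3 := fun p => (I.up_ne_u p).symm
  have h4 := fun p => (I.up_ne_v p).symm
  have htag : (S.insert I).tag = S.tag := rfl
  ext q
  · simp only [join, insert_par_up, insert_dot_up, up_eq_iff]
    rfl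
  · rcases I.eq_or q with rfl | rfl | ⟨p, rfl⟩
    · simp [join, insert_par_up, insert_par_u, h3]
    · simp [join, insert_par_up, insert_par_v, h4]
    · simp only [join, insert_par_up, up_eq_iff]
      split_ifs <;> rfl
  · rcases I.eq_or q with rfl | rfl | ⟨p, rfl⟩
    · simp [join, insert_par_up, insert_dot_u, h3]
    · simp [join, insert_par_up, insert_dot_v, h4]
    · simp only [join, insert_par_up, insert_dot_up, up_eq_iff, htag]

lemma insert_joinCoef {F : Type*} [One F] (δ : F) (I : Slot α β) (S : State α) (a b : α)
    (e : Bool) : (S.insert I).joinCoef δ (I.up a) (I.up b) e = S.joinCoef δ a b e := by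
  have h5 := I.down_up
  have h6 : I.up (S.par a) = I.up b ↔ S.par a = b := by grind
  simp only [joinCoef, insert_par_up, insert_dot_up, h6]
  rfl

/-- The join pulls the arc inserted at `J` over to `I`, while the end of the strand at `z` moves to
the other side. If the generator is dotted, one dot stays on the new cap and one on that strand. -/
lemma insert_join_shift {I J : Slot α β} {z : α} (h : Shift I J z) (S : State α) (e : Bool) :
    (S.insert J).join I.v I.u I.u_ne.symm e =
      if e = true then S.insertDot I z else S.insert I := by
  obtain ⟨k1, k2, k3, k4⟩ := h
  have h0 := S.dot_par
  have h1 := S.par_par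
  have h2 := S.par_ne
  have i2 := I.u_ne
  have i3 := I.up_ne_u
  have i4 := I.up_ne_v
  have i5 := I.down_up
  have j2 := J.u_ne
  have j3 := J.up_ne_u
  have j4 := J.up_ne_v
  have j5 := J.down_up
  have h7 := S.tag_dot
  have s1 := S.insert_par_u J
  have s2 := S.insert_par_v J
  have s3 := S.insert_par_up J
  have s4 := S.insert_dot_u J
  have s5 := S.insert_dot_v J
  have s6 := S.insert_dot_up J
  have s7 : (S.insert J).tag = S.tag := rfl
  have t1 := S.insert_par_u I
  have t2 := S.insert_par_v I
  have t3 := S.insert_par_up I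
  have t4 := S.insert_dot_u I
  have t5 := S.insert_dot_v I
  have t6 := S.insert_dot_up I
  have t7 : (S.insert I).tag = S.tag := rfl
  have u1 := S.insertDot_par_u I z
  have u2 := S.insertDot_par_v I z
  have u3 := S.insertDot_par_up I z
  have u4 := S.insertDot_dot_u I z
  have u5 := S.insertDot_dot_v I z
  have u6 := fun p => S.insertDot_dot_up I z p
  have u7 : (S.insertDot I z).tag = S.tag := rfl
  have u8 : S.tag = true → ∀ q, (S.insertDot I z).dot q = false := (S.insertDot I z).tag_dot
  have htag : ((S.insert J).join I.v I.u I.u_ne.symm e).tag = S.tag := by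
    simp only [join]
    grind
  cases e
  · rw [if_neg (by simp)]
    ext q
    · exact htag
    · rcases J.eq_or q with rfl | rfl | ⟨p, rfl⟩
      · simp only [join]
        grind
      · simp only [join]
        grind
      · have e1 := k4 p
        have e2 := k4 (S.par p)
        have e3 := k4 (S.par z)
        simp only [join]
        by_cases hp : p = z <;> by_cases hq : S.par p = z <;> grind
    · cases hS : S.tag
      · rw [hS] at htag
        rw [join_dot_of_tag _ _ _ _ _ htag]
        have e3 := k4 (S.par z)
        rcases J.eq_or q with rfl | rfl | ⟨p, rfl⟩
        · grind
        · grind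
        · have e1 := k4 p
          have e2 := k4 (S.par p)
          by_cases hp : p = z <;> by_cases hq : S.par p = z <;> grind
      · rw [hS] at htag
        exact (tag_dot _ htag q).trans (tag_dot (S.insert I) hS q).symm
  · rw [if_pos rfl]
    ext q
    · exact htag
    · rcases J.eq_or q with rfl | rfl | ⟨p, rfl⟩
      · simp only [join]
        grind
      · simp only [join]
        grind
      · have e1 := k4 p
        have e2 := k4 (S.par p)
        have e3 := k4 (S.par z)
        simp only [join]
        by_cases hp : p = z <;> by_cases hq : S.par p = z <;> grind
    · cases hS : S.tag
      · rw [hS] at htag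
        rw [join_dot_of_tag _ _ _ _ _ htag]
        have e3 := k4 (S.par z)
        rcases J.eq_or q with rfl | rfl | ⟨p, rfl⟩
        · grind
        · grind
        · have e1 := k4 p
          have e2 := k4 (S.par p)
          by_cases hp : p = z <;> by_cases hq : S.par p = z <;> grind
      · rw [hS] at htag
        exact (tag_dot _ htag q).trans (tag_dot (S.insertDot I z) hS q).symm

lemma insert_join_shift' {I J : Slot α β} {z : α} (h : Shift I J z) (S : State α) :
    (S.insert I).join J.v J.u J.u_ne.symm false = S.insert J := by
  obtain ⟨k1, k2, k3, k4⟩ := h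
  have h0 := S.dot_par
  have h1 := S.par_par
  have h2 := S.par_ne
  have i2 := I.u_ne
  have i3 := I.up_ne_u
  have i4 := I.up_ne_v
  have i5 := I.down_up
  have j2 := J.u_ne
  have j3 := J.up_ne_u
  have j4 := J.up_ne_v
  have j5 := J.down_up
  have h7 := S.tag_dot
  have s1 := S.insert_par_u J
  have s2 := S.insert_par_v J
  have s3 := S.insert_par_up J
  have s4 := S.insert_dot_u J
  have s5 := S.insert_dot_v J
  have s6 := S.insert_dot_up J
  have t1 := S.insert_par_u I
  have t2 := S.insert_par_v I
  have t3 := S.insert_par_up I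
  have t4 := S.insert_dot_u I
  have t5 := S.insert_dot_v I
  have t6 := S.insert_dot_up I
  have t7 : (S.insert I).tag = S.tag := rfl
  have htag : ((S.insert I).join J.v J.u J.u_ne.symm false).tag = S.tag := by
    simp only [join]
    grind
  ext q
  · exact htag
  · rcases I.eq_or q with rfl | rfl | ⟨p, rfl⟩
    · simp only [join]
      grind
    · simp only [join]
      grind
    · have e1 := k4 p
      have e2 := k4 (S.par p)
      have e3 := k4 (S.par z)
      simp only [join]
      by_cases hp : p = z <;> by_cases hq : S.par p = z <;> grind
  · cases hS : S.tag
    · rw [hS] at htag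
      have x1 : (S.insert I).dot J.v = false := by rw [k1, t4]
      have x2 : (S.insert I).dot J.u = S.dot z := by rw [← k2, t6]
      rw [join_dot_of_tag _ _ _ _ _ htag, x1, x2, Bool.false_xor, Bool.false_xor]
      have e3 := k4 (S.par z)
      rcases I.eq_or q with rfl | rfl | ⟨p, rfl⟩
      · grind
      · grind
      · have e1 := k4 p
        have e2 := k4 (S.par p)
        by_cases hp : p = z <;> by_cases hq : S.par p = z <;> grind
    · rw [hS] at htag
      exact (tag_dot _ htag q).trans (tag_dot (S.insert J) hS q).symm

end State


/-! ### Inserting a cap into a state on fewer strands -/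

/-- The slot for a cap at position `i` (a right-most vertical strand if `i = n + 1`). -/
def slot {n : ℕ} (hn : 1 ≤ n) (i : ℕ) : Slot (Fin (2 * n)) (Fin (2 * (n + 1))) where
  up p := ⟨if (p : ℕ) < 2 * n - (i - 1) then p else p + 2, by split_ifs <;> omega⟩
  down q := ⟨min (if (q : ℕ) < 2 * n - (i - 1) then q else q - 2) (2 * n - 1), by omega⟩
  -- The truncated `i - 1` makes slots `0` and `1` coincide, as the caps of `E_0` and `E_1` do.
  u := ⟨2 * n - (i - 1), by omega⟩
  v := ⟨2 * n - (i - 1) + 1, by omega⟩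
  u_ne := by simp
  up_ne_u p h := by
    have := congrArg Fin.val h
    simp only at this
    split_ifs at this <;> omega
  up_ne_v p h := by
    have := congrArg Fin.val h
    simp only at this
    split_ifs at this <;> omega
  down_up p := by
    ext
    have := p.isLt
    simp only
    split_ifs <;> omega
  up_down q hu hv := by
    ext
    have h1 : (q : ℕ) ≠ 2 * n - (i - 1) := fun h => hu (Fin.ext h)
    have h2 : (q : ℕ) ≠ 2 * n - (i - 1) + 1 := fun h => hv (Fin.ext h)
    have := q.isLt
    simp only
    split_ifs <;> omega

lemma shift_slot {n : ℕ} (hn : 1 ≤ n) {i : ℕ} (h1 : 1 ≤ i) (hi : i ≤ n) :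
    State.Shift (slot hn i) (slot hn (i + 1)) ⟨2 * n - i, by omega⟩ where
  v_eq := by
    ext
    simp only [slot]
    omega
  up_z := by
    ext
    simp only [slot]
    split_ifs <;> omega
  up_z' := by
    ext
    simp only [slot]
    split_ifs <;> omega
  up_eq p hp := by
    have h' : (p : ℕ) ≠ 2 * n - i := fun h => hp (Fin.ext h)
    ext
    simp only [slot]
    split_ifs <;> omega

namespace State

variable {n : ℕ} (hn : 1 ≤ n)

lemma step_eq {m : ℕ} (S : State (Fin (2 * m))) {s : Fin m} {a b : Fin (2 * m)} {e : Bool}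
    (hab : a ≠ b) (ha : ptA s = a) (hb : ptB s = b) (he : decide ((s : ℕ) = 0) = e) :
    S.step s = S.join a b hab e := by
  subst ha hb he
  rfl

lemma stepCoef_eq {m : ℕ} (S : State (Fin (2 * m))) {s : Fin m} {a b : Fin (2 * m)} {e : Bool}
    (ha : ptA s = a) (hb : ptB s = b) (he : decide ((s : ℕ) = 0) = e) :
    S.stepCoef s = S.joinCoef (-qInt 2) a b e := by
  subst ha hb he
  rfl

lemma ptA_eq_slot {i : ℕ} (hi : i < n + 1) :
    ptA (⟨i, hi⟩ : Fin (n + 1)) = (slot hn i).v := by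
  ext
  simp only [ptA, slot]
  omega

lemma ptB_eq_slot {i : ℕ} (hi : i < n + 1) :
    ptB (⟨i, hi⟩ : Fin (n + 1)) = (slot hn i).u := by
  ext
  simp only [ptB, slot]
  omega

lemma insert_step (S : State (Fin (2 * n))) {i : ℕ} (h1 : 1 ≤ i) (hi : i < n + 1) :
    (S.insert (slot hn (i + 1))).step ⟨i, hi⟩ = S.insert (slot hn i) := by
  rw [step_eq _ (slot hn i).u_ne.symm (ptA_eq_slot hn hi) (ptB_eq_slot hn hi)
    (decide_eq_false (by simp; omega)),
    insert_join_shift (shift_slot hn h1 (by omega)), if_neg (by simp)]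

lemma insert_stepCoef (S : State (Fin (2 * n))) {i : ℕ} (h1 : 1 ≤ i) (hi : i < n + 1) :
    (S.insert (slot hn (i + 1))).stepCoef ⟨i, hi⟩ = 1 := by
  rw [stepCoef_eq _ (ptA_eq_slot hn hi) (ptB_eq_slot hn hi) rfl,
    insert_joinCoef_shift _ (shift_slot hn h1 (by omega))]

lemma insert_step_succ (S : State (Fin (2 * n))) {i : ℕ} (h1 : 1 ≤ i) (hi : i + 1 < n + 1) :
    (S.insert (slot hn i)).step ⟨i + 1, hi⟩ = S.insert (slot hn (i + 1)) := by
  rw [step_eq _ (slot hn (i + 1)).u_ne.symm (ptA_eq_slot hn hi) (ptB_eq_slot hn hi)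
    (decide_eq_false (by simp)),
    insert_join_shift' (shift_slot hn h1 (by omega))]

lemma insert_stepCoef_succ (S : State (Fin (2 * n))) {i : ℕ} (h1 : 1 ≤ i) (hi : i + 1 < n + 1) :
    (S.insert (slot hn i)).stepCoef ⟨i + 1, hi⟩ = 1 := by
  rw [stepCoef_eq _ (ptA_eq_slot hn hi) (ptB_eq_slot hn hi) rfl,
    insert_joinCoef_shift' _ (shift_slot hn h1 (by omega))]

/-- The cap of `E_0` replaces the one at position `2`, and the strand at the left-most bottom point,
with index `2 * n - 1` in `S`, receives the dot of the cup. -/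
lemma insert_step_zero (S : State (Fin (2 * n))) :
    (S.insert (slot hn 2)).step ⟨0, by omega⟩ =
      S.insertDot (slot hn 1) ⟨2 * n - 1, by omega⟩ := by
  rw [step_eq _ (slot hn 0).u_ne.symm (ptA_eq_slot hn _) (ptB_eq_slot hn _)
    (decide_eq_true rfl)]
  have := insert_join_shift (shift_slot hn le_rfl hn) S true
  rwa [if_pos rfl] at this

lemma insert_stepCoef_zero (S : State (Fin (2 * n))) :
    (S.insert (slot hn 2)).stepCoef ⟨0, by omega⟩ = 1 := by
  rw [stepCoef_eq _ (ptA_eq_slot hn _) (ptB_eq_slot hn _) (decide_eq_true rfl)]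
  exact insert_joinCoef_shift _ (shift_slot hn le_rfl hn) S true

lemma insert_step_loop (S : State (Fin (2 * n))) :
    (S.insert (slot hn 1)).step ⟨0, by omega⟩ = S.tagged.insert (slot hn 1) := by
  rw [step_eq _ (slot hn 0).u_ne.symm (ptA_eq_slot hn _) (ptB_eq_slot hn _)
    (decide_eq_true rfl)]
  exact insert_join_loop (slot hn 1) S

lemma insert_stepCoef_loop (S : State (Fin (2 * n))) :
    (S.insert (slot hn 1)).stepCoef ⟨0, by omega⟩ = if S.tag = true then -qInt 2 else 1 := by
  rw [stepCoef_eq _ (ptA_eq_slot hn _) (ptB_eq_slot hn _) (decide_eq_true rfl)]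
  exact insert_joinCoef_loop _ (slot hn 1) S

lemma ptA_castLE (h2 : 2 ≤ n) (s : Fin n) :
    ptA (Fin.castLE (Nat.le_succ n) s) = (slot hn (n + 1)).up (ptA s) := by
  have := s.isLt
  ext
  simp only [ptA, slot, Fin.val_castLE]
  split_ifs <;> omega

/-- This fails for `n = 1`, where `ptB 0` is a top point: `E_0` on one strand joins the two ends of
that strand. -/
lemma ptB_castLE (h2 : 2 ≤ n) (s : Fin n) :
    ptB (Fin.castLE (Nat.le_succ n) s) = (slot hn (n + 1)).up (ptB s) := by
  have := s.isLt
  ext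
  simp only [ptB, slot, Fin.val_castLE]
  split_ifs <;> omega

lemma insert_step_castLE (h2 : 2 ≤ n) (S : State (Fin (2 * n))) (s : Fin n) :
    (S.insert (slot hn (n + 1))).step (Fin.castLE (Nat.le_succ n) s) =
      (S.step s).insert (slot hn (n + 1)) := by
  rw [step_eq (e := decide ((s : ℕ) = 0)) _
    (fun h => ptA_ne_ptB s (((slot hn (n + 1)).down_up _).symm.trans
      ((congrArg (slot hn (n + 1)).down h).trans ((slot hn (n + 1)).down_up _))))
    (ptA_castLE hn h2 s) (ptB_castLE hn h2 s) rfl, insert_join _ _ _ _ (ptA_ne_ptB s)]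
  rfl

lemma insert_stepCoef_castLE (h2 : 2 ≤ n) (S : State (Fin (2 * n))) (s : Fin n) :
    (S.insert (slot hn (n + 1))).stepCoef (Fin.castLE (Nat.le_succ n) s) = S.stepCoef s := by
  rw [stepCoef_eq (e := decide ((s : ℕ) = 0)) _ (ptA_castLE hn h2 s) (ptB_castLE hn h2 s) rfl,
    insert_joinCoef]
  rfl

lemma insert_one : (one n).insert (slot hn (n + 1)) = one (n + 1) := by
  ext p
  · rfl
  · have := p.isLt
    simp only [insert, one, slot, Fin.ext_iff, Fin.val_rev]
    split_ifs <;> simp only <;> omega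
  · simp [insert, one]

end State

/-! ### Coset words act on diagrams by inserting caps -/

section Expand

variable {n : ℕ} (hn : 1 ≤ n)

/-- Insertion of a cap at position `i`, extended linearly. -/
def insL (i : ℕ) : StateModule n →ₗ[K] StateModule (n + 1) :=
  Finsupp.lmapDomain K K (State.insert (slot hn i))

/-- Insertion of a dotted cap at position `1`, extended linearly. -/
def insDotL : StateModule n →ₗ[K] StateModule (n + 1) :=
  Finsupp.lmapDomain K K (State.insertDot (slot hn 1) ⟨2 * n - 1, by omega⟩)

/-- Insertion of a cap at position `i` together with a dotted loop, extended linearly. -/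
def insTagL (i : ℕ) : StateModule n →ₗ[K] StateModule (n + 1) :=
  Finsupp.linearCombination K fun S =>
    Finsupp.single (S.tagged.insert (slot hn i)) (if S.tag = true then -qInt 2 else 1)

lemma insL_single (i : ℕ) (S : State (Fin (2 * n))) (c : K) :
    insL hn i (Finsupp.single S c) = Finsupp.single (S.insert (slot hn i)) c := by
  simp [insL]

lemma insDotL_single (S : State (Fin (2 * n))) (c : K) :
    insDotL hn (Finsupp.single S c) =
      Finsupp.single (S.insertDot (slot hn 1) ⟨2 * n - 1, by omega⟩) c := by
  simp [insDotL]

lemma insTagL_single (i : ℕ) (S : State (Fin (2 * n))) (c : K) :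
    insTagL hn i (Finsupp.single S c) = Finsupp.single (S.tagged.insert (slot hn i))
      (c * if S.tag = true then -qInt 2 else 1) := by
  simp only [insTagL, Finsupp.linearCombination_single, Finsupp.smul_single, smul_eq_mul]

lemma act_insL {i : ℕ} (h1 : 1 ≤ i) (hi : i < n + 1) (v : StateModule n) :
    act ⟨i, hi⟩ (insL hn (i + 1) v) = insL hn i v := by
  suffices h : act ⟨i, hi⟩ ∘ₗ insL hn (i + 1) = insL hn i from LinearMap.congr_fun h v
  refine Finsupp.lhom_ext fun S c => ?_
  rw [LinearMap.comp_apply, insL_single, insL_single, act_single, S.insert_step hn h1,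
    S.insert_stepCoef hn h1, mul_one]

lemma act_zero_insL (v : StateModule n) :
    act ⟨0, by omega⟩ (insL hn 2 v) = insDotL hn v := by
  suffices h : act ⟨0, by omega⟩ ∘ₗ insL hn 2 = insDotL hn from LinearMap.congr_fun h v
  refine Finsupp.lhom_ext fun S c => ?_
  rw [LinearMap.comp_apply, insL_single, insDotL_single, act_single, S.insert_step_zero hn,
    S.insert_stepCoef_zero hn, mul_one]

lemma act_zero_insL_one (v : StateModule n) :
    act ⟨0, by omega⟩ (insL hn 1 v) = insTagL hn 1 v := by
  suffices h : act ⟨0, by omega⟩ ∘ₗ insL hn 1 = insTagL hn 1 from LinearMap.congr_fun h v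
  refine Finsupp.lhom_ext fun S c => ?_
  rw [LinearMap.comp_apply, insL_single, insTagL_single, act_single, S.insert_step_loop hn,
    S.insert_stepCoef_loop hn]

lemma act_insTagL {i : ℕ} (h1 : 1 ≤ i) (hi : i + 1 < n + 1) (v : StateModule n) :
    act ⟨i + 1, hi⟩ (insTagL hn i v) = insTagL hn (i + 1) v := by
  suffices h : act ⟨i + 1, hi⟩ ∘ₗ insTagL hn i = insTagL hn (i + 1) from LinearMap.congr_fun h v
  refine Finsupp.lhom_ext fun S c => ?_
  rw [LinearMap.comp_apply, insTagL_single, insTagL_single, act_single,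
    State.insert_step_succ hn _ h1, State.insert_stepCoef_succ hn _ h1, mul_one]

lemma act_castLE_insL (h2 : 2 ≤ n) (s : Fin n) (v : StateModule n) :
    act (Fin.castLE (Nat.le_succ n) s) (insL hn (n + 1) v) = insL hn (n + 1) (act s v) := by
  suffices h : act (Fin.castLE (Nat.le_succ n) s) ∘ₗ insL hn (n + 1) =
      insL hn (n + 1) ∘ₗ act s from LinearMap.congr_fun h v
  refine Finsupp.lhom_ext fun S c => ?_
  rw [LinearMap.comp_apply, LinearMap.comp_apply, insL_single, act_single, act_single,
    S.insert_step_castLE hn h2, S.insert_stepCoef_castLE hn h2, insL_single]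

lemma expand_one_succ : expand (n + 1) 1 = insL hn (n + 1) (expand n 1) := by
  rw [expand_one, expand_one, insL_single, State.insert_one]

lemma expand_incl (h2 : 2 ≤ n) (y : TLD n) :
    expand (n + 1) (incl (Nat.le_succ n) y) = insL hn (n + 1) (expand n y) := by
  suffices h : expand (n + 1) ∘ₗ (incl (Nat.le_succ n)).toLinearMap =
      insL hn (n + 1) ∘ₗ expand n from LinearMap.congr_fun h y
  refine LinearMap.ext_on span_word ?_
  rintro _ ⟨w, rfl⟩
  simp only [LinearMap.comp_apply, AlgHom.toLinearMap_apply]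
  induction w using List.reverseRecOn with
  | nil => rw [word_nil, map_one, expand_one_succ]
  | append_singleton w s ih =>
    rw [word_concat, map_mul, incl_E, expand_mul_E, expand_mul_E, ih, act_castLE_insL hn h2]

variable {x : TLD (n + 1)} {v : StateModule n}

/-- Each letter of `e n ⋯ e i` moves the inserted arc one position to the left, starting from the
right-most vertical strand at position `n + 1`. -/
lemma expand_mul_desc (hx : expand (n + 1) x = insL hn (n + 1) v) {i : ℕ} (h1 : 1 ≤ i)
    (hi : i ≤ n + 1) : expand (n + 1) (x * desc (gen (n + 1)) n i) = insL hn i v := by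
  induction hi using Nat.decreasingInduction with
  | self => rw [desc_top, mul_one, hx]
  | of_succ i hi ih =>
    rw [desc_eq _ n (by omega), ← mul_assoc, gen_of_lt hi, expand_mul_E, ih (by omega),
      act_insL hn h1]

lemma expand_mul_descZero (hx : expand (n + 1) x = insL hn (n + 1) v) :
    expand (n + 1) (x * descZero (gen (n + 1)) n) = insDotL hn v := by
  rw [descZero, ← mul_assoc, gen_of_lt (by omega), expand_mul_E,
    expand_mul_desc hn hx (by omega) (by omega), act_zero_insL]

/-- After the descent the cap is at position `1`; `e 0` closes it to a dotted loop, and `e 2 ⋯ e i`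
moves the new cap back to position `i`. -/
lemma expand_mul_valley (hx : expand (n + 1) x = insL hn (n + 1) v) {i : ℕ} (h1 : 1 ≤ i)
    (hi : i ≤ n) : expand (n + 1) (x * valley (gen (n + 1)) n i) = insTagL hn i v := by
  induction i, h1 using Nat.le_induction with
  | base =>
    rw [valley_one, ← mul_assoc, gen_of_lt (by omega), expand_mul_E,
      expand_mul_desc hn hx le_rfl (by omega), act_zero_insL_one]
  | succ i h1 ih =>
    rw [valley_succ _ n h1, ← mul_assoc, gen_of_lt (by omega), expand_mul_E, ih (by omega),
      act_insTagL hn h1]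

end Expand


/-! ### Planar states -/

namespace State

/-- The matching has no crossings. -/
def NonCrossing {N : ℕ} (par : Fin N → Fin N) : Prop :=
  ∀ p r, ¬ (p < r ∧ r < par p ∧ par p < par r)

/-! ### Inner-most arcs of non-crossing matchings -/

section Matching

variable {N : ℕ} {par : Fin N → Fin N}

lemma nested_succ (hpp : ∀ p, par (par p) = p) (hne : ∀ p, par p ≠ p)
    (hnc : NonCrossing par) {p q : Fin N} (hp : p < par p) (hq : (q : ℕ) = p + 1) (h : par p ≠ q) :
    q < par q ∧ par q < par p := by
  have h1 := hnc p q
  have h2 := hnc (par q) p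
  rw [hpp] at h2
  have h3 := hne q
  have h4 : par q ≠ par p := fun h' => by
    have := congrArg par h'
    rw [hpp, hpp] at this
    have := congrArg Fin.val this
    omega
  have h5 : par q ≠ p := fun h' => h (by rw [← h', hpp])
  simp only [Fin.lt_def, ne_eq, Fin.ext_iff] at *
  omega

/-- Every arc encloses, or is, an inner-most one: pass to the arc at the next point inside and
induct on the length. -/
lemma exists_adjacent (hpp : ∀ p, par (par p) = p) (hne : ∀ p, par p ≠ p)
    (hnc : NonCrossing par) {p : Fin N} (hp : p < par p) :
    ∃ r : Fin N, p ≤ r ∧ (par r : ℕ) = r + 1 ∧ par r ≤ par p := by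
  induction h : (par p : ℕ) - p using Nat.strong_induction_on generalizing p with
  | _ k ih =>
    by_cases h1 : (par p : ℕ) = p + 1
    · exact ⟨p, le_rfl, h1, le_rfl⟩
    · have hq : (p : ℕ) + 1 < N := by
        have := (par p).isLt
        simp only [Fin.lt_def] at hp
        omega
      obtain ⟨h2, h3⟩ := nested_succ hpp hne hnc hp (q := ⟨p + 1, hq⟩) rfl
        (fun h' => h1 (congrArg Fin.val h'))
      obtain ⟨r, hr1, hr2, hr3⟩ := ih _ (by
        simp only [Fin.lt_def] at *
        omega) h2 rfl
      refine ⟨r, ?_, hr2, hr3.trans h3.le⟩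
      simp only [Fin.le_def] at *
      omega

/-- Otherwise the arc ending at the last point would enclose an inner-most arc beyond `L`, which
would not be outer-most. It is applied when all caps are dotted, hence outer-most, and then yields a
cap at position `1`. -/
lemma last_adjacent (hpp : ∀ p, par (par p) = p) (hne : ∀ p, par p ≠ p)
    (hnc : NonCrossing par) {L : ℕ} {r₀ y z : Fin N} (hy : (y : ℕ) + 2 = N) (hz : (z : ℕ) + 1 = N)
    (hL : L ≤ r₀) (hr₀ : (par r₀ : ℕ) = r₀ + 1)
    (hout : ∀ r : Fin N, L ≤ r → (par r : ℕ) = r + 1 → ∀ s : Fin N, ¬ (s < r ∧ par r < par s)) :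
    par y = z := by
  have hpz := hpp z
  by_contra hcon
  have hne1 : par z ≠ y := fun h => hcon (by rw [← h, hpp])
  have h1 := hout r₀ hL hr₀ (par z)
  rw [hpz] at h1
  have h2 : par z ≠ r₀ := fun h => by
    have h' : z = par r₀ := by rw [← h, hpz]
    have := congrArg Fin.val h'
    have := congrArg Fin.val h
    simp only [ne_eq, Fin.ext_iff] at hne1
    omega
  have h3 : par z ≠ par r₀ := fun h => by
    have h' : z = r₀ := by rw [← hpz, h, hpp]
    have := congrArg Fin.val h'
    have := (par r₀).isLt
    omega
  have h7 : par r₀ ≠ z := fun h => h2 (by rw [← h, hpp])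
  have h4 := hne z
  have hlt : par z < par (par z) := by
    rw [hpz]
    simp only [Fin.lt_def, ne_eq, Fin.ext_iff] at *
    have := (par z).isLt
    omega
  have hr := (par r₀).isLt
  have hpzlt := (par z).isLt
  obtain ⟨h5, h6⟩ := nested_succ hpp hne hnc hlt
    (q := ⟨par z + 1, by simp only [Fin.lt_def, ne_eq, Fin.ext_iff] at *; omega⟩) rfl (fun h' => by
      have := congrArg Fin.val (hpz.symm.trans h')
      simp only [ne_eq, Fin.ext_iff] at *
      omega)
  obtain ⟨r, hr1, hr2, hr3⟩ := exists_adjacent hpp hne hnc h5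
  refine hout r ?_ hr2 (par z) ⟨?_, lt_of_le_of_lt hr3 h6⟩
  · simp only [Fin.lt_def, Fin.le_def, ne_eq, Fin.ext_iff] at *
    omega
  · simp only [Fin.lt_def, Fin.le_def] at *
    omega

end Matching

/-- Without a cap all bottom points are joined to top points, and planarity makes this map strictly
decreasing. A strictly decreasing map between sets of `m` points is the reversal. -/
lemma exists_adjacent_of_ne_rev {m : ℕ} {par : Fin (2 * m) → Fin (2 * m)}
    (hpp : ∀ p, par (par p) = p) (hne : ∀ p, par p ≠ p) (hnc : NonCrossing par)
    (h : par ≠ Fin.rev) : ∃ r : Fin (2 * m), m ≤ r ∧ (par r : ℕ) = r + 1 := by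
  by_contra hcon
  push Not at hcon
  have top : ∀ p : Fin (2 * m), m ≤ p → (par p : ℕ) < m := by
    intro p hp
    by_contra hp'
    rcases lt_or_gt_of_ne (hne p) with h1 | h1
    · obtain ⟨r, hr1, hr2, -⟩ := exists_adjacent hpp hne hnc (p := par p) (by rwa [hpp])
      simp only [Fin.le_def] at hr1
      exact hcon r (by omega) hr2
    · obtain ⟨r, hr1, hr2, -⟩ := exists_adjacent hpp hne hnc h1
      simp only [Fin.le_def] at hr1
      exact hcon r (by omega) hr2
  have anti : ∀ p r : Fin (2 * m), m ≤ p → p < r → par r < par p := by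
    intro p r hp hpr
    have h1 := top p hp
    have h2 := top r (by simp only [Fin.lt_def] at hpr; omega)
    have h3 := hnc (par p) (par r)
    rw [hpp, hpp] at h3
    have h4 : par p ≠ par r := fun h' => by
      have := congrArg par h'
      rw [hpp, hpp] at this
      exact hpr.ne this
    simp only [Fin.lt_def, ne_eq, Fin.ext_iff] at *
    omega
  have upper : ∀ k (hk : m + k < 2 * m), (par ⟨m + k, hk⟩ : ℕ) + k + 1 ≤ m := by
    intro k
    induction k with
    | zero => intro hk; have := top ⟨m + 0, hk⟩ (by simp); omega
    | succ k ih =>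
      intro hk
      have h1 := ih (by omega)
      have h2 := anti ⟨m + k, by omega⟩ ⟨m + (k + 1), hk⟩ (by simp) (by simp [Fin.lt_def])
      simp only [Fin.lt_def] at h2
      omega
  have lower : ∀ k (hk : k < m), k ≤ (par ⟨2 * m - 1 - k, by omega⟩ : ℕ) := by
    intro k
    induction k with
    | zero => intro _; exact Nat.zero_le _
    | succ k ih =>
      intro hk
      have h1 := ih (by omega)
      have h2 := anti ⟨2 * m - 1 - (k + 1), by omega⟩ ⟨2 * m - 1 - k, by omega⟩
        (by simp only; omega) (by simp only [Fin.lt_def]; omega)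
      simp only [Fin.lt_def] at h2
      omega
  have bottom : ∀ p : Fin (2 * m), m ≤ p → par p = p.rev := by
    intro p hp
    have hp2 := p.isLt
    have h1 := upper (p - m) (by omega)
    have h2 := lower (2 * m - 1 - p) (by omega)
    have e1 : (⟨m + (p - m), by omega⟩ : Fin (2 * m)) = p := Fin.ext (by simp only; omega)
    have e2 : (⟨2 * m - 1 - (2 * m - 1 - p), by omega⟩ : Fin (2 * m)) = p :=
      Fin.ext (by simp only; omega)
    rw [e1] at h1
    rw [e2] at h2
    ext
    rw [Fin.val_rev]
    omega
  refine h (funext fun p => ?_)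
  by_cases hp : m ≤ p
  · exact bottom p hp
  · have h1 := bottom p.rev (by rw [Fin.val_rev]; omega)
    rw [Fin.rev_rev] at h1
    rw [← h1, hpp, h1]

/-- The points on dotted arcs. -/
def dotted {m : ℕ} (S : State (Fin (2 * m))) : Finset (Fin (2 * m)) :=
  Finset.univ.filter fun p => S.dot p = true

/-- Planar states with an even number of dots, all of them on outer-most arcs. -/
structure Planar {m : ℕ} (S : State (Fin (2 * m))) : Prop where
  noncrossing : NonCrossing S.par
  outer : ∀ p, S.dot p = true → ∀ r, ¬ (r < p ∧ r < S.par p ∧ p < S.par r ∧ S.par p < S.par r)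
  even : Even (S.dotted.card / 2)

/-- Planar states that represent diagrams. -/
structure Good {m : ℕ} (S : State (Fin (2 * m))) : Prop extends Planar S where
  par_ne_rev : S.tag = true → S.par ≠ Fin.rev

/-! ### Planarity and parity of dots under inserting a cap -/

section Slot

variable {n : ℕ} (hn : 1 ≤ n) (i : ℕ)

lemma slot_up_lt {p r : Fin (2 * n)} : (slot hn i).up p < (slot hn i).up r ↔ p < r := by
  simp only [slot, Fin.lt_def]
  split_ifs <;> omega

lemma slot_val : ((slot hn i).v : ℕ) = (slot hn i).u + 1 := rfl

lemma nonCrossing_insert {S : State (Fin (2 * n))} :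
    NonCrossing (S.insert (slot hn i)).par ↔ NonCrossing S.par := by
  have hv := slot_val hn i
  constructor
  · intro h p r h'
    refine h ((slot hn i).up p) ((slot hn i).up r) ?_
    rw [insert_par_up, insert_par_up, slot_up_lt, slot_up_lt, slot_up_lt]
    exact h'
  · intro h p r h'
    rcases (slot hn i).eq_or p with rfl | rfl | ⟨p, rfl⟩
    · rw [insert_par_u] at h'
      simp only [Fin.lt_def] at h'
      omega
    · rw [insert_par_v] at h'
      simp only [Fin.lt_def] at h'
      omega
    · rw [insert_par_up] at h'
      rcases (slot hn i).eq_or r with rfl | rfl | ⟨r, rfl⟩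
      · rw [insert_par_u] at h'
        simp only [Fin.lt_def] at h'
        omega
      · rw [insert_par_v] at h'
        simp only [Fin.lt_def] at h'
        omega
      · rw [insert_par_up, slot_up_lt, slot_up_lt, slot_up_lt] at h'
        exact h p r h'

lemma outer_insert {S : State (Fin (2 * n))} (p : Fin (2 * n)) :
    (∀ r, ¬ (r < (slot hn i).up p ∧ r < (slot hn i).up (S.par p) ∧
      (slot hn i).up p < (S.insert (slot hn i)).par r ∧
      (slot hn i).up (S.par p) < (S.insert (slot hn i)).par r)) ↔
    ∀ r, ¬ (r < p ∧ r < S.par p ∧ p < S.par r ∧ S.par p < S.par r) := by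
  have hv := slot_val hn i
  constructor
  · intro h r h'
    refine h ((slot hn i).up r) ?_
    rw [insert_par_up, slot_up_lt, slot_up_lt, slot_up_lt, slot_up_lt]
    exact h'
  · intro h r h'
    rcases (slot hn i).eq_or r with rfl | rfl | ⟨r, rfl⟩
    · rw [insert_par_u] at h'
      simp only [Fin.lt_def] at h'
      omega
    · rw [insert_par_v] at h'
      simp only [Fin.lt_def] at h'
      omega
    · rw [insert_par_up, slot_up_lt, slot_up_lt, slot_up_lt, slot_up_lt] at h'
      exact h r h'

lemma slot_up_injective : Function.Injective (slot hn i).up :=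
  Function.LeftInverse.injective (slot hn i).down_up

lemma dotted_insert (S : State (Fin (2 * n))) :
    (S.insert (slot hn i)).dotted.card = S.dotted.card := by
  rw [← Finset.card_image_of_injective _ (slot_up_injective hn i)]
  congr 1
  ext q
  simp only [dotted, Finset.mem_filter, Finset.mem_univ, true_and, Finset.mem_image]
  constructor
  · intro h
    rcases (slot hn i).eq_or q with rfl | rfl | ⟨p, rfl⟩
    · rw [insert_dot_u] at h
      simp at h
    · rw [insert_dot_v] at h
      simp at h
    · exact ⟨p, by rwa [insert_dot_up] at h, rfl⟩
  · rintro ⟨p, hp, rfl⟩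
    rwa [insert_dot_up]

lemma planar_insert {S : State (Fin (2 * n))} : (S.insert (slot hn i)).Planar ↔ S.Planar := by
  constructor
  · rintro ⟨h1, h2, h3⟩
    refine ⟨(nonCrossing_insert hn i).1 h1, fun p hp => ?_, by rwa [dotted_insert] at h3⟩
    have := h2 ((slot hn i).up p) (by rwa [insert_dot_up])
    rw [insert_par_up] at this
    exact (outer_insert hn i p).1 this
  · rintro ⟨h1, h2, h3⟩
    refine ⟨(nonCrossing_insert hn i).2 h1, fun q hq => ?_, by rwa [dotted_insert]⟩
    rcases (slot hn i).eq_or q with rfl | rfl | ⟨p, rfl⟩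
    · rw [insert_dot_u] at hq
      simp at hq
    · rw [insert_dot_v] at hq
      simp at hq
    · rw [insert_par_up]
      exact (outer_insert hn i p).2 (h2 p (by rwa [insert_dot_up] at hq))

lemma dotted_flip (S : State (Fin (2 * n))) (z : Fin (2 * n)) (ht : S.tag = false) :
    (S.flip z).dotted.card + (if S.dot z = true then 2 else 0) =
      S.dotted.card + (if S.dot z = true then 0 else 2) := by
  have hz := S.par_ne z
  have hd := S.dot_par z
  have key : ∀ p, (S.flip z).dot p = (S.dot p ^^ decide (p = z ∨ p = S.par z)) := by
    intro p
    simp [flip, ht]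
  split_ifs with h
  · have : S.dotted = (S.flip z).dotted ∪ {z, S.par z} := by
      ext p
      simp only [dotted, Finset.mem_filter, Finset.mem_univ, true_and, Finset.mem_union,
        Finset.mem_insert, Finset.mem_singleton, key]
      grind
    rw [this, Finset.card_union_of_disjoint, Finset.card_pair hz.symm, add_zero]
    rw [Finset.disjoint_left]
    intro p hp
    simp only [dotted, Finset.mem_filter, Finset.mem_univ, true_and, key,
        Finset.mem_insert, Finset.mem_singleton] at *
    grind
  · have : (S.flip z).dotted = S.dotted ∪ {z, S.par z} := by
      ext p
      simp only [dotted, Finset.mem_filter, Finset.mem_univ, true_and, Finset.mem_union,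
        Finset.mem_insert, Finset.mem_singleton, key]
      grind
    rw [this, Finset.card_union_of_disjoint, Finset.card_pair hz.symm, add_zero]
    rw [Finset.disjoint_left]
    intro p hp
    simp only [dotted, Finset.mem_filter, Finset.mem_univ, true_and,
        Finset.mem_insert, Finset.mem_singleton] at *
    grind

lemma dotted_insertDot (S : State (Fin (2 * n))) (z : Fin (2 * n)) (ht : S.tag = false) :
    (S.insertDot (slot hn i) z).dotted.card = (S.flip z).dotted.card + 2 := by
  have h : (S.insertDot (slot hn i) z).dotted =
      (S.flip z).dotted.image (slot hn i).up ∪ {(slot hn i).u, (slot hn i).v} := by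
    ext q
    simp only [dotted, Finset.mem_filter, Finset.mem_univ, true_and, Finset.mem_image,
      Finset.mem_union, Finset.mem_insert, Finset.mem_singleton]
    rcases (slot hn i).eq_or q with rfl | rfl | ⟨p, rfl⟩
    · simp [insertDot_dot_u, ht]
    · simp [insertDot_dot_v, ht]
    · rw [insertDot_dot_up _ _ _ _ ht]
      simp only [(slot hn i).up_ne_u, (slot hn i).up_ne_v, or_self, or_false, up_eq_iff,
        exists_eq_right, flip, ht, Bool.not_false, Bool.true_and]
  rw [h, Finset.card_union_of_disjoint, Finset.card_image_of_injective _ (slot_up_injective hn i),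
    Finset.card_pair (slot hn i).u_ne]
  rw [Finset.disjoint_left]
  intro q hq hq'
  obtain ⟨p, -, rfl⟩ := Finset.mem_image.1 hq
  simp [(slot hn i).up_ne_u, (slot hn i).up_ne_v] at hq'

/-- One dot is added on the cap and one is toggled at `z`, so the number of dots changes by `0` or
`2`. -/
lemma even_insertDot (S : State (Fin (2 * n))) (z : Fin (2 * n)) (ht : S.tag = false) :
    Even ((S.insertDot (slot hn i) z).dotted.card / 2) ↔ Even (S.dotted.card / 2) := by
  have h1 := S.dotted_flip z ht
  rw [dotted_insertDot hn i S z ht]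
  rw [Nat.even_iff, Nat.even_iff]
  split_ifs at h1 <;> omega

/-- The arc at the left-most bottom point contains the last point of the boundary order, so nothing
encloses it. The same is true of a cap at position `1`, so both may carry dots freely. -/
lemma planar_insertDot {S : State (Fin (2 * n))} (ht : S.tag = false) :
    (S.insertDot (slot hn 1) ⟨2 * n - 1, by omega⟩).Planar ↔ S.Planar := by
  have hpar : (S.insertDot (slot hn 1) ⟨2 * n - 1, by omega⟩).par = (S.insert (slot hn 1)).par :=
    rfl
  have hv := slot_val hn 1
  have hu : ((slot hn 1).u : ℕ) = 2 * n := rfl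
  have hz : ∀ p : Fin (2 * n), p = ⟨2 * n - 1, by omega⟩ ∨ p = S.par ⟨2 * n - 1, by omega⟩ →
      ∀ r, ¬ (r < p ∧ r < S.par p ∧ p < S.par r ∧ S.par p < S.par r) := by
    rintro p hp r ⟨-, -, h3, h4⟩
    have := (S.par r).isLt
    rcases hp with hp | hp
    · rw [hp] at h3
      simp only [Fin.lt_def] at h3
      omega
    · rw [hp, S.par_par] at h4
      simp only [Fin.lt_def] at h4
      omega
  constructor
  · rintro ⟨h1, h2, h3⟩
    refine ⟨(nonCrossing_insert hn 1).1 h1, fun p hp => ?_, (even_insertDot hn 1 S _ ht).1 h3⟩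
    by_cases hpz : p = ⟨2 * n - 1, by omega⟩ ∨ p = S.par ⟨2 * n - 1, by omega⟩
    · exact hz p hpz
    · have := h2 ((slot hn 1).up p) (by
        rw [insertDot_dot_up _ _ _ _ ht, hp, decide_eq_false hpz]
        rfl)
      rw [hpar, insert_par_up] at this
      exact (outer_insert hn 1 p).1 this
  · rintro ⟨h1, h2, h3⟩
    refine ⟨(nonCrossing_insert hn 1).2 h1, fun q hq => ?_, (even_insertDot hn 1 S _ ht).2 h3⟩
    rw [hpar]
    rcases (slot hn 1).eq_or q with rfl | rfl | ⟨p, rfl⟩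
    · rintro r ⟨-, -, -, h⟩
      have := ((S.insert (slot hn 1)).par r).isLt
      rw [insert_par_u] at h
      simp only [Fin.lt_def] at h
      omega
    · rintro r ⟨-, -, h, -⟩
      have := ((S.insert (slot hn 1)).par r).isLt
      simp only [Fin.lt_def] at h
      omega
    · rw [insert_par_up]
      refine (outer_insert hn 1 p).2 ?_
      by_cases hpz : p = ⟨2 * n - 1, by omega⟩ ∨ p = S.par ⟨2 * n - 1, by omega⟩
      · exact hz p hpz
      · rw [insertDot_dot_up _ _ _ _ ht, decide_eq_false hpz] at hq
        exact h2 p (by simpa using hq)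

lemma par_eq_rev_of_insert {S : State (Fin (2 * n))}
    (h : (S.insert (slot hn i)).par = Fin.rev) : S.par = Fin.rev := by
  have h1 := congrFun h (slot hn i).u
  rw [insert_par_u] at h1
  have h1' := congrArg Fin.val h1
  rw [slot_val, Fin.val_rev] at h1'
  have hu : ((slot hn i).u : ℕ) = 2 * n - (i - 1) := rfl
  ext p
  have h2 := congrArg Fin.val (congrFun h ((slot hn i).up p))
  rw [insert_par_up, Fin.val_rev] at h2
  rw [Fin.val_rev]
  have hp := p.isLt
  have hp2 := (S.par p).isLt
  simp only [slot] at h2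
  split_ifs at h2 <;> omega

lemma insert_par_ne_rev {S : State (Fin (2 * n))} (h1 : 1 ≤ i) (hi : i ≤ n) :
    (S.insert (slot hn i)).par ≠ Fin.rev := by
  intro h
  have h1 := congrFun h (slot hn i).u
  rw [insert_par_u] at h1
  have h1' := congrArg Fin.val h1
  rw [slot_val, Fin.val_rev] at h1'
  have hu : ((slot hn i).u : ℕ) = 2 * n - (i - 1) := rfl
  omega

lemma Good.insert {S : State (Fin (2 * n))} (h : S.Good) : (S.insert (slot hn i)).Good :=
  ⟨(planar_insert hn i).2 h.toPlanar, fun ht h' => h.par_ne_rev ht (par_eq_rev_of_insert hn i h')⟩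

lemma Good.insertDot {S : State (Fin (2 * n))} (h : S.Good) (ht : S.tag = false) :
    (S.insertDot (slot hn 1) ⟨2 * n - 1, by omega⟩).Good := by
  refine ⟨(planar_insertDot hn ht).2 h.toPlanar, fun ht' => ?_⟩
  exact absurd (ht'.symm.trans ht) (by simp)

lemma planar_tagged_one (m : ℕ) : (one m).tagged.Planar := by
  refine ⟨?_, ?_, ?_⟩
  · rintro p r ⟨h1, h2, h3⟩
    simp only [tagged, one, Fin.rev_lt_rev] at *
    exact lt_asymm h1 h3
  · intro p hp
    simp [tagged] at hp
  · simp [dotted, tagged]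

/-- The tagged identity is not a diagram, but it becomes one after a genuine cap (`i ≤ n`) is
inserted. These are the states of the bare valleys. -/
lemma good_tagged_one (h1 : 1 ≤ i) (hi : i ≤ n) :
    ((one n).tagged.insert (slot hn i)).Good :=
  ⟨(planar_insert hn i).2 (planar_tagged_one n), fun _ => insert_par_ne_rev hn i h1 hi⟩

lemma good_one (m : ℕ) : (one m).Good := by
  refine ⟨⟨(planar_tagged_one m).noncrossing, ?_, ?_⟩, ?_⟩
  · intro p hp
    simp [one] at hp
  · simp [dotted, one]
  · simp [one]

end Slot

end State


/-! ### Planar diagrams give a basis -/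

/-- Vectors sent to distinct basis vectors allow a linear inverse on their span; this is how
injectivity of `expand` will follow from a spanning family. -/
lemma exists_leftInverse_on_span {F A ι κ : Type*} [Field F] [AddCommGroup A] [Module F A]
    (f : A →ₗ[F] (κ →₀ F)) (b : ι → A) (g : ι → κ) (s : Set ι) (hg : Set.InjOn g s)
    (h : ∀ i ∈ s, f (b i) = Finsupp.single (g i) 1) :
    ∃ k : (κ →₀ F) →ₗ[F] A, ∀ x ∈ Submodule.span F (b '' s), k (f x) = x := by
  classical
  refine ⟨Finsupp.linearCombination F fun j => if hj : ∃ i ∈ s, g i = j then b hj.choose else 0,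
    fun x hx => ?_⟩
  induction hx using Submodule.span_induction with
  | mem x hx =>
    obtain ⟨i, hi, rfl⟩ := hx
    have hj : ∃ i' ∈ s, g i' = g i := ⟨i, hi, rfl⟩
    rw [h i hi, Finsupp.linearCombination_single, one_smul, dif_pos hj]
    congr 1
    exact hg hj.choose_spec.1 hi hj.choose_spec.2
  | zero => simp
  | add x y _ _ hx hy => rw [map_add, map_add, hx, hy]
  | smul c x _ hx => rw [map_smul, map_smul, hx]

/-- Only the left-most of the vertical strands is outer-most, so at most one dot is possible, and
parity excludes it. -/
lemma State.good_eq_one {m : ℕ} {S : State (Fin (2 * m))} (h : S.Good) (hr : S.par = Fin.rev) :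
    S = State.one m := by
  have ht : S.tag = false := by
    by_contra ht
    exact h.par_ne_rev (by simpa using ht) hr
  ext p
  · exact ht
  · rw [hr]
    rfl
  · by_contra hp
    have hp' : S.dot p = true := by simpa [State.one] using hp
    have hout : ∀ q, S.dot q = true → (q : ℕ) = 0 ∨ (q : ℕ) = 2 * m - 1 := by
      intro q hq
      have := h.outer q hq ⟨0, by have := q.isLt; omega⟩
      rw [hr] at this
      have hq := q.isLt
      simp only [Fin.lt_def, Fin.val_rev] at this
      omega
    have hd : S.dotted = {p, S.par p} := by
      ext q
      simp only [State.dotted, Finset.mem_filter, Finset.mem_univ, true_and, Finset.mem_insert,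
        Finset.mem_singleton]
      constructor
      · intro hq
        have h1 := hout q hq
        have h2 := hout p hp'
        have := p.isLt
        rw [hr]
        simp only [Fin.ext_iff, Fin.val_rev]
        omega
      · rintro (rfl | rfl)
        · exact hp'
        · rw [S.dot_par, hp']
    have := h.even
    rw [hd, Finset.card_pair (S.par_ne p).symm] at this
    simp at this

/-- A family of words indexed by states that is dual to the planar states and spans. -/
def HasBasis (m : ℕ) : Prop :=
  ∃ b : State (Fin (2 * m)) → TLD m, (∀ S, S.Good → (∃ w, b S = word w) ∧
    expand m (b S) = Finsupp.single S 1) ∧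
    Submodule.span K (b '' {S | S.Good}) = ⊤

/-- The analogue of `HasBasis` for the subalgebra on fewer strands. -/
structure LowerBasis {n : ℕ} (hn : 1 ≤ n) (b : State (Fin (2 * n)) → TLD (n + 1)) : Prop where
  isWord : ∀ S, S.Good → ∃ w, b S = word w
  mem : ∀ S, S.Good → b S ∈ TLRel.sub n (gen (n + 1))
  expand_eq : ∀ S, S.Good → expand (n + 1) (b S) = insL hn (n + 1) (Finsupp.single S 1)
  span : ∀ y ∈ TLRel.sub n (gen (n + 1)), y ∈ Submodule.span K (b '' {S | S.Good})

lemma incl_gen {n : ℕ} (s : Fin n) : incl (Nat.le_succ n) (E s) = gen (n + 1) s := by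
  rw [incl_E, ← gen_val]
  rfl

lemma incl_word {n : ℕ} (w : List (Fin n)) :
    incl (Nat.le_succ n) (word w) = word (w.map (Fin.castLE (Nat.le_succ n))) := by
  simp only [word, map_list_prod, List.map_map]
  congr 2
  funext s
  exact incl_E _ s

lemma incl_mem_sub {n : ℕ} (h2 : 2 ≤ n) (y : TLD n) :
    incl (Nat.le_succ n) y ∈ TLRel.sub n (gen (n + 1)) := by
  have hy : y ∈ Submodule.span K (Set.range (word (m := n))) := span_word ▸ Submodule.mem_top
  induction hy using Submodule.span_induction with
  | mem x hx =>
    obtain ⟨w, rfl⟩ := hx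
    rw [word, map_list_prod]
    refine Subalgebra.list_prod_mem _ fun x hx => ?_
    simp only [List.map_map, List.mem_map, Function.comp_apply] at hx
    obtain ⟨s, -, rfl⟩ := hx
    rw [incl_gen]
    exact TLRel.mem_sub s.isLt h2
  | zero => rw [map_zero]; exact zero_mem _
  | add x y _ _ hx hy => rw [map_add]; exact add_mem hx hy
  | smul c x _ hx => rw [map_smul]; exact Subalgebra.smul_mem _ hx c

lemma sub_le_range_incl {n : ℕ} :
    TLRel.sub n (gen (n + 1)) ≤ (incl (Nat.le_succ n)).range := by
  refine Algebra.adjoin_le ?_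
  rintro _ ⟨t, ⟨ht, -⟩, rfl⟩
  exact ⟨E ⟨t, ht⟩, incl_gen _⟩

lemma HasBasis.lowerBasis {n : ℕ} (h2 : 2 ≤ n) (h : HasBasis n) :
    ∃ b, LowerBasis (by omega : 1 ≤ n) b := by
  obtain ⟨b, h1, h3⟩ := h
  refine ⟨fun S => incl (Nat.le_succ n) (b S), fun S hS => ?_, fun S _ => incl_mem_sub h2 _,
    fun S hS => ?_, fun y hy => ?_⟩
  · obtain ⟨w, hw⟩ := (h1 S hS).1
    exact ⟨_, by rw [hw, incl_word]⟩
  · rw [expand_incl (by omega) h2, (h1 S hS).2]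
  · obtain ⟨x, rfl⟩ := sub_le_range_incl hy
    have hx : x ∈ Submodule.span K (b '' {S | S.Good}) := h3 ▸ Submodule.mem_top
    have := Submodule.mem_map_of_mem (f := (incl (Nat.le_succ n)).toLinearMap) hx
    rw [Submodule.map_span, Set.image_image] at this
    exact this

lemma lowerBasis_one : LowerBasis (le_refl 1) fun _ => 1 := by
  have hS : ∀ S : State (Fin (2 * 1)), S.Good → S = State.one 1 := by
    intro S hS
    refine State.good_eq_one hS (funext fun p => ?_)
    have h := S.par_ne p
    ext
    have := (S.par p).isLt
    have := p.isLt
    rw [Fin.val_rev]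
    simp only [ne_eq, Fin.ext_iff] at h
    omega
  refine ⟨fun S _ => ⟨[], rfl⟩, fun S _ => one_mem _, fun S h => ?_, fun y hy => ?_⟩
  · rw [hS S h, expand_one_succ (le_refl 1), expand_one]
  · have : TLRel.sub 1 (gen (1 + 1)) = ⊥ := by
      rw [TLRel.sub, show {t : ℕ | t < 1 ∧ 2 ≤ 1} = ∅ by ext; simp, Set.image_empty,
        Algebra.adjoin_empty]
    rw [this] at hy
    obtain ⟨c, rfl⟩ := Algebra.mem_bot.1 hy
    rw [Algebra.algebraMap_eq_smul_one]
    exact Submodule.smul_mem _ _ (Submodule.subset_span ⟨State.one 1, State.good_one 1, rfl⟩)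

section Words

lemma isWord_gen {m i : ℕ} (h : i < m) : ∃ w : List (Fin m), gen m i = word w :=
  ⟨[⟨i, h⟩], by rw [gen_of_lt h]; simp [word]⟩

lemma isWord_mul {m : ℕ} {x y : TLD m} (hx : ∃ w, x = word w) (hy : ∃ w, y = word w) :
    ∃ w, x * y = word w := by
  obtain ⟨v, rfl⟩ := hx
  obtain ⟨w, rfl⟩ := hy
  exact ⟨v ++ w, (word_append v w).symm⟩

lemma isWord_desc {n i : ℕ} (hi : i ≤ n + 1) : ∃ w, desc (gen (n + 1)) n i = word w := by
  induction hi using Nat.decreasingInduction with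
  | self => exact ⟨[], desc_top _ _⟩
  | of_succ i hi ih =>
    rw [desc_eq _ n (by omega)]
    exact isWord_mul ih (isWord_gen hi)

lemma isWord_valley {n i : ℕ} (h1 : 1 ≤ i) (hi : i ≤ n) :
    ∃ w, valley (gen (n + 1)) n i = word w := by
  induction i, h1 using Nat.le_induction with
  | base => exact isWord_mul (isWord_desc (by omega)) (isWord_gen (by omega))
  | succ i h1 ih =>
    rw [valley_succ _ n h1]
    exact isWord_mul (ih (by omega)) (isWord_gen (by omega))

lemma isWord_descZero {n : ℕ} (hn : 1 ≤ n) : ∃ w, descZero (gen (n + 1)) n = word w :=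
  isWord_mul (isWord_desc (by omega)) (isWord_gen (by omega))

end Words

namespace State

variable {n : ℕ} (hn : 1 ≤ n)

/-- There is an undotted cap at position `t`. -/
def CapAt (S : State (Fin (2 * n))) (t : Fin n) : Prop :=
  S.par (ptB t) = ptA t ∧ S.dot (ptB t) = false

/-- There is an undotted cap (or right-most vertical strand) at position `i`. -/
def PosAt (S : State (Fin (2 * (n + 1)))) (i : ℕ) : Prop :=
  1 ≤ i ∧ i ≤ n + 1 ∧ S.par (slot hn i).u = (slot hn i).v ∧ S.dot (slot hn i).u = false

lemma slot_u_eq_up {i j : ℕ} (h1 : 1 ≤ i) (hij : i + 2 ≤ j) (hj : j - 2 < n) :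
    (slot hn j).u = (slot hn i).up (ptB ⟨j - 2, hj⟩) := by
  ext
  simp only [slot, ptB]
  split_ifs <;> omega

lemma slot_v_eq_up {i j : ℕ} (h1 : 1 ≤ i) (hij : i + 2 ≤ j) (hj : j - 2 < n) :
    (slot hn j).v = (slot hn i).up (ptA ⟨j - 2, hj⟩) := by
  ext
  simp only [slot, ptA]
  split_ifs <;> omega

lemma slot_v_succ {i : ℕ} (h1 : 1 ≤ i) (hi : i ≤ n) : (slot hn (i + 1)).v = (slot hn i).u :=
  (shift_slot hn h1 hi).v_eq

open Classical in
/-- The largest position of an undotted cap (or `0`). -/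
def maxPos (S : State (Fin (2 * (n + 1)))) : ℕ := Nat.findGreatest (S.PosAt hn) (n + 1)

lemma maxPos_spec {S : State (Fin (2 * (n + 1)))} {i : ℕ} (h : S.PosAt hn i) :
    S.PosAt hn (S.maxPos hn) := by
  classical
  have := Nat.findGreatest_spec h.2.1 h
  unfold maxPos
  convert this

lemma maxPos_eq {S : State (Fin (2 * (n + 1)))} {i : ℕ} (h : S.PosAt hn i)
    (hmax : ∀ j, i < j → ¬ S.PosAt hn j) : S.maxPos hn = i := by
  classical
  refine le_antisymm ?_ ?_
  · by_contra hlt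
    exact hmax _ (by omega) (maxPos_spec hn h)
  · have := Nat.le_findGreatest h.2.1 h
    unfold maxPos
    convert this

lemma posAt_insert {S : State (Fin (2 * n))} {i : ℕ} (h1 : 1 ≤ i) (hi : i ≤ n + 1) :
    (S.insert (slot hn i)).PosAt hn i :=
  ⟨h1, hi, insert_par_u _ _, insert_dot_u _ _⟩

/-- A cap of `S` at position `t ≥ i` moves to `t + 2`, and position `i + 1` shares a point with the
inserted cap. So `i` is largest as soon as `S` has no undotted cap from `i` on. -/
lemma maxPos_insert {S : State (Fin (2 * n))} {i : ℕ} (h1 : 1 ≤ i) (hi : i ≤ n + 1)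
    (hS : ∀ t : Fin n, i ≤ t → ¬ S.CapAt t) : (S.insert (slot hn i)).maxPos hn = i := by
  refine maxPos_eq hn (posAt_insert hn h1 hi) fun j hij hj => ?_
  obtain ⟨-, hjn, hp, hd⟩ := hj
  obtain rfl | h2 : j = i + 1 ∨ i + 2 ≤ j := by omega
  · rw [slot_v_succ hn h1 (by omega), ← (insert_par_v (slot hn i) S)] at hp
    have := congrArg (S.insert (slot hn i)).par hp
    rw [par_par, par_par] at this
    have h3 := congrArg Fin.val this
    simp only [slot] at h3
    omega
  · refine hS ⟨j - 2, by omega⟩ (by simp only; omega) ⟨?_, ?_⟩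
    · rw [slot_u_eq_up hn h1 h2 (by omega), slot_v_eq_up hn h1 h2 (by omega), insert_par_up,
        up_eq_iff] at hp
      exact hp
    · rwa [slot_u_eq_up hn h1 h2 (by omega), insert_dot_up] at hd

/-- The cap of `S` at position `1`, if there is one, moves to position `3` and has its dot toggled.
It must therefore be undotted in `S` in order to be dotted afterwards. -/
lemma not_posAt_insertDot {S : State (Fin (2 * n))} (ht : S.tag = false)
    (hS : ∀ t : Fin n, 2 ≤ (t : ℕ) → ¬ S.CapAt t)
    (hS1 : ∀ t : Fin n, (t : ℕ) = 1 → S.par (ptB t) = ptA t → S.dot (ptB t) = false) (j : ℕ) :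
    ¬ (S.insertDot (slot hn 1) ⟨2 * n - 1, by omega⟩).PosAt hn j := by
  rintro ⟨h1, hj, hp, hd⟩
  obtain rfl | rfl | h2 : j = 1 ∨ j = 2 ∨ 1 + 2 ≤ j := by omega
  · rw [insertDot_dot_u, ht] at hd
    simp at hd
  · rw [slot_v_succ hn le_rfl hn, ← (insertDot_par_v (slot hn 1) ⟨2 * n - 1, by omega⟩ S)] at hp
    have := congrArg (S.insertDot (slot hn 1) ⟨2 * n - 1, by omega⟩).par hp
    rw [par_par, par_par] at this
    have h3 := congrArg Fin.val this
    simp only [slot] at h3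
    omega
  · rw [slot_u_eq_up hn le_rfl h2 (by omega), slot_v_eq_up hn le_rfl h2 (by omega),
      insertDot_par_up, up_eq_iff] at hp
    rw [slot_u_eq_up hn le_rfl h2 (by omega), insertDot_dot_up _ _ _ _ ht] at hd
    by_cases h3 : j = 3
    · subst h3
      rw [hS1 _ rfl hp, decide_eq_true] at hd
      · simp at hd
      · right
        rw [← S.par_par (ptB _), hp]
        congr 1
    · refine hS ⟨j - 2, by omega⟩ (by simp only; omega) ⟨hp, ?_⟩
      rw [decide_eq_false] at hd
      · simpa using hd
      · rintro (h | h)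
        · have := congrArg Fin.val h
          simp only [ptB] at this
          omega
        · rw [h, par_par] at hp
          have := congrArg Fin.val hp
          simp only [ptA] at this
          omega

end State


/-! ### Normal form words: from `n` to `n + 1` strands -/

section ExtendBasis

variable {n : ℕ} (hn : 1 ≤ n)

open Classical in
/-- The word attached to a state on `n + 1` strands, built from words on `n` strands. -/
def extendBasis (b : State (Fin (2 * n)) → TLD (n + 1)) (S : State (Fin (2 * (n + 1)))) :
    TLD (n + 1) :=
  -- Removing the right-most undotted cap makes the normal form unique.
  if h : S.PosAt hn (S.maxPos hn) then
    -- What remains is the tagged identity, which has no word on `n` strands; the dotted loop has to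
    -- be made by the coset word.
    if S.tag = true ∧ (S.remove (slot hn (S.maxPos hn)) h.2.2.1).par = Fin.rev then
      valley (gen (n + 1)) n (S.maxPos hn)
    else b (S.remove (slot hn (S.maxPos hn)) h.2.2.1) * desc (gen (n + 1)) n (S.maxPos hn)
  else if h : S.par (slot hn 1).u = (slot hn 1).v then
    b ((S.remove (slot hn 1) h).flip ⟨2 * n - 1, by omega⟩) * descZero (gen (n + 1)) n
  else 0

variable {b : State (Fin (2 * n)) → TLD (n + 1)}

open Classical in
lemma extendBasis_of_posAt {S : State (Fin (2 * (n + 1)))} {i : ℕ} (h : S.PosAt hn i)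
    (hi : S.maxPos hn = i) : extendBasis hn b S =
      if S.tag = true ∧ (S.remove (slot hn i) h.2.2.1).par = Fin.rev then
        valley (gen (n + 1)) n i
      else b (S.remove (slot hn i) h.2.2.1) * desc (gen (n + 1)) n i := by
  subst hi
  rw [extendBasis, dif_pos h]

open Classical in
lemma extendBasis_insert {S : State (Fin (2 * n))} {i : ℕ} (h1 : 1 ≤ i) (hi : i ≤ n + 1)
    (hS : ∀ t : Fin n, i ≤ t → ¬ S.CapAt t) : extendBasis hn b (S.insert (slot hn i)) =
      if S.tag = true ∧ S.par = Fin.rev then valley (gen (n + 1)) n i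
      else b S * desc (gen (n + 1)) n i := by
  rw [extendBasis_of_posAt hn (State.posAt_insert hn h1 hi) (State.maxPos_insert hn h1 hi hS),
    State.remove_insert]
  rfl

lemma extendBasis_insertDot {S : State (Fin (2 * n))} (ht : S.tag = false)
    (hS : ∀ t : Fin n, 2 ≤ (t : ℕ) → ¬ S.CapAt t)
    (hS1 : ∀ t : Fin n, (t : ℕ) = 1 → S.par (ptB t) = ptA t → S.dot (ptB t) = false) :
    extendBasis hn b (S.insertDot (slot hn 1) ⟨2 * n - 1, by omega⟩) =
      b S * descZero (gen (n + 1)) n := by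
  rw [extendBasis, dif_neg (State.not_posAt_insertDot hn ht hS hS1 _),
    dif_pos (State.insertDot_par_u _ _ _), State.remove_insertDot, State.flip_flip]

namespace State

lemma posAt_of_adjacent {S : State (Fin (2 * (n + 1)))} {r : Fin (2 * (n + 1))} (hr : n ≤ (r : ℕ))
    (h : (S.par r : ℕ) = r + 1) (hd : S.dot r = false) : S.PosAt hn (2 * n + 1 - r) := by
  have hlt := (S.par r).isLt
  have hu : (slot hn (2 * n + 1 - r)).u = r := by
    ext
    simp only [slot]
    omega
  refine ⟨by omega, by omega, ?_, by rwa [hu]⟩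
  ext
  rw [slot_val, hu, h]

lemma exists_adjacent_succ {S : State (Fin (2 * (n + 1)))} (h : NonCrossing S.par) :
    ∃ r : Fin (2 * (n + 1)), n ≤ (r : ℕ) ∧ (S.par r : ℕ) = r + 1 := by
  by_cases hr : S.par = Fin.rev
  · exact ⟨⟨n, by omega⟩, le_rfl, by rw [hr, Fin.val_rev]; simp only; omega⟩
  · obtain ⟨r, hr1, hr2⟩ := exists_adjacent_of_ne_rev S.par_par S.par_ne h hr
    exact ⟨r, by omega, hr2⟩

lemma Good.eq_tagged_one {S : State (Fin (2 * n))} (ht : S.tag = true) (hr : S.par = Fin.rev) :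
    S = (one n).tagged := by
  ext p
  · exact ht
  · rw [hr]
    rfl
  · rw [S.tag_dot ht]
    rfl

/-- Without an undotted cap, there is a dotted cap at position `1`. -/
lemma Good.dotted_first {S : State (Fin (2 * (n + 1)))} (hS : S.Good)
    (h : ∀ i, ¬ S.PosAt hn i) :
    S.tag = false ∧ S.par (slot hn 1).u = (slot hn 1).v ∧ S.dot (slot hn 1).u = true := by
  have hd : ∀ r : Fin (2 * (n + 1)), n ≤ (r : ℕ) → (S.par r : ℕ) = r + 1 → S.dot r = true := by
    intro r h1 h2
    by_contra h3
    exact h _ (posAt_of_adjacent hn h1 h2 (by simpa using h3))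
  obtain ⟨r, hr1, hr2⟩ := exists_adjacent_succ hS.noncrossing
  have ht : S.tag = false := by
    by_contra ht
    have := hd r hr1 hr2
    rw [S.tag_dot (by simpa using ht)] at this
    simp at this
  have hp : S.par (slot hn 1).u = (slot hn 1).v := by
    refine last_adjacent S.par_par S.par_ne hS.noncrossing (L := n) (r₀ := r) ?_ ?_ hr1 hr2 ?_
    · simp only [slot]
      omega
    · simp only [slot]
      omega
    · rintro p hp1 hp2 s ⟨h1, h2⟩
      have := hS.outer p (hd p hp1 hp2) s
      simp only [Fin.lt_def] at this h1 h2
      omega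
  refine ⟨ht, hp, hd _ ?_ ?_⟩
  · simp only [slot]
    omega
  · rw [hp, slot_val]

/-- A good state other than the identity has a cap which the corresponding generator closes. -/
lemma Good.exists_loop {S : State (Fin (2 * n))} (hS : S.Good) (h : S.par ≠ Fin.rev) :
    ∃ t : Fin n, 2 ≤ n ∧
      S.par (ptA t) = ptB t ∧ (S.tag = true ∨ S.dot (ptA t) = decide ((t : ℕ) = 0)) := by
  obtain ⟨r₀, hr1, hr2⟩ := exists_adjacent_of_ne_rev S.par_par S.par_ne hS.noncrossing h
  have hlt := (S.par r₀).isLt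
  by_cases hd : ∃ r : Fin (2 * n), n ≤ (r : ℕ) ∧ (S.par r : ℕ) = r + 1 ∧ S.dot r = false
  · obtain ⟨r, h1, h2, h3⟩ := hd
    have hlt := (S.par r).isLt
    have ha : ptA ⟨2 * n - 1 - r, by omega⟩ = S.par r := by
      ext
      simp only [ptA]
      omega
    have hb : ptB ⟨2 * n - 1 - r, by omega⟩ = r := by
      ext
      simp only [ptB]
      omega
    refine ⟨⟨2 * n - 1 - r, by omega⟩, by omega, ?_, Or.inr ?_⟩
    · rw [ha, hb, S.par_par]
    · rw [ha, S.dot_par, h3, eq_comm, decide_eq_false_iff_not]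
      simp only
      omega
  · push Not at hd
    have hd' : ∀ r : Fin (2 * n), n ≤ (r : ℕ) → (S.par r : ℕ) = r + 1 → S.dot r = true :=
      fun r h1 h2 => by simpa using hd r h1 h2
    have hp : S.par (ptB ⟨0, by omega⟩) = ptA ⟨0, by omega⟩ := by
      refine last_adjacent S.par_par S.par_ne hS.noncrossing (L := n) (r₀ := r₀) ?_ ?_ hr1 hr2 ?_
      · simp only [ptB]
        omega
      · simp only [ptA]
        omega
      · rintro p hp1 hp2 s ⟨h1, h2⟩
        have := hS.outer p (hd' p hp1 hp2) s
        simp only [Fin.lt_def] at this h1 h2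
        omega
    refine ⟨⟨0, by omega⟩, by omega, by rw [← hp, S.par_par], Or.inr ?_⟩
    rw [← hp, S.dot_par, hd']
    · simp
    · simp only [ptB]
      omega
    · rw [hp]
      simp only [ptA, ptB]
      omega

end State

lemma LowerBasis.ext (hb : LowerBasis hn b) {x y : TLD (n + 1)}
    (hx : x ∈ TLRel.sub n (gen (n + 1))) (hy : y ∈ TLRel.sub n (gen (n + 1)))
    (h : expand (n + 1) x = expand (n + 1) y) : x = y := by
  obtain ⟨k, hk⟩ := exists_leftInverse_on_span (expand (n + 1)) b
    (State.insert (slot hn (n + 1))) {S | S.Good} (fun S _ S' _ h => by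
      rw [← S.remove_insert (slot hn (n + 1)) (State.insert_par_u _ _),
        ← S'.remove_insert (slot hn (n + 1)) (State.insert_par_u _ _)]
      congr 1)
    (fun S hS => by rw [hb.expand_eq S hS, insL_single])
  rw [← hk x (hb.span x hx), h, hk y (hb.span y hy)]

/-- Since `e t` only closes a loop on `S`, a factor `e t` can be split off from the right end of `b
S`. In the spanning argument it is then absorbed by the coset word that follows. -/
lemma LowerBasis.mul_gen_of_loop (hb : LowerBasis hn b) {S : State (Fin (2 * n))} (hS : S.Good)
    {t : Fin n} (h2 : 2 ≤ n) (hp : S.par (ptA t) = ptB t)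
    (hd : S.tag = true ∨ S.dot (ptA t) = decide ((t : ℕ) = 0)) :
    ∃ c : K, b S = c • (b S * gen (n + 1) t) := by
  have key : b S * gen (n + 1) t = (-qInt 2) • b S := by
    refine hb.ext hn (mul_mem (hb.mem S hS) (TLRel.mem_sub t.isLt h2))
      (Subalgebra.smul_mem _ (hb.mem S hS) _) ?_
    have : gen (n + 1) (t : ℕ) = E (Fin.castLE (Nat.le_succ n) t) := by
      rw [← gen_val]
      rfl
    rw [this, expand_mul_E, hb.expand_eq S hS, act_castLE_insL hn h2, act_single, map_smul,
      hb.expand_eq S hS, ← map_smul, Finsupp.smul_single, smul_eq_mul, one_mul, mul_one]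
    congr 2
    · exact State.join_of_loop _ _ _ _ _ ⟨hp, hd⟩
    · exact if_pos ⟨hp, hd⟩
  have h0 : (-qInt 2 : K) ≠ 0 := neg_ne_zero.2 (by
    exact_mod_cast qInt_natCast_ne_zero (k := 2) (by omega))
  exact ⟨(-qInt 2)⁻¹, by rw [key, smul_smul, inv_mul_cancel₀ h0, one_smul]⟩

lemma extendBasis_good (hb : LowerBasis hn b) {S : State (Fin (2 * (n + 1)))} (hS : S.Good) :
    (∃ w, extendBasis hn b S = word w) ∧
      expand (n + 1) (extendBasis hn b S) = Finsupp.single S 1 := by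
  classical
  by_cases h : ∃ i, S.PosAt hn i
  · obtain ⟨i, hi⟩ := h
    have hi := State.maxPos_spec hn hi
    rw [extendBasis_of_posAt hn hi rfl]
    set i := S.maxPos hn
    have hSi := S.insert_remove (slot hn i) hi.2.2.1 hi.2.2.2
    set S' := S.remove (slot hn i) hi.2.2.1
    have htag : S'.tag = S.tag := rfl
    have hpl : S'.Planar := by
      rw [← State.planar_insert hn i, hSi]
      exact hS.toPlanar
    split_ifs with ht
    · have hS' := State.Good.eq_tagged_one (htag.trans ht.1) ht.2
      have hin : i ≤ n := by
        by_contra hin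
        have hin : i = n + 1 := le_antisymm hi.2.1 (by omega)
        refine hS.par_ne_rev ht.1 ?_
        rw [← hSi, hS', State.insert_tagged, hin, State.insert_one]
        rfl
      refine ⟨isWord_valley hi.1 hin, ?_⟩
      rw [← one_mul (valley _ _ _), expand_mul_valley hn (expand_one_succ hn) hi.1 hin, expand_one,
        insTagL_single, ← hSi, hS']
      simp [State.one]
    · have hg : S'.Good := ⟨hpl, fun h1 h2 => ht ⟨h1, h2⟩⟩
      refine ⟨isWord_mul (hb.isWord _ hg) (isWord_desc hi.2.1), ?_⟩
      rw [expand_mul_desc hn (hb.expand_eq _ hg) hi.1 hi.2.1, insL_single, hSi]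
  · push Not at h
    obtain ⟨ht, hp, hd⟩ := hS.dotted_first hn h
    have hSi := S.insertDot_remove (slot hn 1) ⟨2 * n - 1, by omega⟩ hp hd
    rw [extendBasis, dif_neg (h _), dif_pos hp]
    set S' := (S.remove (slot hn 1) hp).flip ⟨2 * n - 1, by omega⟩
    have ht' : S'.tag = false := ht
    have hg : S'.Good := by
      refine ⟨?_, fun h => by simp [ht'] at h⟩
      rw [← State.planar_insertDot hn ht', hSi]
      exact hS.toPlanar
    refine ⟨isWord_mul (hb.isWord _ hg) (isWord_descZero hn), ?_⟩
    rw [expand_mul_descZero hn (hb.expand_eq _ hg), insDotL_single, hSi]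

/-- If the coefficient has an undotted cap at some `t ≥ i`, splitting off `e t` turns `desc i` into
`desc (t + 2)`, a shorter descending word. Otherwise the product is already in normal form. -/
lemma LowerBasis.desc_mem_span (hb : LowerBasis hn b) {i : ℕ} (h1 : 1 ≤ i) (hi : i ≤ n + 1)
    {y : TLD (n + 1)} (hy : y ∈ TLRel.sub n (gen (n + 1))) :
    y * desc (gen (n + 1)) n i ∈ Submodule.span K (extendBasis hn b '' {S | S.Good}) := by
  induction h : n + 1 - i using Nat.strong_induction_on generalizing i y with
  | _ k ih =>
    have hy' := hb.span y hy
    clear hy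
    induction hy' using Submodule.span_induction with
    | mem y hy' =>
      obtain ⟨S, hS, rfl⟩ := hy'
      by_cases hcap : ∃ t : Fin n, i ≤ t ∧ S.CapAt t
      · obtain ⟨t, hit, hp, hd⟩ := hcap
        have hp' : S.par (ptA t) = ptB t := by rw [← hp, S.par_par]
        obtain ⟨c, hc⟩ := hb.mul_gen_of_loop hn hS (t := t) (by omega) hp' (Or.inr (by
          rw [← hp, S.dot_par, hd, eq_comm, decide_eq_false_iff_not]
          omega))
        obtain ⟨y', hy', he⟩ := (tlRel_gen n).gen_mul_desc h1 hit t.isLt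
        rw [hc, smul_mul_assoc, mul_assoc, he, ← mul_assoc]
        exact Submodule.smul_mem _ _ (ih _ (by omega) (by omega) (by omega)
          (mul_mem (hb.mem S hS) hy') rfl)
      · push Not at hcap
        refine Submodule.subset_span ⟨S.insert (slot hn i), State.Good.insert hn i hS, ?_⟩
        rw [extendBasis_insert hn h1 hi hcap, if_neg fun h' => hS.par_ne_rev h'.1 h'.2]
    | zero => rw [zero_mul]; exact zero_mem _
    | add x y hx hy ihx ihy => rw [add_mul]; exact add_mem ihx ihy
    | smul c x hx ihx => rw [smul_mul_assoc]; exact Submodule.smul_mem _ _ ihx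

lemma LowerBasis.inDesc_mem_span (hb : LowerBasis hn b) {z : TLD (n + 1)}
    (hz : TLRel.InDesc n (gen (n + 1)) z) :
    z ∈ Submodule.span K (extendBasis hn b '' {S | S.Good}) := by
  obtain ⟨y, hy, k, h1, hk, rfl⟩ := hz
  exact hb.desc_mem_span hn h1 hk hy

/-- A coefficient other than the identity ends in some `e t`, which collapses the valley to
descending words. -/
lemma LowerBasis.valley_mem_span (hb : LowerBasis hn b) {i : ℕ} (h1 : 1 ≤ i) (hi : i ≤ n)
    {y : TLD (n + 1)} (hy : y ∈ TLRel.sub n (gen (n + 1))) :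
    y * valley (gen (n + 1)) n i ∈ Submodule.span K (extendBasis hn b '' {S | S.Good}) := by
  have hy' := hb.span y hy
  clear hy
  induction hy' using Submodule.span_induction with
  | mem y hy' =>
    obtain ⟨S, hS, rfl⟩ := hy'
    by_cases hr : S.par = Fin.rev
    · have hS1 := State.good_eq_one hS hr
      have hb1 : b S = 1 := hb.ext hn (hb.mem S hS) (one_mem _) (by
        rw [hb.expand_eq S hS, expand_one_succ hn, expand_one, hS1])
      refine Submodule.subset_span ⟨(State.one n).tagged.insert (slot hn i),
        State.good_tagged_one hn i h1 hi, ?_⟩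
      rw [extendBasis_insert hn h1 (by omega), if_pos ⟨rfl, rfl⟩, hb1, one_mul]
      rintro t hit ⟨hp, -⟩
      have := congrArg Fin.val hp
      have h2 : (((State.one n).tagged.par (ptB t) : Fin (2 * n)) : ℕ) = 2 * n - (ptB t + 1) :=
        Fin.val_rev _
      rw [h2] at this
      simp only [ptA, ptB] at this
      omega
    · obtain ⟨t, h2, hp, hd⟩ := hS.exists_loop hr
      obtain ⟨c, hc⟩ := hb.mul_gen_of_loop hn hS h2 hp hd
      rw [hc, smul_mul_assoc, mul_assoc]
      exact Submodule.smul_mem _ _ (hb.inDesc_mem_span hn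
        (((tlRel_gen n).gen_mul_valley h1 hi t.isLt h2).mul_left (hb.mem S hS)))
  | zero => rw [zero_mul]; exact zero_mem _
  | add x y hx hy ihx ihy => rw [add_mul]; exact add_mem ihx ihy
  | smul c x hx ihx => rw [smul_mul_assoc]; exact Submodule.smul_mem _ _ ihx

/-- An undotted cap at `t ≥ 2`, or a cap at position `1` that is dotted or tagged, lets a generator
be split off and leads to descending words. In all other cases the product is in normal form. -/
lemma LowerBasis.descZero_mem_span (hb : LowerBasis hn b) {y : TLD (n + 1)}
    (hy : y ∈ TLRel.sub n (gen (n + 1))) :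
    y * descZero (gen (n + 1)) n ∈ Submodule.span K (extendBasis hn b '' {S | S.Good}) := by
  have hy' := hb.span y hy
  clear hy
  induction hy' using Submodule.span_induction with
  | mem y hy' =>
    obtain ⟨S, hS, rfl⟩ := hy'
    by_cases hcap : ∃ t : Fin n, 2 ≤ (t : ℕ) ∧ S.CapAt t
    · obtain ⟨t, hit, hp, hd⟩ := hcap
      have hp' : S.par (ptA t) = ptB t := by rw [← hp, S.par_par]
      obtain ⟨c, hc⟩ := hb.mul_gen_of_loop hn hS (t := t) (by omega) hp' (Or.inr (by
        rw [← hp, S.dot_par, hd, eq_comm, decide_eq_false_iff_not]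
        omega))
      obtain ⟨y', hy', he⟩ := (tlRel_gen n).gen_mul_descZero hit t.isLt
      rw [hc, smul_mul_assoc, mul_assoc, he, ← mul_assoc]
      exact Submodule.smul_mem _ _ (hb.desc_mem_span hn (by omega) (by omega)
        (mul_mem (hb.mem S hS) hy'))
    · push Not at hcap
      by_cases hd1 : ∃ t : Fin n, (t : ℕ) = 1 ∧ S.par (ptB t) = ptA t ∧
          (S.tag = true ∨ S.dot (ptB t) = true)
      · obtain ⟨t, ht, hp, hd⟩ := hd1
        have h2 : 2 ≤ n := by omega
        have ha : ptA t = ptA ⟨0, by omega⟩ := by simp [ptA, ht]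
        have hb' : ptB t = ptB ⟨0, by omega⟩ := by simp [ptB, ht]
        obtain ⟨c, hc⟩ := hb.mul_gen_of_loop hn hS (t := ⟨0, by omega⟩) h2
          (by rw [← ha, ← hp, S.par_par, hb'])
          (hd.imp_right fun hd => by rw [← ha, ← hp, S.dot_par, hd]; simp)
        simp only at hc
        rw [hc, smul_mul_assoc, mul_assoc, (tlRel_gen n).zero_mul_descZero h2, ← mul_assoc]
        exact Submodule.smul_mem _ _ (hb.desc_mem_span hn (by omega) (by omega)
          (mul_mem (hb.mem S hS) (TLRel.mem_sub (by omega) h2)))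
      · push Not at hd1
        -- A tagged good state has some cap, and each position has just been dealt with.
        have ht : S.tag = false := by
          by_contra ht
          have ht : S.tag = true := by simpa using ht
          obtain ⟨r, hr1, hr2⟩ :=
            State.exists_adjacent_of_ne_rev S.par_par S.par_ne hS.noncrossing (hS.par_ne_rev ht)
          have hlt := (S.par r).isLt
          have ha : ptA ⟨2 * n - 1 - r, by omega⟩ = S.par r := by
            ext
            simp only [ptA]
            omega
          have hb' : ptB ⟨2 * n - 1 - r, by omega⟩ = r := by
            ext
            simp only [ptB]
            omega
          by_cases h1 : (2 * n - 1 - r : ℕ) = 1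
          · exact (hd1 ⟨2 * n - 1 - r, by omega⟩ h1 (by rw [ha, hb'])).1 ht
          · exact hcap ⟨2 * n - 1 - r, by omega⟩ (by simp only; omega)
              ⟨by rw [ha, hb'], S.tag_dot ht _⟩
        refine Submodule.subset_span ⟨S.insertDot (slot hn 1) ⟨2 * n - 1, by omega⟩,
          State.Good.insertDot hn hS ht, ?_⟩
        exact extendBasis_insertDot hn ht hcap fun t h1 h2 => by simpa using (hd1 t h1 h2).2
  | zero => rw [zero_mul]; exact zero_mem _
  | add x y hx hy ihx ihy => rw [add_mul]; exact add_mem ihx ihy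
  | smul c x hx ihx => rw [smul_mul_assoc]; exact Submodule.smul_mem _ _ ihx

lemma LowerBasis.hasBasis (hb : LowerBasis hn b) : HasBasis (n + 1) := by
  refine ⟨extendBasis hn b, fun S hS => extendBasis_good hn hb hS, ?_⟩
  rw [eq_top_iff, ← span_word, Submodule.span_le]
  rintro _ ⟨w, rfl⟩
  have key : TLRel.IsCoset n (gen (n + 1)) (word w) := by
    induction w using List.reverseRecOn with
    | nil =>
      rw [word_nil, ← desc_top (gen (n + 1)) n]
      exact TLRel.isCoset_desc (by omega) le_rfl
    | append_singleton w s ih =>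
      rw [word_concat, ← gen_val]
      exact ih.mul_gen (tlRel_gen n) hn (by omega)
  generalize word w = z at key
  cases key with
  | desc y hy k h1 hk => exact hb.desc_mem_span hn h1 hk hy
  | descZero y hy => exact hb.descZero_mem_span hn hy
  | valley y hy k h1 hk => exact hb.valley_mem_span hn h1 hk hy

end ExtendBasis

lemma hasBasis {m : ℕ} (h2 : 2 ≤ m) : HasBasis m := by
  induction m, h2 using Nat.le_induction with
  | base => exact lowerBasis_one.hasBasis
  | succ m h2 ih =>
    obtain ⟨b, hb⟩ := ih.lowerBasis h2
    exact hb.hasBasis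


/-! ### Expansions into reduced words -/

lemma expand_injective_of_span {m : ℕ} {ι : Type*} {b : ι → TLD m}
    {g : ι → State (Fin (2 * m))} {s : Set ι} (hg : Set.InjOn g s)
    (h : ∀ i ∈ s, expand m (b i) = Finsupp.single (g i) 1)
    (hs : Submodule.span K (b '' s) = ⊤) : Function.Injective (expand m) := by
  obtain ⟨k, hk⟩ := exists_leftInverse_on_span (expand m) b g s hg h
  rw [hs] at hk
  exact Function.LeftInverse.injective fun x => hk x Submodule.mem_top

lemma expand_zero_injective : Function.Injective (expand 0) := by
  refine expand_injective_of_span (ι := Unit) (b := fun _ => 1) (g := fun _ => State.one 0)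
    (s := Set.univ) (fun _ _ _ _ _ => rfl) (fun _ _ => expand_one) ?_
  rw [eq_top_iff, ← span_word]
  refine Submodule.span_mono ?_
  rintro _ ⟨w, rfl⟩
  cases w with
  | nil => exact ⟨(), trivial, rfl⟩
  | cons s _ => exact s.elim0

/-- One strand is exceptional: `E 0` expands to the tagged identity, which represents no diagram, so
the basis `1, E 0` is not indexed by good states. -/
lemma expand_one_injective : Function.Injective (expand 1) := by
  refine expand_injective_of_span (ι := Bool) (b := fun i => if i then E 0 else 1)
    (g := fun i => if i then (State.one 1).tagged else State.one 1)
    (s := Set.univ) ?_ ?_ ?_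
  · intro i _ j _ h
    have := congrArg State.tag h
    revert this
    cases i <;> cases j <;> simp [State.tagged, State.one]
  · rintro i -
    cases i
    · exact expand_one
    · simp only [if_true]
      rw [← one_mul (E 0), expand_mul_E, expand_one, act_single, one_mul]
      have h0 : ptA (0 : Fin 1) = 1 := rfl
      have h1 : ptB (0 : Fin 1) = 0 := rfl
      congr 1
      ext p
      · simp [State.step, State.join, State.one, State.tagged, h0, h1]
      · fin_cases p <;> simp [State.step, State.join, State.one, State.tagged, h0, h1]
      · simp [State.step, State.join, State.one, State.tagged, h0, h1]
  · rw [eq_top_iff, ← span_word, Submodule.span_le]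
    rintro _ ⟨w, rfl⟩
    have h1 : (1 : TLD 1) ∈ Submodule.span K
        ((fun i : Bool => if i then (E 0 : TLD 1) else 1) '' Set.univ) :=
      Submodule.subset_span ⟨false, trivial, rfl⟩
    have h2 : (E 0 : TLD 1) ∈ Submodule.span K
        ((fun i : Bool => if i then (E 0 : TLD 1) else 1) '' Set.univ) :=
      Submodule.subset_span ⟨true, trivial, rfl⟩
    have h3 : word w = 1 ∨ ∃ c : K, word w = c • (E 0 : TLD 1) := by
      induction w with
      | nil => exact Or.inl rfl
      | cons s w ih =>
        have hs : s = 0 := Subsingleton.elim _ _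
        have hw : word (s :: w) = E 0 * word w := by simp [word, hs]
        right
        rcases ih with ih | ⟨c, ih⟩
        · exact ⟨1, by rw [hw, ih, mul_one, one_smul]⟩
        · have := (tlRel_gen 0).sq 0 le_rfl
          rw [gen_of_lt (by omega)] at this
          exact ⟨c * -qInt 2, by rw [hw, ih, mul_smul_comm, mul_smul]; congr 1⟩
    rcases h3 with h3 | ⟨c, h3⟩
    · rw [h3]
      exact h1
    · rw [h3]
      exact Submodule.smul_mem _ _ h2

lemma expand_injective (m : ℕ) : Function.Injective (expand m) := by
  match m with
  | 0 => exact expand_zero_injective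
  | 1 => exact expand_one_injective
  | m + 2 =>
    obtain ⟨b, h1, h2⟩ := hasBasis (m := m + 2) (by omega)
    exact expand_injective_of_span (g := id) Function.injective_id.injOn
      (fun S hS => (h1 S hS).2) h2

lemma State.Good.exists_word {m : ℕ} {S : State (Fin (2 * m))} (hS : S.Good) :
    ∃ w : List (Fin m), expand m (word w) = Finsupp.single S 1 := by
  by_cases h2 : 2 ≤ m
  · obtain ⟨b, h1, -⟩ := hasBasis h2
    obtain ⟨⟨w, hw⟩, h⟩ := h1 S hS
    exact ⟨w, hw ▸ h⟩
  · refine ⟨[], ?_⟩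
    rw [word_nil, expand_one, State.good_eq_one hS]
    funext p
    have h := S.par_ne p
    ext
    have := (S.par p).isLt
    have := p.isLt
    rw [Fin.val_rev]
    simp only [ne_eq, Fin.ext_iff] at h
    omega

/-! ### Comparing stacked diagrams with states -/

section Stack

variable {m : ℕ}

lemma Raw.stack_partner (R : Raw m) (s : Fin m) (p : Fin (2 * m)) : (R.stack s).partner p =
    if p = ptA s then ptB s else if p = ptB s then ptA s
    else if p = R.partner (ptA s) then R.partner (ptB s)
    else if p = R.partner (ptB s) then R.partner (ptA s) else R.partner p := rfl

lemma Raw.stack_dot (R : Raw m) (s : Fin m) (p : Fin (2 * m)) : (R.stack s).dot p =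
    if p = ptA s ∨ p = ptB s then decide ((s : ℕ) = 0)
    else if p = R.partner (ptA s) ∨ p = R.partner (ptB s) then
      (R.dot (ptA s) ^^ (decide ((s : ℕ) = 0) ^^ R.dot (ptB s)))
    else R.dot p := rfl

/-- The number of dotted points. -/
def Raw.dotCount (R : Raw m) : ℕ := ∑ p, (R.dot p).toNat

lemma Raw.numDots_eq (R : Raw m) : R.numDots = R.dotCount / 2 := by
  rw [numDots, dotCount, Finset.card_filter]
  congr 1
  refine Finset.sum_congr rfl fun p _ => ?_
  cases R.dot p <;> simp

/-- The state describes the multigraph `R` up to the positions of an odd number of dots. -/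
structure Matches (S : State (Fin (2 * m))) (R : Raw m) : Prop where
  par_eq : S.par = R.partner
  dot_partner : ∀ p, R.dot (R.partner p) = R.dot p
  tag_iff : S.tag = true ↔ Odd R.numDots
  dot_eq : S.tag = false → S.dot = R.dot

/-- If no loop closes, the number of dotted points changes by a multiple of `4`, so the number of
dots keeps its parity. -/
lemma dotCount_stack (S : State (Fin (2 * m))) (R : Raw m) (h : Matches S R) (s : Fin m)
    (hab : S.par (ptA s) ≠ ptB s) :
    (R.stack s).dotCount + 2 * (R.dot (ptA s)).toNat + 2 * (R.dot (ptB s)).toNat =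
      R.dotCount + 2 * (decide ((s : ℕ) = 0)).toNat +
        2 * (R.dot (ptA s) ^^ (decide ((s : ℕ) = 0) ^^ R.dot (ptB s))).toNat := by
  have h0 := ptA_ne_ptB s
  have h1 := S.par_par
  have h2 := S.par_ne
  have h3 := h.dot_partner
  have h4 := R.stack_dot s
  rw [← h.par_eq] at h3 h4
  generalize ptA s = a at *
  generalize ptB s = b at *
  have n1 : a ≠ S.par a := (h2 a).symm
  have n2 : a ≠ S.par b := fun h' => hab (by rw [h', h1])
  have n3 : b ≠ S.par a := fun h' => hab h'.symm
  have n4 : b ≠ S.par b := (h2 b).symm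
  have n5 : S.par a ≠ S.par b := fun h' => h0 (by rw [← h1 a, h', h1])
  have hT : ∀ f : Fin (2 * m) → ℕ, ∑ p ∈ ({a, b, S.par a, S.par b} : Finset _), f p =
      f a + f b + f (S.par a) + f (S.par b) := by
    intro f
    rw [Finset.sum_insert (by simp [h0, n1, n2]), Finset.sum_insert (by simp [n3, n4]),
      Finset.sum_pair n5]
    ring
  have e1 := Finset.sum_add_sum_compl ({a, b, S.par a, S.par b} : Finset _)
    fun p => (R.dot p).toNat
  have e2 := Finset.sum_add_sum_compl ({a, b, S.par a, S.par b} : Finset _)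
    fun p => ((R.stack s).dot p).toNat
  have e3 : ∑ p ∈ ({a, b, S.par a, S.par b} : Finset _)ᶜ, ((R.stack s).dot p).toNat =
      ∑ p ∈ ({a, b, S.par a, S.par b} : Finset _)ᶜ, (R.dot p).toNat := by
    refine Finset.sum_congr rfl fun p hp => ?_
    simp only [Finset.mem_compl, Finset.mem_insert, Finset.mem_singleton, not_or] at hp
    rw [h4, if_neg (by tauto), if_neg (by tauto)]
  rw [hT] at e1 e2
  rw [h4 a, h4 b, h4 (S.par a), h4 (S.par b), if_pos (Or.inl rfl), if_pos (Or.inr rfl),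
    if_neg (by simp [n1.symm, n3.symm]), if_pos (Or.inl rfl), if_neg (by simp [n2.symm, n4.symm]),
    if_pos (Or.inr rfl), e3] at e2
  rw [h3, h3] at e1
  unfold Raw.dotCount
  omega

lemma dotCount_stack_loop (S : State (Fin (2 * m))) (R : Raw m) (h : Matches S R) (s : Fin m)
    (hab : S.par (ptA s) = ptB s) :
    (R.stack s).dotCount + 2 * (R.dot (ptA s)).toNat =
      R.dotCount + 2 * (decide ((s : ℕ) = 0)).toNat := by
  have h0 := ptA_ne_ptB s
  have h1 := S.par_par
  have h3 := h.dot_partner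
  have h4 := R.stack_dot s
  rw [← h.par_eq] at h3 h4
  generalize ptA s = a at *
  generalize ptB s = b at *
  have hb : S.par b = a := by rw [← hab, h1]
  rw [hab, hb] at h4
  have e1 := Finset.sum_add_sum_compl ({a, b} : Finset _) fun p => (R.dot p).toNat
  have e2 := Finset.sum_add_sum_compl ({a, b} : Finset _) fun p => ((R.stack s).dot p).toNat
  have e3 : ∑ p ∈ ({a, b} : Finset _)ᶜ, ((R.stack s).dot p).toNat =
      ∑ p ∈ ({a, b} : Finset _)ᶜ, (R.dot p).toNat := by
    refine Finset.sum_congr rfl fun p hp => ?_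
    simp only [Finset.mem_compl, Finset.mem_insert, Finset.mem_singleton, not_or] at hp
    rw [h4, if_neg (by tauto), if_neg (by tauto)]
  rw [Finset.sum_pair h0] at e1 e2
  rw [h4 a, h4 b, if_pos (Or.inl rfl), if_pos (Or.inr rfl), e3] at e2
  have := h3 a
  rw [hab] at this
  rw [this] at e1
  unfold Raw.dotCount
  omega

/-- With loops of value `δ` excluded, the only loop that can close is a dotted one on an untagged
state. Deleting it makes the number of dots odd, exactly when the tag is set. -/
lemma Matches.step {S : State (Fin (2 * m))} {R : Raw m} (h : Matches S R) {s : Fin m}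
    (hs : ¬ (S.par (ptA s) = ptB s ∧ (S.tag = true ∨ S.dot (ptA s) = decide ((s : ℕ) = 0)))) :
    Matches (S.step s) (R.stack s) where
  par_eq := by
    funext p
    rw [R.stack_partner, ← h.par_eq]
    rfl
  dot_partner p := by
    have h1 := S.par_par
    have h2 := S.par_ne
    have h3 := h.dot_partner
    rw [R.stack_dot, R.stack_dot, R.stack_partner]
    rw [← h.par_eq] at h3 ⊢
    generalize ptA s = a
    generalize ptB s = b
    grind
  tag_iff := by
    have ht : (S.step s).tag =
      (S.tag || decide (S.par (ptA s) = ptB s ∧ S.dot (ptA s) ≠ decide ((s : ℕ) = 0))) := rfl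
    have h0 := h.tag_iff
    rw [Raw.numDots_eq] at h0 ⊢
    by_cases hab : S.par (ptA s) = ptB s
    · have h1 := dotCount_stack_loop S R h s hab
      have htag : S.tag = false := by
        by_contra h'
        exact hs ⟨hab, Or.inl (by simpa using h')⟩
      have hd : S.dot (ptA s) ≠ decide ((s : ℕ) = 0) := fun h' => hs ⟨hab, Or.inr h'⟩
      rw [ht, htag, Bool.false_or, decide_eq_true ⟨hab, hd⟩]
      rw [h.dot_eq htag] at hd
      rw [htag] at h0
      rw [Nat.odd_iff] at h0 ⊢
      revert h1 hd
      cases R.dot (ptA s) <;> cases decide ((s : ℕ) = 0) <;> simp at h0 ⊢ <;> omega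
    · have h1 := dotCount_stack S R h s hab
      rw [ht, decide_eq_false (fun h' => hab h'.1), Bool.or_false, h0, Nat.odd_iff, Nat.odd_iff]
      revert h1
      cases R.dot (ptA s) <;> cases R.dot (ptB s) <;> cases decide ((s : ℕ) = 0) <;> simp <;> omega
  dot_eq ht := by
    have htag := State.tag_of_join_tag _ _ _ _ _ ht
    funext p
    rw [R.stack_dot, ← h.dot_eq htag, ← h.par_eq]
    exact State.join_dot_of_tag _ _ _ _ _ ht p

lemma matches_one : Matches (State.one m) (Raw.one m) where
  par_eq := rfl
  dot_partner _ := rfl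
  tag_iff := by simp [State.one, Raw.numDots, Raw.one]
  dot_eq _ := rfl

end Stack

/-! ### Reduced words, their diagrams and well-defined coefficients -/

section Reduced

variable {m : ℕ}

lemma IsReduced.of_concat {w : List (Fin m)} {s : Fin m} (h : IsReduced (w ++ [s])) :
    IsReduced w := by
  intro v c hv he
  refine h (v ++ [s]) c (by simpa using hv) ?_
  rw [word_concat, word_concat, he, smul_mul_assoc]

/-- A letter that closed a loop of value `-[2]` would make the word, by injectivity of `expand`, a
multiple of the word without it. -/
lemma IsReduced.expand_word {w : List (Fin m)} (h : IsReduced w) :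
    ∃ S, expand m (word w) = Finsupp.single S 1 ∧ Matches S (w.foldl Raw.stack (Raw.one m)) := by
  induction w using List.reverseRecOn with
  | nil => exact ⟨_, expand_one, matches_one⟩
  | append_singleton w s ih =>
    obtain ⟨S, hS, hM⟩ := ih h.of_concat
    have hstep : expand m (word (w ++ [s])) = Finsupp.single (S.step s) (S.stepCoef s) := by
      rw [word_concat, expand_mul_E, hS, act_single, one_mul]
    rw [List.foldl_append]
    by_cases hs : S.par (ptA s) = ptB s ∧ (S.tag = true ∨ S.dot (ptA s) = decide ((s : ℕ) = 0))
    · refine absurd (expand_injective m ?_) (h w (-qInt 2) (by simp))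
      have h1 : S.step s = S := State.join_of_loop _ _ _ _ _ hs
      have h2 : S.stepCoef s = -qInt 2 := if_pos hs
      rw [hstep, h1, h2, map_smul, hS, Finsupp.smul_single, smul_eq_mul, mul_one]
    · have h2 : S.stepCoef s = 1 := if_neg hs
      exact ⟨S.step s, by rw [hstep, h2], hM.step hs⟩

lemma span_reduced : Submodule.span K {y : TLD m | ∃ w, IsReduced w ∧ word w = y} = ⊤ := by
  rw [eq_top_iff, ← span_word, Submodule.span_le]
  rintro _ ⟨w, rfl⟩
  induction h : w.length using Nat.strong_induction_on generalizing w with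
  | _ k ih =>
    by_cases hw : IsReduced w
    · exact Submodule.subset_span ⟨w, hw, rfl⟩
    · simp only [IsReduced, not_forall, not_not] at hw
      obtain ⟨v, c, hv, he⟩ := hw
      rw [he]
      exact Submodule.smul_mem _ _ (ih _ (h ▸ hv) v rfl)

lemma exists_isExpansion (x : TLD m) : ∃ f, IsExpansion x f := by
  have hx : x ∈ Submodule.span K {y : TLD m | ∃ w, IsReduced w ∧ word w = y} :=
    span_reduced ▸ Submodule.mem_top
  obtain ⟨f, hf, hs⟩ := Submodule.mem_span_set.1 hx
  exact ⟨f, fun y hy => hf hy, hs⟩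

/-- Every word is a nonzero multiple of a reduced word, unless it is zero. -/
lemma exists_reduced (w : List (Fin m)) (hw : word w ≠ 0) :
    ∃ (v : List (Fin m)) (c : K), IsReduced v ∧ word w = c • word v := by
  induction h : w.length using Nat.strong_induction_on generalizing w with
  | _ k ih =>
    by_cases hr : IsReduced w
    · exact ⟨w, 1, hr, (one_smul _ _).symm⟩
    · simp only [IsReduced, not_forall, not_not] at hr
      obtain ⟨v, c, hv, he⟩ := hr
      obtain ⟨u, d, hu, he'⟩ := ih _ (h ▸ hv) v (fun h0 => hw (by rw [he, h0, smul_zero])) rfl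
      exact ⟨u, c * d, hu, by rw [he, he', mul_smul]⟩

/-- The state of a diagram. -/
def Diagram.state (D : Diagram m) : State (Fin (2 * m)) where
  tag := decide (Odd D.numDots)
  par := D.partner
  dot p := !decide (Odd D.numDots) && D.dot p
  par_par := D.partner_partner
  par_ne := D.partner_ne
  dot_par p := by rw [D.dot_partner]
  tag_dot h p := by rw [h]; rfl

lemma Diagram.numDots_eq_one {D : Diagram m} (h : Odd D.numDots) : D.numDots = 1 :=
  D.dots_one_or_even.resolve_right (Nat.not_even_iff_odd.2 h)

lemma Diagram.state_good (D : Diagram m) : D.state.Good where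
  noncrossing := D.noncrossing
  outer p hp r := by
    have hp' : D.dot p = true := by
      simp only [state, Bool.and_eq_true] at hp
      exact hp.2
    have he : Even D.numDots := by
      simp only [state, Bool.and_eq_true] at hp
      simpa using hp.1
    have := D.dots_even he p hp' r
    rw [lt_min_iff, max_lt_iff] at this
    exact fun h => this ⟨⟨h.1, h.2.1⟩, h.2.2⟩
  even := by
    by_cases h : Odd D.numDots
    · simp [State.dotted, state, h]
    · have : D.state.dotted.card / 2 = D.numDots := by
        have hd : D.state.dot = D.dot := funext fun p => by simp [state, h]
        rw [State.dotted, hd]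
        rfl
      rw [this]
      exact Nat.not_odd_iff_even.1 h
  par_ne_rev h hr := by
    have h1 : D.numDots = 1 := D.numDots_eq_one (by simpa [state] using h)
    have := D.dots_identity hr
    simp [Raw.numDots, this] at h1

lemma numDots_oddDiagram {D : State (Fin (2 * m))} (hm : 1 ≤ m) :
    (oddDiagram D.par).numDots = 1 := by
  classical
  have : (Finset.univ.filter fun p => (oddDiagram D.par).dot p = true) =
      {⟨2 * m - 1, by omega⟩, D.par ⟨2 * m - 1, by omega⟩} := by
    ext p
    simp only [oddDiagram, Finset.mem_filter, Finset.mem_univ, true_and, decide_eq_true_eq,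
      Finset.mem_insert, Finset.mem_singleton]
    refine or_congr ⟨fun h => Fin.ext h, fun h => congrArg Fin.val h⟩ ⟨fun h => ?_, fun h => by
      rw [h, D.par_par]⟩
    rw [← D.par_par p]
    congr 1
    exact Fin.ext h
  rw [Raw.numDots, this, Finset.card_pair (D.par_ne _).symm]

lemma Diagram.eq_oddDiagram {D : Diagram m} (h : D.numDots = 1) :
    D.toRaw = oddDiagram D.partner := by
  have hne : ∃ p, D.dot p = true := by
    by_contra hcon
    push Not at hcon
    simp [Raw.numDots, hcon] at h
  obtain ⟨p, hp⟩ := hne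
  have key : ∀ q, IsFirstBottom D.partner q ↔ q = p ∨ q = D.partner p := by
    intro q
    have hf := D.dots_one h p hp
    have h1 := D.partner_partner
    simp only [IsFirstBottom] at hf ⊢
    constructor
    · rintro (hq | hq) <;> rcases hf with hf | hf
      · exact Or.inl (Fin.ext (by omega))
      · exact Or.inr (Fin.ext (by omega))
      · right
        rw [← h1 q]
        congr 1
        exact Fin.ext (by omega)
      · left
        rw [← h1 q, ← h1 p]
        congr 1
        exact Fin.ext (by omega)
    · rintro (rfl | rfl)
      · exact hf
      · rw [h1]
        exact hf.symm
  refine Raw.ext rfl (funext fun q => ?_)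
  rw [Bool.eq_iff_iff]
  simp only [oddDiagram, decide_eq_true_eq]
  constructor
  · exact fun hq => D.dots_one h q hq
  · intro hq
    rcases (key q).1 hq with rfl | rfl
    · exact hp
    · rw [D.dot_partner, hp]

/-- An odd number of dots is forgotten on both sides, by the single normalised dot and by the tag;
an even number is kept on both sides. -/
lemma Matches.normalize_eq_iff {S : State (Fin (2 * m))} {R : Raw m} (h : Matches S R)
    (D : Diagram m) : R.normalize = D.toRaw ↔ S = D.state := by
  constructor
  · intro hR
    by_cases ho : Odd R.numDots
    · have hm : 1 ≤ m := by
        by_contra hm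
        obtain rfl : m = 0 := by omega
        simp [Raw.numDots] at ho
      have hS : S.tag = true := h.tag_iff.2 ho
      rw [Raw.normalize, if_pos ho, ← h.par_eq] at hR
      have hD : D.numDots = 1 := by rw [← hR, numDots_oddDiagram hm]
      have ht : D.state.tag = true := by simp [Diagram.state, hD]
      ext p
      · rw [hS, ht]
      · have : D.state.par = D.partner := rfl
        rw [this, ← hR]
        rfl
      · rw [S.tag_dot hS, D.state.tag_dot ht]
    · rw [Raw.normalize, if_neg ho] at hR
      have hS : S.tag = false := by
        by_contra hS
        exact ho (h.tag_iff.1 (by simpa using hS))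
      subst hR
      ext p
      · simp [hS, Diagram.state, ho]
      · rw [h.par_eq]
        rfl
      · rw [h.dot_eq hS]
        simp [Diagram.state, ho]
  · rintro rfl
    by_cases ho : Odd D.numDots
    · have hR : Odd R.numDots := h.tag_iff.1 (by simp [Diagram.state, ho])
      rw [Raw.normalize, if_pos hR, D.eq_oddDiagram (D.numDots_eq_one ho), ← h.par_eq]
      rfl
    · have ht : D.state.tag = false := by simp [Diagram.state, ho]
      have hR : ¬ Odd R.numDots := fun h' => by
        rw [← h.tag_iff, ht] at h'
        simp at h'
      rw [Raw.normalize, if_neg hR]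
      refine Raw.ext h.par_eq.symm ?_
      rw [← h.dot_eq ht]
      funext p
      simp [Diagram.state, ho]

lemma IsReduced.diagramOf_eq_iff {w : List (Fin m)} (h : IsReduced w) (D : Diagram m) :
    diagramOf w = D.toRaw ↔ expand m (word w) = Finsupp.single D.state 1 := by
  obtain ⟨S, hS, hM⟩ := h.expand_word
  rw [diagramOf, hM.normalize_eq_iff, hS, Finsupp.single_left_inj one_ne_zero]

lemma Diagram.exists_reduced_word (D : Diagram m) :
    ∃ w : List (Fin m), IsReduced w ∧ diagramOf w = D.toRaw := by
  obtain ⟨w, hw⟩ := D.state_good.exists_word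
  obtain ⟨v, c, hv, hc⟩ := exists_reduced w fun h0 => by
    rw [h0, map_zero, eq_comm, Finsupp.single_eq_zero] at hw
    exact one_ne_zero hw
  refine ⟨v, hv, ?_⟩
  obtain ⟨S, hS, -⟩ := hv.expand_word
  rw [hv.diagramOf_eq_iff, hS]
  rw [hc, map_smul, hS, Finsupp.smul_single, smul_eq_mul, mul_one] at hw
  have := (Finsupp.single_eq_single_iff _ _ _ _).1 hw
  rcases this with ⟨rfl, -⟩ | ⟨-, h⟩
  · rfl
  · exact absurd h one_ne_zero

open Classical in
-- Different elements `E_w` with `w` reduced have different states by injectivity, so exactly one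
-- term of an expansion contributes at `D.state`, whichever expansion and word are chosen.
theorem isCoeff_iff (x : TLD m) (D : Diagram m) (a : K) :
    IsCoeff x D.toRaw a ↔ a = expand m x D.state := by
  have key : ∀ (f : TLD m →₀ K) (w : List (Fin m)), IsExpansion x f → IsReduced w →
      diagramOf w = D.toRaw → f (word w) = expand m x D.state := by
    rintro f w ⟨hf, rfl⟩ hw hD
    rw [hw.diagramOf_eq_iff] at hD
    rw [Finsupp.sum, map_sum, Finsupp.finsetSum_apply]
    have : ∀ y ∈ f.support, expand m (f y • y) D.state = if y = word w then f y else 0 := by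
      intro y hy
      obtain ⟨v, hv, rfl⟩ := hf y hy
      obtain ⟨S, hS, -⟩ := hv.expand_word
      rw [map_smul, Finsupp.smul_apply, smul_eq_mul, hS]
      split_ifs with h
      · rw [h, hD] at hS
        rw [← hS, Finsupp.single_eq_same, mul_one]
      · rw [Finsupp.single_apply, if_neg, mul_zero]
        rintro rfl
        exact h (expand_injective m (hS.trans hD.symm))
    rw [Finset.sum_congr rfl this, Finset.sum_ite_eq']
    split_ifs with h
    · rfl
    · simpa using h
  constructor
  · rintro ⟨f, hf, w, hw, hD, rfl⟩
    exact key f w hf hw hD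
  · rintro rfl
    obtain ⟨f, hf⟩ := exists_isExpansion x
    obtain ⟨w, hw, hD⟩ := D.exists_reduced_word
    exact ⟨f, hf, w, hw, hD, key f w hf hw hD⟩

lemma coef_eq (x : TLD m) (D : Diagram m) : coef x D.toRaw = expand m x D.state := by
  have h : IsCoeff x D.toRaw (coef x D.toRaw) :=
    Classical.epsilon_spec (p := fun a => IsCoeff x D.toRaw a) ⟨_, (isCoeff_iff x D _).2 rfl⟩
  exact (isCoeff_iff x D _).1 h

end Reduced


/-! ### The augmentation and the Jones--Wenzl projections -/

section Augmentation

variable {m : ℕ}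

/-- Hence the coefficient at the identity vanishes on nonempty words and serves as the augmentation.
Only on one strand could a step preserve the identity matching, and there it needs a dot or a tag.
-/
lemma State.step_ne_one (S : State (Fin (2 * m))) (s : Fin m) : S.step s ≠ State.one m := by
  intro h
  have hs := s.isLt
  have h1 : (S.step s).par (ptA s) = ptB s := State.join_par_left _ _ _ _ _
  have h2 : (S.step s).tag = true ∨ (S.step s).dot (ptA s) = decide ((s : ℕ) = 0) :=
    State.join_loop _ _ _ _ _
  rw [h] at h1 h2
  have h3 := congrArg Fin.val h1
  have h4 : (((State.one m).par (ptA s) : Fin (2 * m)) : ℕ) = 2 * m - (ptA s + 1) := Fin.val_rev _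
  have h5 : (false = true) ∨ false = decide ((s : ℕ) = 0) := h2
  rw [h4] at h3
  simp only [ptA, ptB] at h3
  have h6 : (s : ℕ) = 0 := by omega
  simp [h6] at h5

lemma expand_mul_E_one (x : TLD m) (s : Fin m) : expand m (x * E s) (State.one m) = 0 := by
  classical
  rw [expand_mul_E]
  induction expand m x using Finsupp.induction_linear with
  | zero => rw [map_zero]; rfl
  | add f g hf hg => rw [map_add, Finsupp.add_apply, hf, hg, add_zero]
  | single S c => rw [act_single, Finsupp.single_apply, if_neg (S.step_ne_one s)]

lemma expand_word_one (w : List (Fin m)) (hw : w ≠ []) : expand m (word w) (State.one m) = 0 := by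
  rcases List.eq_nil_or_concat' w with rfl | ⟨v, s, rfl⟩
  · exact absurd rfl hw
  · rw [word_concat, expand_mul_E_one]

lemma expand_one_apply : expand m 1 (State.one m) = 1 := by
  rw [expand_one, Finsupp.single_eq_same]

lemma mul_eq_of_mul_gen {X : TLD m} (hX : ∀ s, X * E s = 0) (x : TLD m) :
    X * x = expand m x (State.one m) • X := by
  have hx : x ∈ Submodule.span K (Set.range (word (m := m))) := span_word ▸ Submodule.mem_top
  induction hx using Submodule.span_induction with
  | mem x hx =>
    obtain ⟨w, rfl⟩ := hx
    cases w with
    | nil => rw [word_nil, expand_one_apply, mul_one, one_smul]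
    | cons s w =>
      rw [expand_word_one _ (by simp), zero_smul, word, List.map_cons, List.prod_cons, ← mul_assoc,
        hX, zero_mul]
  | zero => rw [map_zero, mul_zero, Finsupp.zero_apply, zero_smul]
  | add x y _ _ hx hy => rw [mul_add, hx, hy, map_add, Finsupp.add_apply, add_smul]
  | smul c x _ hx =>
    rw [mul_smul_comm, hx, map_smul, Finsupp.smul_apply, smul_eq_mul, mul_smul]

lemma mul_eq_of_gen_mul {X : TLD m} (hX : ∀ s, E s * X = 0) (x : TLD m) :
    x * X = expand m x (State.one m) • X := by
  have hx : x ∈ Submodule.span K (Set.range (word (m := m))) := span_word ▸ Submodule.mem_top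
  induction hx using Submodule.span_induction with
  | mem x hx =>
    obtain ⟨w, rfl⟩ := hx
    rcases List.eq_nil_or_concat' w with rfl | ⟨v, s, rfl⟩
    · rw [word_nil, expand_one_apply, one_mul, one_smul]
    · rw [expand_word_one _ (by simp), zero_smul, word_concat, mul_assoc, hX, mul_zero]
  | zero => rw [map_zero, zero_mul, Finsupp.zero_apply, zero_smul]
  | add x y _ _ hx hy => rw [add_mul, hx, hy, map_add, Finsupp.add_apply, add_smul]
  | smul c x _ hx =>
    rw [smul_mul_assoc, hx, map_smul, Finsupp.smul_apply, smul_eq_mul, mul_smul]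

lemma incl_refl (x : TLD m) : incl le_rfl x = x := by
  have hx : x ∈ Submodule.span K (Set.range (word (m := m))) := span_word ▸ Submodule.mem_top
  induction hx using Submodule.span_induction with
  | mem x hx =>
    obtain ⟨w, rfl⟩ := hx
    rw [word, map_list_prod, List.map_map]
    congr 2
    funext s
    exact incl_E _ s
  | zero => rw [map_zero]
  | add x y _ _ hx hy => rw [map_add, hx, hy]
  | smul c x _ hx => rw [map_smul, hx]

variable {Q : ∀ m : ℕ, TLD m}

/-- `Q m * Q m` equals `Q m`, and it also equals `Q m` scaled by its augmentation. -/
lemma IsJonesWenzl.expand_apply_one (hQ : IsJonesWenzl Q) (m : ℕ) :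
    expand m (Q m) (State.one m) = 1 := by
  have h := hQ.mul_incl m m le_rfl
  rw [incl_refl, mul_eq_of_mul_gen (hQ.mul_gen m)] at h
  exact smul_left_injective K (hQ.ne_zero m) (h.trans (one_smul K _).symm)

/-- The Jones--Wenzl projection is the only element with trace `1` on the identity diagram that is
annihilated by the generators on the right. -/
lemma IsJonesWenzl.eq_of_mul_gen (hQ : IsJonesWenzl Q) {X : TLD m} (hX : ∀ s, X * E s = 0)
    (h1 : expand m X (State.one m) = 1) : X = Q m := by
  have h := mul_eq_of_mul_gen hX (Q m)
  rw [hQ.expand_apply_one, one_smul, mul_eq_of_gen_mul (hQ.gen_mul m), h1, one_smul] at h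
  exact h.symm

end Augmentation

/-! ### Diagrams and good states -/

section GoodStates

variable {m : ℕ}

lemma Diagram.state_injective : Function.Injective (Diagram.state (m := m)) := by
  intro D D' h
  have hp : D.partner = D'.partner := congrArg State.par h
  have ht : decide (Odd D.numDots) = decide (Odd D'.numDots) := congrArg State.tag h
  have ht' : Odd D.numDots ↔ Odd D'.numDots := by simpa using ht
  apply Diagram.toRaw_injective
  by_cases ho : Odd D.numDots
  · rw [D.eq_oddDiagram (D.numDots_eq_one ho), D'.eq_oddDiagram (D'.numDots_eq_one (ht'.1 ho)), hp]
  · refine Raw.ext hp (funext fun p => ?_)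
    have := congrFun (congrArg State.dot h) p
    have ho' : ¬ Odd D'.numDots := fun h => ho (ht'.2 h)
    simpa only [state, decide_eq_false ho, decide_eq_false ho', Bool.not_false,
      Bool.true_and] using this

/-- With `Diagram.state_good` and `Diagram.state_injective` this identifies diagrams with good
states. -/
lemma State.Good.exists_diagram {S : State (Fin (2 * m))} (h : S.Good) :
    ∃ D : Diagram m, D.state = S := by
  by_cases ht : S.tag = true
  · have hm : 1 ≤ m := by
      by_contra hm
      obtain rfl : m = 0 := by omega
      exact h.par_ne_rev ht (funext fun p => p.elim0)
    have h1 := numDots_oddDiagram (D := S) hm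
    refine ⟨{ toRaw := oddDiagram S.par
              partner_partner := S.par_par
              partner_ne := S.par_ne
              noncrossing := h.noncrossing
              dot_partner := fun p => ?_
              dots_one_or_even := Or.inl h1
              dots_even := fun he => ?_
              dots_one := fun _ p hp => by simpa [oddDiagram] using hp
              dots_identity := fun hr => absurd hr (h.par_ne_rev ht) }, ?_⟩
    · have : IsFirstBottom S.par (S.par p) ↔ IsFirstBottom S.par p := by
        rw [IsFirstBottom, S.par_par]
        exact or_comm
      exact decide_eq_decide.2 this
    · rw [h1] at he
      simp at he
    · ext p
      · simp [Diagram.state, h1, ht]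
      · rfl
      · simp [Diagram.state, h1, S.tag_dot ht]
  · have ht : S.tag = false := by simpa using ht
    have he : Even (Raw.numDots ⟨S.par, S.dot⟩) := h.even
    refine ⟨{ toRaw := ⟨S.par, S.dot⟩
              partner_partner := S.par_par
              partner_ne := S.par_ne
              noncrossing := h.noncrossing
              dot_partner := S.dot_par
              dots_one_or_even := Or.inr he
              dots_even := fun _ p hp r => ?_
              dots_one := fun h1 => ?_
              dots_identity := fun hr p => ?_ }, ?_⟩
    · have := h.outer p hp r
      rw [lt_min_iff, max_lt_iff]
      exact fun h' => this ⟨h'.1.1, h'.1.2, h'.2⟩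
    · rw [h1] at he
      simp at he
    · rw [State.good_eq_one h hr]
      rfl
    · ext p
      · simp [Diagram.state, he, ht]
      · rfl
      · simp [Diagram.state, he]

/-- The coefficient at a state with an odd number of dots. -/
lemma coefOdd_eq {x : TLD m} {v : StateModule m} (hv : ∀ S, v S ≠ 0 → S.Good)
    (hc : ∀ D : Diagram m, v D.state = coef x D.toRaw) {S : State (Fin (2 * m))}
    (hS : S.tag = true) (hnc : State.NonCrossing S.par) : coefOdd x S.par = v S := by
  rw [coefOdd]
  split_ifs with h
  · by_contra h0
    exact (hv S (Ne.symm h0)).par_ne_rev hS h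
  · have hg : S.Good := by
      refine ⟨⟨hnc, fun p hp => ?_, ?_⟩, fun _ => h⟩
      · simp [S.tag_dot hS] at hp
      · simp [State.dotted, S.tag_dot hS]
    obtain ⟨D, rfl⟩ := hg.exists_diagram
    have ho : Odd D.numDots := by simpa [Diagram.state] using hS
    rw [hc, D.eq_oddDiagram (D.numDots_eq_one ho)]
    rfl

lemma eq_sum_diagrams {v : StateModule m} (hv : ∀ S, v S ≠ 0 → S.Good) :
    v = ∑ D : Diagram m, Finsupp.single D.state (v D.state) := by
  classical
  ext S
  rw [Finsupp.finsetSum_apply]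
  by_cases h : ∃ D : Diagram m, D.state = S
  · obtain ⟨D, rfl⟩ := h
    rw [Finset.sum_eq_single D]
    · rw [Finsupp.single_eq_same]
    · intro D' _ hD
      rw [Finsupp.single_apply, if_neg fun h => hD (Diagram.state_injective h)]
    · exact fun h => absurd (Finset.mem_univ _) h
  · rw [Finset.sum_eq_zero]
    · by_contra h0
      exact h (hv S h0).exists_diagram
    · intro D' _
      rw [Finsupp.single_apply, if_neg fun h' => h ⟨D', h'⟩]

end GoodStates


/-! ### The recursion -/

section Recursion

variable {n : ℕ} (hn : 1 ≤ n)

lemma Diagram.mem_positions {D : Diagram (n + 1)} {i : ℕ} : i ∈ D.positions ↔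
    i ∈ Finset.Icc 1 (n + 1) ∧ D.partner (slot hn i).u = (slot hn i).v := by
  rw [Raw.positions, Finset.mem_filter]
  refine and_congr_right fun hi => ?_
  rw [Finset.mem_Icc] at hi
  constructor
  · rintro ⟨p, h1, h2⟩
    have hp : p = (slot hn i).v := by
      ext
      simp only [slot]
      omega
    have hu : D.partner p = (slot hn i).u := by
      ext
      simp only [slot]
      omega
    rw [← hu, D.partner_partner, hp]
  · intro h
    refine ⟨(slot hn i).v, by simp only [slot]; omega, ?_⟩
    rw [← h, D.partner_partner]
    simp only [slot]
    omega

lemma Diagram.remove_eq {D : Diagram (n + 1)} {i : ℕ} (h1 : 1 ≤ i) (hi : i ≤ n + 1)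
    (h : D.partner (slot hn i).u = (slot hn i).v) :
    D.toRaw.remove i = (D.state.remove (slot hn i) h).par := by
  funext p
  have hp := p.isLt
  have hup : (slot hn i).up p =
      if (p : ℕ) < 2 * n + 1 - i then ⟨p, by omega⟩ else ⟨p + 2, by omega⟩ := by
    ext
    simp only [slot]
    split_ifs <;> first | rfl | omega
  have hr := D.state.up_down_par (slot hn i) h p
  have hpar : ∀ q, D.state.par q = D.partner q := fun _ => rfl
  have hrem : (D.state.remove (slot hn i) h).par p =
    (slot hn i).down (D.partner ((slot hn i).up p)) := rfl
  rw [hrem]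
  rw [hpar] at hr
  simp only [Raw.remove]
  rw [← hup]
  generalize D.partner ((slot hn i).up p) = r at *
  have hlt := r.isLt
  have hne1 := (slot hn i).up_ne_u ((slot hn i).down r)
  have hne2 := (slot hn i).up_ne_v ((slot hn i).down r)
  rw [hr] at hne1 hne2
  simp only [slot, ne_eq, Fin.ext_iff] at hne1 hne2
  have hlt' : (if (r : ℕ) < 2 * n + 1 - i then (r : ℕ) else r - 2) < 2 * n := by
    split_ifs <;> omega
  rw [dif_pos hlt']
  ext
  simp only [slot]
  split_ifs <;> omega

lemma insL_apply_insert {i : ℕ} (v : StateModule n) (S : State (Fin (2 * n))) :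
    insL hn i v (S.insert (slot hn i)) = v S := by
  refine Finsupp.mapDomain_apply (fun S S' h => ?_) _ _
  rw [← S.remove_insert (slot hn i) (State.insert_par_u _ _),
    ← S'.remove_insert (slot hn i) (State.insert_par_u _ _)]
  congr 1

lemma insL_apply_of_ne {i : ℕ} (v : StateModule n) {T : State (Fin (2 * (n + 1)))}
    (hT : T.par (slot hn i).u ≠ (slot hn i).v) : insL hn i v T = 0 := by
  refine Finsupp.mapDomain_of_notMem_range _ _ ?_
  rintro ⟨S, rfl⟩
  exact hT (State.insert_par_u _ _)

lemma insDotL_apply_insertDot (v : StateModule n) (S : State (Fin (2 * n))) :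
    insDotL hn v (S.insertDot (slot hn 1) ⟨2 * n - 1, by omega⟩) = v S := by
  refine Finsupp.mapDomain_apply (fun S S' h => ?_) _ _
  have h1 := S.remove_insertDot (slot hn 1) ⟨2 * n - 1, by omega⟩ (State.insertDot_par_u _ _ _)
  have h2 := S'.remove_insertDot (slot hn 1) ⟨2 * n - 1, by omega⟩ (State.insertDot_par_u _ _ _)
  rw [← S.flip_flip ⟨2 * n - 1, by omega⟩, ← S'.flip_flip ⟨2 * n - 1, by omega⟩, ← h1, ← h2]
  congr 2

lemma insDotL_apply_of_ne (v : StateModule n) {T : State (Fin (2 * (n + 1)))}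
    (hT : T.par (slot hn 1).u ≠ (slot hn 1).v) : insDotL hn v T = 0 := by
  refine Finsupp.mapDomain_of_notMem_range _ _ ?_
  rintro ⟨S, rfl⟩
  exact hT (State.insertDot_par_u _ _ _)

lemma insTagL_apply_of_ne {i : ℕ} (v : StateModule n) {T : State (Fin (2 * (n + 1)))}
    (hT : T.par (slot hn i).u ≠ (slot hn i).v) : insTagL hn i v T = 0 := by
  classical
  induction v using Finsupp.induction_linear with
  | zero => rw [map_zero]; rfl
  | add f g hf hg => rw [map_add, Finsupp.add_apply, hf, hg, add_zero]
  | single S c =>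
    rw [insTagL_single, Finsupp.single_apply, if_neg]
    rintro rfl
    exact hT (State.insert_par_u _ _)

/-- The added dotted loop erases all dots, so every diagram with the connectivity of `S`
contributes. An odd one is tagged already, and its second dotted loop gives `-[2]`. -/
lemma insTagL_apply_insert {x : TLD n} {v : StateModule n} (hv : ∀ S, v S ≠ 0 → S.Good)
    (hc : ∀ D : Diagram n, v D.state = coef x D.toRaw) {i : ℕ} {S : State (Fin (2 * n))}
    (hS : S.tag = true) : insTagL hn i v (S.insert (slot hn i)) =
      ∑ D ∈ evenLifts S.par, coef x D.toRaw - qInt 2 * v S := by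
  classical
  have key : insTagL hn i v (S.insert (slot hn i)) = ∑ D : Diagram n, if D.partner = S.par then
      v D.state * (if Odd D.numDots then -qInt 2 else 1) else 0 := by
    conv_lhs => rw [eq_sum_diagrams hv]
    rw [map_sum, Finsupp.finsetSum_apply]
    refine Finset.sum_congr rfl fun D _ => ?_
    rw [insTagL_single, Finsupp.single_apply]
    have h1 : D.state.tagged.insert (slot hn i) = S.insert (slot hn i) ↔ D.partner = S.par := by
      constructor
      · intro h
        have := S.remove_insert (slot hn i) (State.insert_par_u _ _)
        simp only [← h] at this
        rw [State.remove_insert] at this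
        rw [← this]
        rfl
      · intro h
        congr 1
        ext p
        · exact hS.symm
        · exact congrArg Fin.val (congrFun h p)
        · rw [S.tag_dot hS]
          rfl
    have h2 : D.state.tag = true ↔ Odd D.numDots := by simp [Diagram.state]
    simp only [h1, h2]
  have hodd : ∑ D : Diagram n with D.partner = S.par ∧ Odd D.numDots, v D.state = v S := by
    have hmem : ∀ D : Diagram n, (D.partner = S.par ∧ Odd D.numDots) ↔ D.state = S := by
      intro D
      constructor
      · rintro ⟨h1, h2⟩
        have ht : D.state.tag = true := by simp [Diagram.state, h2]
        ext p
        · rw [ht, hS]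
        · exact congrArg Fin.val (congrFun h1 p)
        · rw [S.tag_dot hS, D.state.tag_dot ht]
      · rintro rfl
        exact ⟨rfl, by simpa [Diagram.state] using hS⟩
    simp only [hmem]
    by_cases h : ∃ D : Diagram n, D.state = S
    · obtain ⟨D, rfl⟩ := h
      rw [Finset.sum_filter, Finset.sum_eq_single D]
      · rw [if_pos rfl]
      · intro D' _ hD
        exact if_neg fun h => hD (Diagram.state_injective h)
      · exact fun h => absurd (Finset.mem_univ _) h
    · rw [Finset.filter_false_of_mem fun D _ hD => h ⟨D, hD⟩, Finset.sum_empty, eq_comm]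
      by_contra h0
      exact h (hv S h0).exists_diagram
  have heven : ∑ D ∈ evenLifts S.par, coef x D.toRaw =
      ∑ D : Diagram n with D.partner = S.par ∧ Even D.numDots, v D.state := by
    rw [evenLifts]
    refine Finset.sum_congr ?_ fun D _ => (hc D).symm
    ext D
    simp
  rw [key, heven, ← hodd, Finset.mul_sum, Finset.sum_filter, Finset.sum_filter,
    ← Finset.sum_sub_distrib]
  refine Finset.sum_congr rfl fun D _ => ?_
  by_cases h1 : D.partner = S.par <;> by_cases h2 : Odd D.numDots
  · have h3 : ¬ Even D.numDots := Nat.not_even_iff_odd.2 h2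
    simp only [h1, h2, h3, and_true, and_false, if_true, if_false]
    ring
  · have h3 : Even D.numDots := Nat.not_odd_iff_even.1 h2
    simp only [h1, h2, h3, and_true, and_false, if_true, if_false]
    ring
  · simp [h1]
  · simp [h1]

lemma expand_mul_cosetSum {P : TLD (n + 1)} {v : StateModule n}
    (hP : expand (n + 1) P = insL hn (n + 1) v) (cg ch : ℕ → K) :
    expand (n + 1) (P * TLRel.cosetSum n (gen (n + 1)) cg ch) =
      ∑ i ∈ Finset.Icc 1 (n + 1), cg i • insL hn i v + cg 1 • insDotL hn v +
        ∑ i ∈ Finset.Icc 1 n, ch i • insTagL hn i v := by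
  rw [TLRel.cosetSum, mul_add P, mul_add P, map_add, map_add, Finset.mul_sum, Finset.mul_sum,
    map_sum, map_sum]
  congr 1
  · congr 1
    swap
    · rw [mul_smul_comm, map_smul, expand_mul_descZero hn hP]
    refine Finset.sum_congr rfl fun i hi => ?_
    rw [Finset.mem_Icc] at hi
    rw [mul_smul_comm, map_smul, expand_mul_desc hn hP hi.1 hi.2]
  · refine Finset.sum_congr rfl fun i hi => ?_
    rw [Finset.mem_Icc] at hi
    rw [mul_smul_comm, map_smul, expand_mul_valley hn hP hi.1 hi.2]

lemma one_par_slot {i : ℕ} (h1 : 1 ≤ i) (hi : i ≤ n) :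
    (State.one (n + 1)).par (slot hn i).u ≠ (slot hn i).v := by
  intro h
  have h2 := congrArg Fin.val h
  have h3 : (((State.one (n + 1)).par (slot hn i).u : Fin (2 * (n + 1))) : ℕ) =
    2 * (n + 1) - ((slot hn i).u + 1) := Fin.val_rev _
  rw [h3] at h2
  simp only [slot] at h2
  omega

variable {Q : ∀ m : ℕ, TLD m}

/-- The data needed from `Q n`: it is annihilated by the generators, and its expansion. -/
lemma IsJonesWenzl.exists_lower (hQ : IsJonesWenzl Q) :
    ∃ (P : TLD (n + 1)) (v : StateModule n),
      (2 ≤ n → ∀ t < n, P * gen (n + 1) t = 0) ∧ expand (n + 1) P = insL hn (n + 1) v ∧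
      v (State.one n) = 1 ∧ (∀ S, v S ≠ 0 → S.Good) ∧
      ∀ D : Diagram n, v D.state = coef (Q n) D.toRaw := by
  classical
  rcases hn.eq_or_lt with rfl | h2
  -- `Q 1` itself is not used: its `E 0` component is the tagged identity, which is no diagram. With
  -- `P = 1` the term in `E 0` is supplied by the coset sum.
  · refine ⟨1, Finsupp.single (State.one 1) 1, fun h => by omega, ?_, Finsupp.single_eq_same,
      fun S hS => ?_, fun D => ?_⟩
    · rw [expand_one_succ hn, expand_one]
    · rw [Finsupp.single_apply] at hS
      split_ifs at hS with h
      · exact h ▸ State.good_one 1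
      · exact absurd rfl hS
    · have hr : D.state.par = Fin.rev := by
        funext p
        have h := D.state.par_ne p
        ext
        have := (D.state.par p).isLt
        have := p.isLt
        rw [Fin.val_rev]
        simp only [ne_eq, Fin.ext_iff] at h
        omega
      rw [coef_eq, State.good_eq_one D.state_good hr, hQ.expand_apply_one, Finsupp.single_eq_same]
  · obtain ⟨b, hb, hs⟩ := hasBasis h2
    refine ⟨incl (Nat.le_succ n) (Q n), expand n (Q n), fun _ t ht => ?_, expand_incl hn h2 _,
      hQ.expand_apply_one n, fun S hS => ?_, fun D => (coef_eq _ D).symm⟩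
    · rw [← incl_gen ⟨t, ht⟩, ← map_mul, hQ.mul_gen, map_zero]
    · have hx : Q n ∈ Submodule.span K (b '' {S | S.Good}) := hs ▸ Submodule.mem_top
      by_contra hg
      refine hS ?_
      clear hS
      generalize Q n = x at hx
      induction hx using Submodule.span_induction with
      | mem x hx =>
        obtain ⟨S', hS', rfl⟩ := hx
        rw [(hb S' hS').2, Finsupp.single_apply, if_neg]
        rintro rfl
        exact hg hS'
      | zero => rw [map_zero]; rfl
      | add x y _ _ hx hy => rw [map_add, Finsupp.add_apply, hx, hy, add_zero]
      | smul c x _ hx => rw [map_smul, Finsupp.smul_apply, hx, smul_zero]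

/-- The expansion of a Jones--Wenzl projection in terms of the previous one. -/
lemma IsJonesWenzl.expand_succ (hQ : IsJonesWenzl Q) {P : TLD (n + 1)} {v : StateModule n}
    (hP0 : 2 ≤ n → ∀ t < n, P * gen (n + 1) t = 0) (hP : expand (n + 1) P = insL hn (n + 1) v)
    (hv : v (State.one n) = 1) : expand (n + 1) (Q (n + 1)) =
      ∑ i ∈ Finset.Icc 1 (n + 1), coefG n i • insL hn i v + coefG n 1 • insDotL hn v +
        ∑ i ∈ Finset.Icc 1 n, coefH n i • insTagL hn i v := by
  rw [← expand_mul_cosetSum hn hP]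
  congr 1
  refine (hQ.eq_of_mul_gen (fun s => ?_) ?_).symm
  · rw [← gen_val]
    exact (tlRel_gen n).cosetSum_mul_gen hP0 (coefRel n) hn (by omega)
  · rw [expand_mul_cosetSum hn hP, Finsupp.add_apply, Finsupp.add_apply, Finsupp.finsetSum_apply,
      Finsupp.finsetSum_apply, Finsupp.smul_apply,
      insDotL_apply_of_ne hn v (one_par_slot hn le_rfl hn), smul_zero, add_zero, Finset.sum_eq_zero (s := Finset.Icc 1 n) fun i hi => ?_, add_zero,
      Finset.sum_eq_single (n + 1)]
    -- The identity occurs only in the term `i = n + 1`, whose coefficient is `1`.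
    · rw [Finsupp.smul_apply, coefG_top hn, one_smul, ← State.insert_one hn, insL_apply_insert, hv]
    · intro i hi hne
      rw [Finset.mem_Icc] at hi
      rw [Finsupp.smul_apply, insL_apply_of_ne hn v (one_par_slot hn hi.1 (by omega)), smul_zero]
    · intro h
      exact absurd (Finset.mem_Icc.2 ⟨by omega, le_rfl⟩) h
    · rw [Finset.mem_Icc] at hi
      rw [Finsupp.smul_apply, insTagL_apply_of_ne hn v (one_par_slot hn hi.1 hi.2), smul_zero]

lemma IsJonesWenzl.coef_succ (hQ : IsJonesWenzl Q) (hn : 1 ≤ n) (D : Diagram (n + 1))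
    (hD : D.numDots = 1) :
    coef (Q (n + 1)) D.toRaw =
      ∑ i ∈ D.positions,
          coefH n i * ((∑ D' ∈ evenLifts (D.remove i), coef (Q n) D'.toRaw) -
            qInt 2 * coefOdd (Q n) (D.remove i)) +
        ∑ i ∈ D.positions,
          (if i = 1 then 2 else 1) * coefG n i * coefOdd (Q n) (D.remove i) := by
  classical
  obtain ⟨P, v, hP0, hP, hv1, hv, hc⟩ := hQ.exists_lower hn
  have hT : D.state.tag = true := by simp [Diagram.state, hD]
  have hgood := D.state_good
  have hin : ∀ i ∈ D.positions, insL hn i v D.state = coefOdd (Q n) (D.remove i) ∧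
      insTagL hn i v D.state = (∑ D' ∈ evenLifts (D.remove i), coef (Q n) D'.toRaw) -
        qInt 2 * coefOdd (Q n) (D.remove i) ∧
      (i = 1 → insDotL hn v D.state = coefOdd (Q n) (D.remove i)) := by
    intro i hi
    obtain ⟨h1, hp⟩ := (Diagram.mem_positions hn).1 hi
    rw [Finset.mem_Icc] at h1
    rw [Diagram.remove_eq hn h1.1 h1.2 hp]
    have hins := D.state.insert_remove (slot hn i) hp (D.state.tag_dot hT _)
    set S := D.state.remove (slot hn i) hp
    have hS : S.tag = true := hT
    have hnc : State.NonCrossing S.par := by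
      rw [← State.nonCrossing_insert hn i, hins]
      exact hgood.noncrossing
    rw [coefOdd_eq hv hc hS hnc]
    refine ⟨?_, ?_, ?_⟩
    · rw [← hins, insL_apply_insert]
    · rw [← hins, insTagL_apply_insert hn hv hc hS]
    · rintro rfl
      -- The tagged state also arises from the dotted cap, so position `1` is counted a second time.
      rw [← hins, ← State.insertDot_of_tag _ ⟨2 * n - 1, by omega⟩ _ hS, insDotL_apply_insertDot]
  have hout : ∀ i ∈ Finset.Icc 1 (n + 1), i ∉ D.positions →
      D.state.par (slot hn i).u ≠ (slot hn i).v :=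
    fun i h1 h2 h3 => h2 ((Diagram.mem_positions hn).2 ⟨h1, h3⟩)
  have hsub : D.positions ⊆ Finset.Icc 1 (n + 1) := Finset.filter_subset _ _
  have e1 : ∑ i ∈ Finset.Icc 1 (n + 1), coefG n i * insL hn i v D.state =
      ∑ i ∈ D.positions, coefG n i * coefOdd (Q n) (D.remove i) := by
    rw [← Finset.sum_subset hsub fun i h1 h2 => ?_]
    · exact Finset.sum_congr rfl fun i hi => by rw [(hin i hi).1]
    · rw [insL_apply_of_ne hn v (hout i h1 h2), mul_zero]
  have e2 : coefG n 1 * insDotL hn v D.state =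
      ∑ i ∈ D.positions, if i = 1 then coefG n i * coefOdd (Q n) (D.remove i) else 0 := by
    rw [Finset.sum_ite_eq' D.positions 1 fun i => coefG n i * coefOdd (Q n) (D.remove i)]
    split_ifs with h
    · rw [(hin 1 h).2.2 rfl]
    · rw [insDotL_apply_of_ne hn v (hout 1 (by simp) h), mul_zero]
  have e3 : ∑ i ∈ Finset.Icc 1 n, coefH n i * insTagL hn i v D.state =
      ∑ i ∈ D.positions, coefH n i * ((∑ D' ∈ evenLifts (D.remove i), coef (Q n) D'.toRaw) -
        qInt 2 * coefOdd (Q n) (D.remove i)) := by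
    -- There is no valley for `i = n + 1`, but `coefH n (n + 1) = 0` lets the sum run over all
    -- positions.
    have : ∑ i ∈ Finset.Icc 1 n, coefH n i * insTagL hn i v D.state =
        ∑ i ∈ Finset.Icc 1 (n + 1), coefH n i * insTagL hn i v D.state := by
      rw [Finset.sum_Icc_succ_top (by omega), coefH_top, zero_mul, add_zero]
    rw [this, ← Finset.sum_subset hsub fun i h1 h2 => ?_]
    · exact Finset.sum_congr rfl fun i hi => by rw [(hin i hi).2.1]
    · rw [insTagL_apply_of_ne hn v (hout i h1 h2), mul_zero]
  rw [coef_eq, hQ.expand_succ hn hP0 hP hv1, Finsupp.add_apply, Finsupp.add_apply,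
    Finsupp.finsetSum_apply, Finsupp.finsetSum_apply]
  simp only [Finsupp.smul_apply, smul_eq_mul]
  rw [e1, e2, e3, ← Finset.sum_add_distrib, add_comm]
  congr 1
  refine Finset.sum_congr rfl fun i _ => ?_
  split_ifs <;> ring

end Recursion

lemma Diagram.numDots_ne_one (D : Diagram 1) : D.numDots ≠ 1 := by
  intro h
  have hr : D.partner = Fin.rev := by
    funext p
    have h := D.partner_ne p
    ext
    have := (D.partner p).isLt
    have := p.isLt
    rw [Fin.val_rev]
    simp only [ne_eq, Fin.ext_iff] at h
    omega
  have := D.dots_identity hr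
  simp [Raw.numDots, this] at h

end

end TLTypeD

theorem mainTheorem6 (Q : ∀ m : ℕ, TLD m) (hQ : IsJonesWenzl Q) :
    (∀ (m : ℕ) (D : Diagram m), ∃! a : K, IsCoeff (Q m) D.toRaw a) ∧
    ∀ (n : ℕ) (D : Diagram (n + 1)), D.numDots = 1 →
      coef (Q (n + 1)) D.toRaw =
        ∑ i ∈ D.positions,
            coefH n i *
              ((∑ D' ∈ evenLifts (D.remove i), coef (Q n) D'.toRaw) -
                qInt 2 * coefOdd (Q n) (D.remove i)) +
          ∑ i ∈ D.positions,
            (if i = 1 then 2 else 1) * coefG n i * coefOdd (Q n) (D.remove i) := by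
  refine ⟨fun m D => ⟨_, (isCoeff_iff _ D _).2 rfl, fun a ha => (isCoeff_iff _ D a).1 ha⟩,
    fun n D hD => ?_⟩
  rcases Nat.eq_zero_or_pos n with rfl | hn
  -- The only diagram on one strand is the undotted identity.
  · exact absurd hD D.numDots_ne_one
  · exact hQ.coef_succ hn D hD
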